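/- Let $X$ be a smooth $n$-dimensional manifold (Hausdorff, second countable, without boundary), and let $\mathcal A^{\mathrm{even}}(X)$ and $\mathcal A^{\mathrm{odd}}(X)$ be the spaces of smooth complex differential forms on $X$ of even and of odd degree. For a connection $\nabla=d+A$ on a trivial complex vector bundle $V$ of rank $r$ ($A$ an $r\times r$ matrix of smooth complex $1$-forms), with curvature $\nabla^2=dA+A\wedge A$, let $$\mathrm{ch}(V,\nabla)=\mathrm{Tr}\exp\Big(\frac{\sqrt{-1}}{2\pi}\nabla^2\Big)$$ be its Chern character form. For two connections $\nabla^0,\nabla^1$ on $V=X\times\mathbb C^r$, let $\tilde\nabla$ be any connection on the bundle $X\times S^1\times\mathbb C^r$ over $X\times S^1$ whose restrictions to $X\times\{e^{i\theta}\}$ for $\theta=0$ and $\theta=\pi$ are $\nabla^0$ and $\nabla^1$, let $g(\theta)=0$ for $0\le\theta<\pi$ and $g(\theta)=1$ for $\pi\le\theta<2\pi$, and put $$\mathrm{cs}(\nabla^1,\nabla^0)=\int_{S^1}g(\theta)\,\mathrm{ch}(\tilde\nabla)\in\mathcal A^{\mathrm{odd}}(X)$$ (integration over the fibres of $X\times S^1\to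 X$, with $d\theta$ written last, so that $d\,\mathrm{cs}(\nabla^1,\nabla^0)=\mathrm{ch}(\nabla^1)-\mathrm{ch}(\nabla^0)$). The Chern–Simons class $\mathrm{CS}(\nabla^1,\nabla^0)$ is the class of $\mathrm{cs}(\nabla^1,\nabla^0)$ in $\mathcal A^{\mathrm{odd}}(X)/d\mathcal A^{\mathrm{even}}(X)$; it does not depend on the choice of $\tilde\nabla$. Then for every $\alpha\in\mathcal A^{\mathrm{odd}}(X)/d\mathcal A^{\mathrm{even}}(X)$ there are a trivial vector bundle $V=X\times\mathbb C^r$ and a connection $\nabla$ on $V$ such that $$\mathrm{CS}(\nabla,d)=\alpha,$$ where $d$ is the trivial connection on $V$; that is, connections $\tilde\nabla$ as above exist for the pair $(\nabla,d)$, and for each of them the form $\int_{S^1}g(\theta)\,\mathrm{ch}(\tilde\nabla)$ is smooth and represents $\alpha$. -/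

import Mathlib

open scoped Manifold ContDiff

noncomputable section

namespace ChernSimons

/-! ### Differential forms on manifolds -/

section Forms

variable {E : Type*} [NormedAddCommGroup E] [NormedSpace ℝ E]
  {H : Type*} [TopologicalSpace H] (I : ModelWithCorners ℝ E H)
  (M : Type*) [TopologicalSpace M] [ChartedSpace H M]

/-- Complex-valued differential `k`-forms on `M`, with no regularity imposed: an alternating
`ℝ`-multilinear map `(T_x M)^k → ℂ` for every point `x`. -/
abbrev Form (k : ℕ) : Type _ := ∀ x : M, TangentSpace I x [⋀^Fin k]→L[ℝ] ℂ

variable {I M}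

/-- The expression of the form `η` in the preferred chart `φ` around `x₀`, that is, the pullback
of `η` under `φ⁻¹`, a form on the model vector space `E` (meaningful on the target of `φ`). -/
def Form.inChart {k : ℕ} (η : Form I M k) (x₀ : M) : E → E [⋀^Fin k]→L[ℝ] ℂ := fun y =>
  (η ((extChartAt I x₀).symm y)).compContinuousLinearMap
    (mfderivWithin 𝓘(ℝ, E) I (extChartAt I x₀).symm (Set.range I) y)

/-- A form is smooth if its expressions in the charts are smooth. -/
def Form.IsSmooth {k : ℕ} (η : Form I M k) : Prop :=
  ∀ x₀ : M, ContDiffOn ℝ ∞ (Form.inChart η x₀) (extChartAt I x₀).target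

/-- The exterior derivative, computed at `x` in the preferred chart around `x`. The normalization
is the one for which `dη (v, w) = v (η w) - w (η v)` for commuting vector fields. -/
def Form.d {k : ℕ} (η : Form I M k) : Form I M (k + 1) := fun x =>
  (extDerivWithin (Form.inChart η x) (Set.range I) (extChartAt I x x)).compContinuousLinearMap
    (mfderiv I 𝓘(ℝ, E) (extChartAt I x) x)

/-- The continuous multilinear map `v ↦ α (v_1, …, v_m) * β (v_{m+1}, …, v_{m+n})`. -/
def mulForm {V : Type*} [AddCommGroup V] [Module ℝ V] [TopologicalSpace V] {m n : ℕ}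
    (α : V [⋀^Fin m]→L[ℝ] ℂ) (β : V [⋀^Fin n]→L[ℝ] ℂ) :
    ContinuousMultilinearMap ℝ (fun _ : Fin (m + n) => V) ℂ where
  toMultilinearMap := (LinearMap.mul' ℝ ℂ).compMultilinearMap
    ((α.toMultilinearMap.domCoprod β.toMultilinearMap).domDomCongr finSumFinEquiv)
  cont := by
    change Continuous fun v : Fin (m + n) → V =>
      α (fun i => v (Fin.castAdd n i)) * β (fun j => v (Fin.natAdd m j))
    exact (α.cont.comp (by fun_prop)).mul (β.cont.comp (by fun_prop))

theorem mulForm_apply {V : Type*} [AddCommGroup V] [Module ℝ V] [TopologicalSpace V] {m n : ℕ}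
    (α : V [⋀^Fin m]→L[ℝ] ℂ) (β : V [⋀^Fin n]→L[ℝ] ℂ) (v : Fin (m + n) → V) :
    mulForm α β v = α (fun i => v (Fin.castAdd n i)) * β (fun j => v (Fin.natAdd m j)) := rfl

/-- The wedge product of forms,
`(α ∧ β)(v) = 1/(m! n!) ∑_σ sign(σ) α(v_σ(1), …, v_σ(m)) β(v_σ(m+1), …, v_σ(m+n))`. -/
def Form.wedge {m n : ℕ} (α : Form I M m) (β : Form I M n) : Form I M (m + n) := fun x =>
  ((m.factorial * n.factorial : ℂ)⁻¹) •
    ContinuousMultilinearMap.alternatization (mulForm (α x) (β x))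

/-- The pullback of a form under a map `f`. -/
def Form.pullback {E' : Type*} [NormedAddCommGroup E'] [NormedSpace ℝ E']
    {H' : Type*} [TopologicalSpace H'] {J : ModelWithCorners ℝ E' H'}
    {N : Type*} [TopologicalSpace N] [ChartedSpace H' N] {k : ℕ}
    (f : M → N) (η : Form J N k) : Form I M k := fun x =>
  (η (f x)).compContinuousLinearMap (mfderiv I J f x)

theorem Form.inChart_add {k : ℕ} (α β : Form I M k) (x₀ : M) :
    Form.inChart (α + β) x₀ = Form.inChart α x₀ + Form.inChart β x₀ := rfl

theorem Form.inChart_smul {k : ℕ} (c : ℂ) (α : Form I M k) (x₀ : M) :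
    Form.inChart (c • α) x₀ = c • Form.inChart α x₀ := rfl

theorem Form.inChart_zero {k : ℕ} (x₀ : M) :
    Form.inChart (0 : Form I M k) x₀ = 0 := rfl

variable (I M) in
/-- The complex vector space `𝒜^k(M)` of smooth complex `k`-forms. -/
def SmoothForm (k : ℕ) : Submodule ℂ (Form I M k) where
  carrier := {η | Form.IsSmooth η}
  add_mem' := fun {α β} hα hβ x₀ => by
    rw [Form.inChart_add]; exact (hα x₀).add (hβ x₀)
  zero_mem' := fun x₀ => by rw [Form.inChart_zero]; exact contDiffOn_const
  smul_mem' := fun c α hα x₀ => by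
    rw [Form.inChart_smul]; exact (hα x₀).const_smul c

theorem Form.IsSmooth.differentiableWithinAt {k : ℕ} {η : Form I M k} (h : Form.IsSmooth η) (x : M) :
    DifferentiableWithinAt ℝ (Form.inChart η x) (Set.range I) (extChartAt I x x) :=
  (((h x).contDiffWithinAt (mem_extChartAt_target x)).differentiableWithinAt (by simp)).mono_of_mem_nhdsWithin
    (extChartAt_target_mem_nhdsWithin x)

theorem Form.d_add {k : ℕ} {α β : Form I M k} (hα : Form.IsSmooth α) (hβ : Form.IsSmooth β) :
    Form.d (α + β) = Form.d α + Form.d β := by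
  funext x
  simp only [Form.d, Form.inChart_add]
  rw [extDerivWithin_add (I.uniqueDiffOn _ (by simp)) (hα.differentiableWithinAt x)
    (hβ.differentiableWithinAt x)]
  rfl

theorem Form.d_smul {k : ℕ} (c : ℂ) {α : Form I M k} (hα : Form.IsSmooth α) :
    Form.d (c • α) = c • Form.d α := by
  funext x
  simp only [Form.d, Form.inChart_smul, extDerivWithin]
  rw [fderivWithin_const_smul (I.uniqueDiffOn _ (by simp)) (hα.differentiableWithinAt x),
    ContinuousAlternatingMap.alternatizeUncurryFin_smul]
  rfl

theorem Form.d_zero {k : ℕ} : Form.d (0 : Form I M k) = 0 := by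
  funext x
  have h : fderivWithin ℝ (0 : E → E [⋀^Fin k]→L[ℝ] ℂ) (Set.range I) (extChartAt I x x) = 0 := by
    simp
  have h' : ContinuousAlternatingMap.alternatizeUncurryFin
      (0 : E →L[ℝ] E [⋀^Fin k]→L[ℝ] ℂ) = 0 := by
    ext v
    simp [ContinuousAlternatingMap.alternatizeUncurryFin_apply]
  simp only [Form.d, Form.inChart_zero, extDerivWithin, h, h']
  rfl

variable (I M)

/-- `𝒜^odd(M)`: the component of index `k` is the part of degree `2k + 1`. On a
finite-dimensional manifold all but finitely many of these spaces vanish, so that the product is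
the direct sum. -/
def OddForm : Type _ := ∀ k : ℕ, SmoothForm I M (2 * k + 1)

instance : AddCommGroup (OddForm I M) :=
  inferInstanceAs (AddCommGroup (∀ k : ℕ, SmoothForm I M (2 * k + 1)))

instance : Module ℂ (OddForm I M) :=
  inferInstanceAs (Module ℂ (∀ k : ℕ, SmoothForm I M (2 * k + 1)))

/-- `𝒜^even(M)`: the component of index `k` is the part of degree `2k`. -/
abbrev EvenForm : Type _ := ∀ k : ℕ, SmoothForm I M (2 * k)

/-- The subspace `d 𝒜^even(M)` of `𝒜^odd(M)`. -/
def exactOdd : Submodule ℂ (OddForm I M) where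
  carrier := {α | ∃ β : EvenForm I M, ∀ k, (α k : Form I M (2 * k + 1)) = Form.d (β k : Form I M (2 * k))}
  add_mem' := by
    rintro α α' ⟨β, hβ⟩ ⟨β', hβ'⟩
    refine ⟨β + β', fun k => ?_⟩
    have h := Form.d_add (β k).2 (β' k).2
    rw [← hβ k, ← hβ' k] at h
    exact h.symm
  zero_mem' := ⟨0, fun _ => Form.d_zero.symm⟩
  smul_mem' := by
    rintro c α ⟨β, hβ⟩
    refine ⟨c • β, fun k => ?_⟩
    have h := Form.d_smul c (β k).2
    rw [← hβ k] at h
    exact h.symm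

/-- The quotient `𝒜^odd(M) / d 𝒜^even(M)`. -/
abbrev OddFormModExact : Type _ := OddForm I M ⧸ exactOdd I M

end Forms

/-! ### Connections on trivial bundles and the Chern character form -/

section Connections

variable {E : Type*} [NormedAddCommGroup E] [NormedSpace ℝ E]
  {H : Type*} [TopologicalSpace H] (I : ModelWithCorners ℝ E H)
  (M : Type*) [TopologicalSpace M] [ChartedSpace H M]

/-- A connection `∇ = d + A` on the trivial complex vector bundle `M × ℂ^r`, given by its
connection form: `A` is an `r × r` matrix of smooth complex `1`-forms, and the covariant
derivative of a section `s : M → ℂ^r` is `(∇ s)_i = d s_i + ∑_j A_ij s_j`. -/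
structure Connection (r : ℕ) where
  /-- The connection form `A`. -/
  form : Matrix (Fin r) (Fin r) (SmoothForm I M 1)

/-- The trivial connection `d`. -/
def Connection.trivial (r : ℕ) : Connection I M r := ⟨0⟩

variable {I M} {r : ℕ}

/-- The product of matrices of forms, with entries multiplied by the wedge product. -/
def matWedge {m n : ℕ} (P : Matrix (Fin r) (Fin r) (Form I M m))
    (Q : Matrix (Fin r) (Fin r) (Form I M n)) : Matrix (Fin r) (Fin r) (Form I M (m + n)) :=
  Matrix.of fun i j => ∑ l, (P i l).wedge (Q l j)

/-- The curvature `∇² = dA + A ∧ A`, a matrix of `2`-forms. -/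
def Connection.curvature (c : Connection I M r) : Matrix (Fin r) (Fin r) (Form I M 2) :=
  Matrix.of fun i j => Form.d (c.form i j : Form I M 1) +
    matWedge (fun a b => (c.form a b : Form I M 1)) (fun a b => (c.form a b : Form I M 1)) i j

/-- The identity matrix, as a matrix of `0`-forms. -/
def matOne : Matrix (Fin r) (Fin r) (Form I M 0) :=
  Matrix.of fun i j x =>
    ContinuousAlternatingMap.constOfIsEmpty ℝ (TangentSpace I x) (Fin 0) (if i = j then 1 else 0)

/-- The powers `(∇²)^k`, matrices of `2k`-forms. -/
def Connection.curvaturePow (c : Connection I M r) :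
    ∀ k : ℕ, Matrix (Fin r) (Fin r) (Form I M (2 * k))
  | 0 => matOne
  | k + 1 => matWedge (c.curvaturePow k) c.curvature

/-- The part of degree `2k` of the Chern character form `ch(∇) = Tr exp((√-1 / 2π) ∇²)`, namely
`1/k! (√-1 / 2π)^k Tr ((∇²)^k)`. -/
def Connection.ch (c : Connection I M r) (k : ℕ) : Form I M (2 * k) :=
  ((k.factorial : ℂ)⁻¹ * (Complex.I / (2 * Real.pi)) ^ k) • ∑ i, c.curvaturePow k i i

end Connections

/-! ### Fibre integration along `M × S¹ → M` and the Chern–Simons class -/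

section CS

variable {E : Type*} [NormedAddCommGroup E] [NormedSpace ℝ E]
  {H : Type*} [TopologicalSpace H] {I : ModelWithCorners ℝ E H}
  {M : Type*} [TopologicalSpace M] [ChartedSpace H M]

/-- The inclusion `i_θ : M → M × S¹`, `x ↦ (x, e^{iθ})`. -/
def incl (θ : ℝ) (x : M) : M × Circle := (x, Circle.exp θ)

variable (I) in
/-- The coordinate vector `∂/∂θ` at the point `(x, e^{iθ})` of `M × S¹`. -/
def dTheta (x : M) (θ : ℝ) : TangentSpace (I.prod (𝓡 1)) (incl θ x) :=
  mfderiv 𝓘(ℝ, ℝ) (I.prod (𝓡 1)) (fun t : ℝ => incl t x) θ (1 : ℝ)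

/-- The value at `v_1, …, v_k ∈ T_x M` of the integral `∫_{S¹} g(θ) η` over the fibre of
`M × S¹ → M`, where `η` is a form of degree `k + 1`. The sign convention is the one in which
`dθ` is written last: `∫_{S¹} (β ∧ f dθ) = (∫_0^{2π} f dθ) β` for forms `β` on `M`. -/
def fibreIntegral {k : ℕ} (g : ℝ → ℝ) (η : Form (I.prod (𝓡 1)) (M × Circle) (k + 1)) (x : M)
    (v : Fin k → TangentSpace I x) : ℂ :=
  ∫ θ in (0 : ℝ)..(2 * Real.pi), (g θ : ℂ) *
    η (incl θ x) (Fin.snoc (α := fun _ => TangentSpace (I.prod (𝓡 1)) (incl θ x))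
      (fun j => mfderiv I (I.prod (𝓡 1)) (incl θ) x (v j)) (dTheta I x θ))

/-- The step function on the circle which is `0` on `[0, π)` and `1` on `[π, 2π)`
(only its values on `[0, 2π]` matter). -/
def step (θ : ℝ) : ℝ := if θ < Real.pi then 0 else 1

variable {r : ℕ}

/-- `c'` is a connection on the bundle `M × S¹ × ℂ^r` that restricts to `c₀` at `θ = 0` and to
`c₁` at `θ = π`. -/
def Interpolates (c' : Connection (I.prod (𝓡 1)) (M × Circle) r) (c₁ c₀ : Connection I M r) :
    Prop :=
  ∀ i j, Form.pullback (I := I) (incl 0) (c'.form i j : Form (I.prod (𝓡 1)) (M × Circle) 1) = c₀.form i j ∧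
    Form.pullback (I := I) (incl Real.pi) (c'.form i j : Form (I.prod (𝓡 1)) (M × Circle) 1) = c₁.form i j

/-- The smooth odd form `η` is the Chern–Simons form `∫_{S¹} g(θ) ch(c')` computed from the
connection `c'` on `M × S¹ × ℂ^r`, where `g` is the step function. Its part of degree `2k + 1` is
the fibre integral of the part of degree `2(k + 1)` of the Chern character form. -/
def IsChernSimonsForm (c' : Connection (I.prod (𝓡 1)) (M × Circle) r) (η : OddForm I M) : Prop :=
  ∀ (k : ℕ) (x : M) (v : Fin (2 * k + 1) → TangentSpace I x),
    (η k : Form I M (2 * k + 1)) x v = fibreIntegral (k := 2 * k + 1) step (c'.ch (k + 1)) x v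

/-- `CS(c₁, c₀) = a` in `𝒜^odd(M) / d 𝒜^even(M)`: interpolating connections on `M × S¹ × ℂ^r`
exist, and for every one of them the Chern–Simons form is a smooth form whose class modulo exact
forms is `a`. -/
def IsChernSimonsClass (c₁ c₀ : Connection I M r) (a : OddFormModExact I M) : Prop :=
  (∃ c' : Connection (I.prod (𝓡 1)) (M × Circle) r, Interpolates c' c₁ c₀) ∧
    ∀ c' : Connection (I.prod (𝓡 1)) (M × Circle) r, Interpolates c' c₁ c₀ →
      ∃ η : OddForm I M, IsChernSimonsForm c' η ∧ (exactOdd I M).mkQ η = a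

end CS

end ChernSimons

end

set_option linter.unusedSectionVars false

noncomputable section

namespace ChernSimons

/-! ### Alternating maps inside an exterior algebra -/

section ToExt

open ExteriorAlgebra

variable {V : Type*} [AddCommGroup V] [Module ℝ V] [TopologicalSpace V]
  {ι : Type*} [DecidableEq ι] {k m n : ℕ}

/-- The exterior algebra on the complexified coordinates indexed by `ι`. -/
abbrev CoordExt (ι : Type*) : Type _ := ExteriorAlgebra ℂ (ι → ℂ)

/-- The generator of index `i`. -/
def gen (i : ι) : CoordExt ι := ExteriorAlgebra.ι ℂ (Pi.single i 1)

/-- The product of the generators of indices `g 0, …, g (k - 1)`. -/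
def genMulti (g : Fin k → ι) : CoordExt ι := ιMulti ℂ k fun i => Pi.single (g i) (1 : ℂ)

theorem genMulti_append (g : Fin m → ι) (h : Fin n → ι) :
    genMulti (Fin.append g h) = genMulti g * genMulti h := by
  rw [genMulti, genMulti, genMulti, ιMulti_mul_ιMulti]
  congr 1
  funext i
  refine Fin.addCases (fun i => ?_) (fun i => ?_) i <;> simp

theorem genMulti_perm (g : Fin k → ι) (σ : Equiv.Perm (Fin k)) :
    genMulti (g ∘ σ) = Equiv.Perm.sign σ • genMulti g :=
  (ιMulti ℂ k (M := ι → ℂ)).map_perm (fun i => Pi.single (g i) (1 : ℂ)) σ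

theorem genMulti_cons (i : ι) (g : Fin k → ι) :
    genMulti (Fin.cons i g : Fin (k + 1) → ι) = gen i * genMulti g := by
  rw [genMulti, ιMulti_succ_apply]
  rfl

theorem genMulti_insertNth (p : Fin (k + 1)) (i : ι) (g : Fin k → ι) :
    (-1 : ℂ) ^ (p : ℕ) • genMulti (p.insertNth i g : Fin (k + 1) → ι) = gen i * genMulti g := by
  rw [← genMulti_cons]
  have h := (ιMulti ℂ (k + 1) (M := ι → ℂ)).neg_one_pow_smul_map_insertNth p (Pi.single i 1)
    (fun j => Pi.single (g j) 1)
  have h1 : ((-1 : ℂ) ^ (p : ℕ)) • genMulti (p.insertNth i g : Fin (k + 1) → ι) =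
      ((-1 : ℤ) ^ (p : ℕ)) • genMulti (p.insertNth i g : Fin (k + 1) → ι) := by
    rcases Nat.even_or_odd (p : ℕ) with h3 | h3 <;> simp [h3.neg_one_pow]
  have h2 : (fun j => Pi.single ((p.insertNth i g : Fin (k + 1) → ι) j) (1 : ℂ)) =
      (p.insertNth (Pi.single i 1) (fun j => Pi.single (g j) 1) : Fin (k + 1) → ι → ℂ) := by
    funext j
    refine Fin.succAboveCases p ?_ (fun j => ?_) j <;> simp
  rw [h1, genMulti, h2]
  refine Eq.trans ?_ (h.trans ?_)
  · simp
  · rw [genMulti]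
    congr 1
    funext j
    refine Fin.cases ?_ (fun j => ?_) j <;> simp

theorem gen_mul_genMulti (i : ι) (g : Fin k → ι) :
    gen i * genMulti g = (-1 : ℂ) ^ k • (genMulti g * gen i) := by
  induction k with
  | zero => simp [genMulti]
  | succ k ih =>
    have h : gen i * gen (g 0) = -(gen (g 0) * gen i) :=
      eq_neg_of_add_eq_zero_left (ι_add_mul_swap _ _)
    rw [← Fin.cons_self_tail g, genMulti_cons, ← mul_assoc, h, neg_mul, mul_assoc, ih, pow_succ,
      mul_smul_comm, mul_assoc, mul_neg_one, neg_smul]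

variable [Fintype ι]

/-- The element of the exterior algebra attached to an alternating form through a basis. -/
def toExt (b : Module.Basis ι ℝ V) : (V [⋀^Fin k]→L[ℝ] ℂ) →ₗ[ℂ] CoordExt ι where
  toFun η := (k.factorial : ℂ)⁻¹ • ∑ g : Fin k → ι, η (b ∘ g) • genMulti g
  map_add' η η' := by
    simp [add_smul, Finset.sum_add_distrib]
  map_smul' c η := by
    simp only [ContinuousAlternatingMap.smul_apply, smul_assoc, ← Finset.smul_sum, RingHom.id_apply]
    exact smul_comm _ _ _

theorem toExt_apply (b : Module.Basis ι ℝ V) (η : V [⋀^Fin k]→L[ℝ] ℂ) :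
    toExt b η = (k.factorial : ℂ)⁻¹ • ∑ g : Fin k → ι, η (b ∘ g) • genMulti g := rfl

/-- The wedge product of alternating forms. -/
def wedgeAlt (α : V [⋀^Fin m]→L[ℝ] ℂ) (β : V [⋀^Fin n]→L[ℝ] ℂ) : V [⋀^Fin (m + n)]→L[ℝ] ℂ :=
  ((m.factorial * n.factorial : ℂ)⁻¹) •
    ContinuousMultilinearMap.alternatization (mulForm α β)

theorem wedgeAlt_apply (α : V [⋀^Fin m]→L[ℝ] ℂ) (β : V [⋀^Fin n]→L[ℝ] ℂ) (v : Fin (m + n) → V) :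
    wedgeAlt α β v = (m.factorial * n.factorial : ℂ)⁻¹ * ∑ σ : Equiv.Perm (Fin (m + n)),
      ((Equiv.Perm.sign σ : ℤ) : ℂ) * (α (fun i => v (σ (Fin.castAdd n i))) *
        β (fun j => v (σ (Fin.natAdd m j)))) := by
  rw [wedgeAlt, ContinuousAlternatingMap.smul_apply,
    ContinuousMultilinearMap.alternatization_apply_apply, smul_eq_mul]
  congr 1
  refine Finset.sum_congr rfl fun σ _ => ?_
  rw [mulForm_apply, Units.smul_def, zsmul_eq_mul]
  rfl

theorem toExt_wedge (b : Module.Basis ι ℝ V) (α : V [⋀^Fin m]→L[ℝ] ℂ) (β : V [⋀^Fin n]→L[ℝ] ℂ) :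
    toExt b (wedgeAlt α β) = toExt b α * toExt b β := by
  have key : ∀ σ : Equiv.Perm (Fin (m + n)),
      ∑ g : Fin (m + n) → ι, (((Equiv.Perm.sign σ : ℤ) : ℂ) * (α (b ∘ fun i => g (σ (Fin.castAdd n i))) *
        β (b ∘ fun j => g (σ (Fin.natAdd m j))))) • genMulti g =
      (∑ g : Fin m → ι, α (b ∘ g) • genMulti g) * ∑ g : Fin n → ι, β (b ∘ g) • genMulti g := by
    intro σ
    rw [← (Equiv.arrowCongr σ (Equiv.refl ι)).sum_comp, Finset.sum_mul_sum,
      ← Fintype.sum_prod_type', ← (Fin.appendEquiv m n).sum_comp]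
    refine Finset.sum_congr rfl fun g _ => ?_
    have h1 : (Equiv.arrowCongr σ (Equiv.refl ι)) (Fin.appendEquiv m n g) =
        Fin.append g.1 g.2 ∘ ⇑σ⁻¹ := rfl
    rw [h1, genMulti_perm, genMulti_append, Units.smul_def, ← Int.cast_smul_eq_zsmul ℂ, smul_smul,
      smul_mul_smul_comm]
    congr 1
    have h2 : ((Equiv.Perm.sign σ : ℤ) : ℂ) * ((Equiv.Perm.sign σ⁻¹ : ℤ) : ℂ) = 1 := by
      rw [Equiv.Perm.sign_inv, ← Int.cast_mul, ← Units.val_mul, Int.units_mul_self]; simp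
    have h3 : (b ∘ fun i => (Fin.append g.1 g.2 ∘ ⇑σ⁻¹) (σ (Fin.castAdd n i))) = b ∘ g.1 := by
      funext i; simp
    have h4 : (b ∘ fun i => (Fin.append g.1 g.2 ∘ ⇑σ⁻¹) (σ (Fin.natAdd m i))) = b ∘ g.2 := by
      funext i; simp
    rw [h3, h4]
    linear_combination (α (b ∘ g.1) * β (b ∘ g.2)) * h2
  rw [toExt_apply, toExt_apply, toExt_apply, smul_mul_smul_comm]
  have h : ∑ g : Fin (m + n) → ι, wedgeAlt α β (b ∘ g) • genMulti g =
      ((m.factorial * n.factorial : ℂ)⁻¹ * (m + n).factorial) •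
      ((∑ g : Fin m → ι, α (b ∘ g) • genMulti g) * ∑ g : Fin n → ι, β (b ∘ g) • genMulti g) := by
    simp_rw [wedgeAlt_apply, mul_smul, Finset.sum_smul, ← Finset.smul_sum]
    rw [Finset.sum_comm]
    have := Finset.sum_congr rfl (fun σ (_ : σ ∈ (Finset.univ : Finset (Equiv.Perm (Fin (m + n))))) => key σ)
    simp only [Function.comp_def] at this ⊢
    rw [this, Finset.sum_const, Finset.card_univ, Fintype.card_perm, Fintype.card_fin,
      ← Nat.cast_smul_eq_nsmul ℂ]
  rw [h, smul_smul]
  congr 1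
  have := Nat.factorial_ne_zero (m + n)
  field_simp

/-- The determinant pairing with vectors `v_1, …, v_k`. -/
def detPairing (b : Module.Basis ι ℝ V) (v : Fin k → V) : (ι → ℂ) [⋀^Fin k]→ₗ[ℂ] ℂ :=
  (Matrix.detRowAlternating (n := Fin k) (R := ℂ)).compLinearMap
    (LinearMap.pi fun j => ∑ a, ((b.repr (v j) a : ℝ) : ℂ) • LinearMap.proj a)

theorem detPairing_single (b : Module.Basis ι ℝ V) (v : Fin k → V) (g : Fin k → ι) :
    detPairing b v (fun i => Pi.single (g i) 1) =
      ∑ σ : Equiv.Perm (Fin k), ((Equiv.Perm.sign σ : ℤ) : ℂ) *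
        ∏ i, ((b.repr (v (σ i)) (g i) : ℝ) : ℂ) := by
  rw [detPairing, AlternatingMap.compLinearMap_apply]
  change Matrix.det (Matrix.of fun i j => (∑ a, ((b.repr (v j) a : ℝ) : ℂ) • LinearMap.proj a :
    (ι → ℂ) →ₗ[ℂ] ℂ) (Pi.single (g i) 1)) = _
  rw [← Matrix.det_transpose, Matrix.det_apply']
  refine Finset.sum_congr rfl fun σ _ => ?_
  congr 1
  refine Finset.prod_congr rfl fun i _ => ?_
  simp [Matrix.transpose_apply, Pi.single_apply]

theorem alt_basis_expand (b : Module.Basis ι ℝ V) (η : V [⋀^Fin k]→L[ℝ] ℂ) (v : Fin k → V) :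
    η v = ∑ g : Fin k → ι, (∏ i, ((b.repr (v i) (g i) : ℝ) : ℂ)) * η (b ∘ g) := by
  have h : v = fun i => ∑ a, b.repr (v i) a • b a := by
    funext i; rw [b.sum_repr]
  conv_lhs => rw [h]
  rw [ContinuousAlternatingMap.map_sum]
  refine Finset.sum_congr rfl fun g _ => ?_
  rw [ContinuousAlternatingMap.map_smul_univ, Complex.real_smul, Complex.ofReal_prod]
  rfl

theorem toExt_injective (b : Module.Basis ι ℝ V) :
    Function.Injective (toExt b : (V [⋀^Fin k]→L[ℝ] ℂ) → CoordExt ι) := by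
  rw [injective_iff_map_eq_zero]
  intro η hη
  ext v
  have h1 := congrArg (ExteriorAlgebra.liftAlternating (R := ℂ) (M := ι → ℂ) (N := ℂ)
    (fun i => if h : i = k then h ▸ detPairing b v else 0)) hη
  rw [toExt_apply, map_zero, map_smul, map_sum] at h1
  have h2 : ∀ g : Fin k → ι, ExteriorAlgebra.liftAlternating (R := ℂ) (M := ι → ℂ) (N := ℂ)
    (fun i => if h : i = k then h ▸ detPairing b v else 0) (η (b ∘ g) • genMulti g) =
      ∑ σ : Equiv.Perm (Fin k), ((Equiv.Perm.sign σ : ℤ) : ℂ) *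
        ((∏ i, ((b.repr (v (σ i)) (g i) : ℝ) : ℂ)) * η (b ∘ g)) := by
    intro g
    rw [map_smul, genMulti, ExteriorAlgebra.liftAlternating_apply_ιMulti, dif_pos rfl,
      detPairing_single, smul_eq_mul, Finset.mul_sum]
    refine Finset.sum_congr rfl fun σ _ => by ring
  have h3 : ∀ σ : Equiv.Perm (Fin k), ∑ g : Fin k → ι, ((Equiv.Perm.sign σ : ℤ) : ℂ) *
        ((∏ i, ((b.repr (v (σ i)) (g i) : ℝ) : ℂ)) * η (b ∘ g)) = η v := by
    intro σ
    rw [← Finset.mul_sum, ← alt_basis_expand b η (fun i => v (σ i))]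
    have h4 : η (fun i => v (σ i)) = Equiv.Perm.sign σ • η v := η.toAlternatingMap.map_perm v σ
    rw [h4, Units.smul_def, zsmul_eq_mul, ← mul_assoc, ← Int.cast_mul, ← Units.val_mul,
      Int.units_mul_self]
    simp
  simp_rw [h2] at h1
  rw [Finset.sum_comm] at h1
  simp_rw [h3] at h1
  rw [Finset.sum_const, Finset.card_univ, Fintype.card_perm, Fintype.card_fin,
      ← Nat.cast_smul_eq_nsmul ℂ, smul_smul, inv_mul_cancel₀
      (by exact_mod_cast Nat.factorial_ne_zero k), one_smul] at h1
  exact h1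

theorem toExt_const (b : Module.Basis ι ℝ V) (c : ℂ) :
    toExt b (ContinuousAlternatingMap.constOfIsEmpty ℝ V (Fin 0) c) = algebraMap ℂ _ c := by
  rw [toExt_apply]
  simp [genMulti, Algebra.algebraMap_eq_smul_one]

theorem gen_mul_toExt (b : Module.Basis ι ℝ V) (i : ι) (η : V [⋀^Fin k]→L[ℝ] ℂ) :
    gen i * toExt b η = (-1 : ℂ) ^ k • (toExt b η * gen i) := by
  simp only [toExt_apply, mul_smul_comm, smul_mul_assoc, Finset.mul_sum, Finset.sum_mul,
    gen_mul_genMulti, Finset.smul_sum]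
  refine Finset.sum_congr rfl ?_
  intro g _
  simp only [smul_smul]
  congr 1
  ring

theorem toExt_one_form (b : Module.Basis ι ℝ V) (η : V [⋀^Fin 1]→L[ℝ] ℂ) :
    toExt b η = ∑ i, η (fun _ => b i) • gen i := by
  rw [toExt_apply, ← (Equiv.funUnique (Fin 1) ι).symm.sum_comp]
  simp only [Nat.factorial_one, Nat.cast_one, inv_one, one_smul]
  refine Finset.sum_congr rfl fun i _ => ?_
  congr 1
  simp [genMulti, gen]

theorem toExt_one_mul (b : Module.Basis ι ℝ V) (α : V [⋀^Fin 1]→L[ℝ] ℂ)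
    (η : V [⋀^Fin k]→L[ℝ] ℂ) :
    toExt b α * toExt b η = (-1 : ℂ) ^ k • (toExt b η * toExt b α) := by
  rw [toExt_one_form, Finset.sum_mul, Finset.mul_sum, Finset.smul_sum]
  refine Finset.sum_congr rfl fun i _ => ?_
  rw [smul_mul_assoc, gen_mul_toExt, mul_smul_comm, smul_comm]

theorem toExt_even_commute (b : Module.Basis ι ℝ V) (hk : Even k) (η : V [⋀^Fin k]→L[ℝ] ℂ)
    (y : CoordExt ι) : Commute (toExt b η) y := by
  induction y using ExteriorAlgebra.induction with
  | algebraMap r => exact (Algebra.commutes r _).symm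
  | ι x =>
    have hx : ExteriorAlgebra.ι ℂ x = ∑ i, x i • gen i := by
      simp_rw [gen, ← map_smul, ← map_sum]
      congr 1
      funext j
      simp [Pi.single_apply]
    rw [hx]
    refine Commute.sum_right _ _ _ fun i _ => Commute.smul_right ?_ _
    have := gen_mul_toExt b i η
    rw [hk.neg_one_pow, one_smul] at this
    exact this.symm
  | mul a c ha hc => exact ha.mul_right hc
  | add a c ha hc => exact ha.add_right hc

theorem toExt_uncurry (b : Module.Basis ι ℝ V) (f : V → V [⋀^Fin k]→L[ℝ] ℂ)
    (η : V [⋀^Fin (k + 1)]→L[ℝ] ℂ)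
    (hη : ∀ v, η v = ∑ p : Fin (k + 1), (-1) ^ (p : ℕ) • f (v p) (p.removeNth v)) :
    toExt b η = ∑ i, gen i * toExt b (f (b i)) := by
  have key : ∀ p : Fin (k + 1), ∑ g : Fin (k + 1) → ι,
      ((-1 : ℂ) ^ (p : ℕ) * f (b (g p)) (p.removeNth (b ∘ g))) • genMulti g =
      ∑ i, ∑ g : Fin k → ι, f (b i) (b ∘ g) • (gen i * genMulti g) := by
    intro p
    rw [← (Fin.insertNthEquiv (fun _ => ι) p).sum_comp, Fintype.sum_prod_type]
    refine Finset.sum_congr rfl fun i _ => Finset.sum_congr rfl fun g _ => ?_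
    rw [← genMulti_insertNth p, smul_smul, mul_comm]
    simp only [Fin.insertNthEquiv_apply, Fin.insertNth_apply_same]
    congr 3
    funext j
    simp [Fin.removeNth]
  rw [toExt_apply]
  simp_rw [hη, Finset.sum_smul]
  rw [Finset.sum_comm]
  have h : ∀ p : Fin (k + 1), ∑ g : Fin (k + 1) → ι,
      ((-1) ^ (p : ℕ) • f ((b ∘ g) p) (p.removeNth (b ∘ g))) • genMulti g =
      ∑ i, ∑ g : Fin k → ι, f (b i) (b ∘ g) • (gen i * genMulti g) := by
    intro p
    rw [← key p]
    refine Finset.sum_congr rfl fun g _ => ?_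
    congr 1
    rcases Nat.even_or_odd (p : ℕ) with h3 | h3 <;> simp [h3.neg_one_pow]
  simp_rw [h]
  rw [Finset.sum_const, Finset.card_univ, Fintype.card_fin, ← Nat.cast_smul_eq_nsmul ℂ, smul_smul]
  have hc : (((k + 1).factorial : ℂ))⁻¹ * ((k + 1 : ℕ) : ℂ) = (k.factorial : ℂ)⁻¹ := by
    rw [Nat.factorial_succ, Nat.cast_mul, mul_inv, mul_comm, ← mul_assoc,
      mul_inv_cancel₀ (by exact_mod_cast Nat.succ_ne_zero k), one_mul]
  rw [hc, Finset.smul_sum]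
  refine Finset.sum_congr rfl fun i _ => ?_
  rw [toExt_apply, mul_smul_comm, Finset.mul_sum]
  simp_rw [mul_smul_comm]

/-- The contraction `η (w, ·)` of an alternating form with a vector. -/
def contr (w : V) (η : V [⋀^Fin (k + 1)]→L[ℝ] ℂ) : V [⋀^Fin k]→L[ℝ] ℂ where
  toAlternatingMap := η.toAlternatingMap.curryLeft w
  cont := η.cont.comp (continuous_const.matrixVecCons continuous_id)

theorem contr_apply (w : V) (η : V [⋀^Fin (k + 1)]→L[ℝ] ℂ) (v : Fin k → V) :
    contr w η v = η (Matrix.vecCons w v) := rfl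

theorem contr_contr (w w' : V) (η : V [⋀^Fin (k + 2)]→L[ℝ] ℂ) :
    contr w (contr w' η) = -contr w' (contr w η) := by
  ext v
  have h := η.toAlternatingMap.map_swap (Matrix.vecCons w' (Matrix.vecCons w v))
    (i := 0) (j := 1) (by simp)
  rw [ContinuousAlternatingMap.neg_apply, contr_apply, contr_apply, contr_apply, contr_apply,
    ← neg_eq_iff_eq_neg]
  refine h.symm.trans ?_
  change η _ = η _
  congr 1
  funext i
  refine Fin.cases ?_ (fun i => Fin.cases ?_ (fun i => ?_) i) i
  · simp
  · simp
  · rw [Function.comp_apply, Equiv.swap_apply_of_ne_of_ne]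
    · rfl
    · exact (Fin.succ_ne_zero _)
    · intro h
      exact Fin.succ_ne_zero _ (Fin.succ_injective _ h)

/-- The linear form on coordinates given by pairing with a vector. -/
def pairing (b : Module.Basis ι ℝ V) (w : V) : Module.Dual ℂ (ι → ℂ) :=
  ∑ i, ((b.repr w i : ℝ) : ℂ) • LinearMap.proj i

theorem pairing_single (b : Module.Basis ι ℝ V) (w : V) (i : ι) :
    pairing b w (Pi.single i 1) = b.repr w i := by
  simp [pairing, Pi.single_apply]

open CliffordAlgebra in
theorem contractLeft_gen_mul (d : Module.Dual ℂ (ι → ℂ)) (i : ι) (y : CoordExt ι) :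
    contractLeft (Q := 0) d (gen i * y) =
      d (Pi.single i 1) • y - gen i * contractLeft (Q := 0) d y :=
  contractLeft_ι_mul (Q := (0 : QuadraticForm ℂ (ι → ℂ))) d _ _

theorem toExt_smul_uncurry_contr (b : Module.Basis ι ℝ V) (η : V [⋀^Fin (k + 1)]→L[ℝ] ℂ) :
    ((k + 1 : ℕ) : ℂ) • toExt b η = ∑ i, gen i * toExt b (contr (b i) η) := by
  rw [← map_smul]
  refine toExt_uncurry b (fun w => contr w η) _ fun v => ?_
  have h := congrArg (fun ξ : V [⋀^Fin (k + 1)]→ₗ[ℝ] ℂ => ξ v)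
    (AlternatingMap.alternatizeUncurryFin_curryLeft η.toAlternatingMap)
  simp only [AlternatingMap.alternatizeUncurryFin_apply] at h
  rw [ContinuousAlternatingMap.smul_apply, smul_eq_mul]
  refine Eq.trans ?_ h.symm
  simp

open CliffordAlgebra in
theorem toExt_contr (b : Module.Basis ι ℝ V) (w : V) (η : V [⋀^Fin (k + 1)]→L[ℝ] ℂ) :
    toExt b (contr w η) = contractLeft (Q := 0) (pairing b w) (toExt b η) := by
  have hw : ∀ {m : ℕ} (ξ : V [⋀^Fin (m + 1)]→L[ℝ] ℂ), ∑ i, ((b.repr w i : ℝ) : ℂ) • toExt b (contr (b i) ξ) =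
      toExt b (contr w ξ) := by
    intro m ξ
    simp_rw [← map_smul, ← map_sum]
    congr 1
    ext v
    rw [ContinuousAlternatingMap.sum_apply]
    have : contr w ξ v = ξ.toMultilinearMap.toLinearMap (Matrix.vecCons 0 v) 0 w := by
      rw [contr_apply, MultilinearMap.toLinearMap_apply]
      change ξ _ = ξ _
      congr 1
      funext i
      refine Fin.cases ?_ (fun i => ?_) i <;> simp
    rw [this]
    conv_rhs => rw [← b.sum_repr w, map_sum]
    refine Finset.sum_congr rfl fun i _ => ?_
    rw [map_smul, MultilinearMap.toLinearMap_apply, Complex.real_smul,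
      ContinuousAlternatingMap.smul_apply, smul_eq_mul, contr_apply]
    congr 1
    change ξ _ = ξ _
    congr 1
    funext i
    refine Fin.cases ?_ (fun i => ?_) i <;> simp
  induction k with
  | zero =>
    have h := toExt_smul_uncurry_contr b η
    simp only [zero_add, Nat.cast_one, one_smul] at h
    rw [h, map_sum, ← hw]
    refine Finset.sum_congr rfl fun i _ => ?_
    have h0 : contr (b i) η = ContinuousAlternatingMap.constOfIsEmpty ℝ V (Fin 0) (contr (b i) η 0) := by
      ext v
      rw [ContinuousAlternatingMap.constOfIsEmpty_apply, Subsingleton.elim v 0]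
    rw [contractLeft_gen_mul, pairing_single, h0, toExt_const]
    erw [contractLeft_algebraMap]
    rw [mul_zero, sub_zero]
  | succ k ih =>
    have hk : ((k + 2 : ℕ) : ℂ) ≠ 0 := by exact_mod_cast Nat.succ_ne_zero (k + 1)
    refine smul_right_injective _ hk ?_
    simp only
    rw [← map_smul, ← map_smul, map_smul (toExt b), toExt_smul_uncurry_contr, map_sum]
    simp_rw [contractLeft_gen_mul, pairing_single, ← ih, Finset.sum_sub_distrib, hw, contr_contr w]
    simp_rw [map_neg, mul_neg, Finset.sum_neg_distrib]
    rw [← toExt_smul_uncurry_contr, sub_neg_eq_add]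
    rw [show ((k + 2 : ℕ) : ℂ) = 1 + ((k + 1 : ℕ) : ℂ) by push_cast; ring, add_smul, one_smul]

open CliffordAlgebra in
theorem contractLeft_toExt_mul (b : Module.Basis ι ℝ V) (d : Module.Dual ℂ (ι → ℂ))
    (η : V [⋀^Fin k]→L[ℝ] ℂ) (y : CoordExt ι) :
    contractLeft (Q := 0) d (toExt b η * y) =
      contractLeft (Q := 0) d (toExt b η) * y +
        (-1 : ℂ) ^ k • (toExt b η * contractLeft (Q := 0) d y) := by
  have h : ∀ g : Fin k → ι, contractLeft (Q := 0) d (genMulti g * y) =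
      contractLeft (Q := 0) d (genMulti g) * y +
        (-1 : ℂ) ^ k • (genMulti g * contractLeft (Q := 0) d y) := by
    intro g
    clear η
    induction k with
    | zero =>
      have h1 : contractLeft (Q := 0) d (1 : CoordExt ι) = 0 :=
        contractLeft_one (Q := (0 : QuadraticForm ℂ (ι → ℂ))) d
      simp [genMulti, h1]
    | succ k ih =>
      rw [← Fin.cons_self_tail g, genMulti_cons, mul_assoc, contractLeft_gen_mul, ih,
        contractLeft_gen_mul, mul_add, sub_mul, smul_mul_assoc, mul_assoc, pow_succ, mul_neg_one,
        neg_smul, mul_smul_comm, mul_assoc]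
      abel
  simp only [toExt_apply, smul_mul_assoc, Finset.sum_mul, map_smul, map_sum, h, smul_add,
    Finset.sum_add_distrib, Finset.smul_sum]
  congr 1
  refine Finset.sum_congr rfl ?_
  intro g _
  simp only [smul_smul]
  congr 1
  ring

end ToExt

/-! ### Calculus of forms on normed spaces -/

section Calculus

variable {V W Z : Type*} [NormedAddCommGroup V] [NormedSpace ℝ V] [FiniteDimensional ℝ V]
  [NormedAddCommGroup W] [NormedSpace ℝ W] [FiniteDimensional ℝ W]
  [NormedAddCommGroup Z] [NormedSpace ℝ Z] {k m n : ℕ} {r : WithTop ℕ∞} {s : Set Z} {z : Z}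

/-- Evaluation of alternating forms on all tuples of basis vectors. -/
def altEval (V : Type*) [NormedAddCommGroup V] [NormedSpace ℝ V] [FiniteDimensional ℝ V] (k : ℕ) :
    (V [⋀^Fin k]→L[ℝ] ℂ) →ₗ[ℝ] ((Fin k → Fin (Module.finrank ℝ V)) → ℂ) where
  toFun η g := η (Module.finBasis ℝ V ∘ g)
  map_add' _ _ := rfl
  map_smul' _ _ := rfl

theorem altEval_injective : Function.Injective (altEval V k) := fun η ξ h => by
  ext v
  rw [alt_basis_expand (Module.finBasis ℝ V) η, alt_basis_expand (Module.finBasis ℝ V) ξ]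
  exact Finset.sum_congr rfl fun g _ => congrArg _ (congrFun h g)

instance finiteDimensional_alt : FiniteDimensional ℝ (V [⋀^Fin k]→L[ℝ] ℂ) :=
  FiniteDimensional.of_injective (altEval V k) altEval_injective

theorem contDiffWithinAt_alt_iff {F : Z → V [⋀^Fin k]→L[ℝ] ℂ} :
    ContDiffWithinAt ℝ r F s z ↔ ∀ v, ContDiffWithinAt ℝ r (fun y => F y v) s z := by
  constructor
  · intro h v
    exact (ContinuousAlternatingMap.apply ℝ V ℂ v).contDiff.comp_contDiffWithinAt h
  · intro h
    obtain ⟨G, hG⟩ := (altEval V k).exists_leftInverse_of_injective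
      (LinearMap.ker_eq_bot.2 altEval_injective)
    have h1 : ContDiffWithinAt ℝ r (fun y => altEval V k (F y)) s z :=
      contDiffWithinAt_pi.2 fun g => h _
    have h2 : F = fun y => LinearMap.toContinuousLinearMap G (altEval V k (F y)) := by
      funext y
      exact (LinearMap.congr_fun hG (F y)).symm
    rw [h2]
    exact (LinearMap.toContinuousLinearMap G).contDiff.comp_contDiffWithinAt h1

theorem ContDiffWithinAt.alt_apply {F : Z → V [⋀^Fin k]→L[ℝ] ℂ} {w : Fin k → Z → V}
    (hF : ContDiffWithinAt ℝ r F s z) (hw : ∀ i, ContDiffWithinAt ℝ r (w i) s z) :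
    ContDiffWithinAt ℝ r (fun y => F y fun i => w i y) s z := by
  have h : (fun y => F y fun i => w i y) = fun y => ∑ g : Fin k → Fin (Module.finrank ℝ V),
      (∏ i, (((Module.finBasis ℝ V).repr (w i y) (g i) : ℝ) : ℂ)) * F y (Module.finBasis ℝ V ∘ g) :=
    funext fun y => alt_basis_expand _ _ _
  rw [h]
  refine ContDiffWithinAt.sum fun g _ => ContDiffWithinAt.mul ?_
    (contDiffWithinAt_alt_iff.1 hF _)
  refine contDiffWithinAt_prod fun i _ => Complex.ofRealCLM.contDiff.comp_contDiffWithinAt ?_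
  exact (LinearMap.toContinuousLinearMap ((Module.finBasis ℝ V).coord (g i))).contDiff.comp_contDiffWithinAt
    (hw i)

theorem ContDiffWithinAt.alt_comp {F : Z → V [⋀^Fin k]→L[ℝ] ℂ} {A : Z → W →L[ℝ] V}
    (hF : ContDiffWithinAt ℝ r F s z) (hA : ContDiffWithinAt ℝ r A s z) :
    ContDiffWithinAt ℝ r (fun y => (F y).compContinuousLinearMap (A y)) s z :=
  contDiffWithinAt_alt_iff.2 fun v =>
    ContDiffWithinAt.alt_apply (w := fun i y => A y (v i)) hF fun _ =>
      hA.clm_apply contDiffWithinAt_const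

theorem ContDiffWithinAt.wedgeAlt {α : Z → V [⋀^Fin m]→L[ℝ] ℂ} {β : Z → V [⋀^Fin n]→L[ℝ] ℂ}
    (hα : ContDiffWithinAt ℝ r α s z) (hβ : ContDiffWithinAt ℝ r β s z) :
    ContDiffWithinAt ℝ r (fun y => wedgeAlt (α y) (β y)) s z := by
  refine contDiffWithinAt_alt_iff.2 fun v => ?_
  simp_rw [wedgeAlt_apply]
  refine contDiffWithinAt_const.mul (ContDiffWithinAt.sum fun σ _ => contDiffWithinAt_const.mul ?_)
  exact (contDiffWithinAt_alt_iff.1 hα _).mul (contDiffWithinAt_alt_iff.1 hβ _)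

theorem wedgeAlt_comp {V W : Type*} [AddCommGroup V] [Module ℝ V] [TopologicalSpace V]
    [AddCommGroup W] [Module ℝ W] [TopologicalSpace W] (α : V [⋀^Fin m]→L[ℝ] ℂ)
    (β : V [⋀^Fin n]→L[ℝ] ℂ) (A : W →L[ℝ] V) :
    (wedgeAlt α β).compContinuousLinearMap A =
      wedgeAlt (α.compContinuousLinearMap A) (β.compContinuousLinearMap A) := by
  ext v
  rw [ContinuousAlternatingMap.compContinuousLinearMap_apply, wedgeAlt_apply, wedgeAlt_apply]
  rfl

variable (V m n) in
/-- The wedge product as a continuous bilinear map. -/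
def wedgeB : (V [⋀^Fin m]→L[ℝ] ℂ) →L[ℝ] (V [⋀^Fin n]→L[ℝ] ℂ) →L[ℝ] V [⋀^Fin (m + n)]→L[ℝ] ℂ :=
  LinearMap.toContinuousBilinearMap <| LinearMap.mk₂ ℝ wedgeAlt
    (fun α α' β => by
      ext v
      simp only [wedgeAlt_apply, ContinuousAlternatingMap.add_apply, add_mul, mul_add,
        Finset.sum_add_distrib])
    (fun c α β => by
      ext v
      simp only [wedgeAlt_apply, ContinuousAlternatingMap.smul_apply, Complex.real_smul,
        Finset.mul_sum]
      exact Finset.sum_congr rfl fun σ _ => by ring)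
    (fun α β β' => by
      ext v
      simp only [wedgeAlt_apply, ContinuousAlternatingMap.add_apply, mul_add,
        Finset.sum_add_distrib])
    (fun c α β => by
      ext v
      simp only [wedgeAlt_apply, ContinuousAlternatingMap.smul_apply, Complex.real_smul,
        Finset.mul_sum]
      exact Finset.sum_congr rfl fun σ _ => by ring)

theorem wedgeB_apply (α : V [⋀^Fin m]→L[ℝ] ℂ) (β : V [⋀^Fin n]→L[ℝ] ℂ) :
    wedgeB V m n α β = wedgeAlt α β := rfl

theorem fderiv_wedgeAlt {α : Z → V [⋀^Fin m]→L[ℝ] ℂ} {β : Z → V [⋀^Fin n]→L[ℝ] ℂ}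
    (hα : DifferentiableAt ℝ α z) (hβ : DifferentiableAt ℝ β z) (e : Z) :
    fderiv ℝ (fun y => wedgeAlt (α y) (β y)) z e =
      wedgeAlt (fderiv ℝ α z e) (β z) + wedgeAlt (α z) (fderiv ℝ β z e) := by
  have h := (wedgeB V m n).hasFDerivAt_of_bilinear hα.hasFDerivAt hβ.hasFDerivAt
  simp only [wedgeB_apply] at h
  rw [h.fderiv]
  simp [wedgeB_apply, add_comm]

theorem toExt_extDeriv {ι : Type*} [Fintype ι] [DecidableEq ι] (b : Module.Basis ι ℝ V)
    (α : V → V [⋀^Fin m]→L[ℝ] ℂ) (y : V) :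
    toExt b (extDeriv α y) = ∑ i, gen i * toExt b (fderiv ℝ α y (b i)) :=
  toExt_uncurry b (fun v => fderiv ℝ α y v) _ fun _ =>
    ContinuousAlternatingMap.alternatizeUncurryFin_apply _ _

theorem toExt_extDeriv_wedge {ι : Type*} [Fintype ι] [DecidableEq ι] (b : Module.Basis ι ℝ V)
    {α : V → V [⋀^Fin m]→L[ℝ] ℂ} {β : V → V [⋀^Fin n]→L[ℝ] ℂ} {y : V}
    (hα : DifferentiableAt ℝ α y) (hβ : DifferentiableAt ℝ β y) :
    toExt b (extDeriv (fun y => wedgeAlt (α y) (β y)) y) =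
      toExt b (extDeriv α y) * toExt b (β y) +
        (-1 : ℂ) ^ m • (toExt b (α y) * toExt b (extDeriv β y)) := by
  rw [toExt_extDeriv, toExt_extDeriv, toExt_extDeriv, Finset.sum_mul, Finset.mul_sum,
    Finset.smul_sum, ← Finset.sum_add_distrib]
  refine Finset.sum_congr rfl fun i _ => ?_
  rw [fderiv_wedgeAlt hα hβ, map_add, toExt_wedge, toExt_wedge, mul_add, mul_assoc, ← mul_assoc,
    ← mul_assoc, ← mul_assoc, gen_mul_toExt b i (α y), smul_mul_assoc]

variable (k) in
/-- The contraction with a vector, as a continuous linear map. -/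
def contrL (w : V) : (V [⋀^Fin (k + 1)]→L[ℝ] ℂ) →L[ℝ] V [⋀^Fin k]→L[ℝ] ℂ :=
  LinearMap.toContinuousLinearMap
    { toFun := contr w
      map_add' := fun _ _ => rfl
      map_smul' := fun _ _ => rfl }

theorem contr_extDeriv {α : V → V [⋀^Fin (k + 1)]→L[ℝ] ℂ} {y : V} (hα : DifferentiableAt ℝ α y)
    (w : V) :
    contr w (extDeriv α y) = fderiv ℝ α y w - extDeriv (fun y => contr w (α y)) y := by
  ext v
  have h1 : ∀ e, fderiv ℝ (fun y => contr w (α y)) y e = contr w (fderiv ℝ α y e) := by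
    intro e
    have := ((contrL k w).hasFDerivAt.comp y hα.hasFDerivAt).fderiv
    exact (DFunLike.congr_fun this e)
  rw [contr_apply, extDeriv, extDeriv, ContinuousAlternatingMap.sub_apply,
    ContinuousAlternatingMap.alternatizeUncurryFin_apply,
    ContinuousAlternatingMap.alternatizeUncurryFin_apply, Fin.sum_univ_succ, sub_eq_add_neg,
    ← Finset.sum_neg_distrib]
  congr 1
  · simp only [Fin.val_zero, pow_zero, one_smul, Matrix.cons_val_zero]
    congr 1
  · refine Finset.sum_congr rfl fun i _ => ?_
    rw [h1, contr_apply, Fin.val_succ, pow_succ, mul_neg_one, neg_smul]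
    congr 3
    funext j
    refine Fin.cases ?_ (fun j => ?_) j
    · simp [Fin.removeNth]
    · simp [Fin.removeNth]

/-- For a closed form, `d (i_w i_w' η) = ∂_w (i_w' η) - ∂_w' (i_w η)`. -/
theorem extDeriv_contr_contr {α : V → V [⋀^Fin (k + 2)]→L[ℝ] ℂ} {y : V}
    (hα : DifferentiableAt ℝ α y) (hd : extDeriv α y = 0) (w w' : V) :
    extDeriv (fun y => contr w (contr w' (α y))) y =
      fderiv ℝ (fun y => contr w' (α y)) y w - fderiv ℝ (fun y => contr w (α y)) y w' := by
  have h1 : DifferentiableAt ℝ (fun y => contr w' (α y)) y :=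
    (contrL (k + 1) w').differentiableAt.comp y hα
  have h2 := contr_extDeriv h1 w
  have h3 : extDeriv (fun y => contr w' (α y)) y = fderiv ℝ α y w' := by
    have := contr_extDeriv hα w'
    rw [hd] at this
    rw [eq_comm, ← sub_eq_zero, ← this]
    rfl
  have h4 : fderiv ℝ (fun y => contr w (α y)) y w' = contr w (fderiv ℝ α y w') := by
    have := ((contrL (k + 1) w).hasFDerivAt.comp y hα.hasFDerivAt).fderiv
    exact (DFunLike.congr_fun this w')
  rw [h4, ← h3, h2]
  abel

end Calculus

section Parametric

open MeasureTheory Set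

universe u

variable {Z F : Type u} {Q : Type*} [NormedAddCommGroup Z] [NormedSpace ℝ Z]
  [FiniteDimensional ℝ Z] [NormedAddCommGroup F] [NormedSpace ℝ F]
  [NormedAddCommGroup Q] [NormedSpace ℝ Q] [MeasurableSpace Q] [BorelSpace Q]
  [FiniteDimensional ℝ Q] {ν : Measure Q} [IsLocallyFiniteMeasure ν] {K : Set Q} {U : Set Z}

theorem contDiffOn_partial_fderiv (hU : IsOpen U) {f : Z × Q → F}
    (hf : ContDiffOn ℝ ∞ f (U ×ˢ univ)) :
    ContDiffOn ℝ ∞ (fun p => (fderiv ℝ f p).comp (ContinuousLinearMap.inl ℝ Z Q)) (U ×ˢ univ) :=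
  (hf.fderiv_of_isOpen (hU.prod isOpen_univ) (by simp)).clm_comp contDiffOn_const

theorem hasFDerivAt_setIntegral (hU : IsOpen U) (hK : IsCompact K) {f : Z × Q → F}
    (hf : ContDiffOn ℝ ∞ f (U ×ˢ univ)) {z : Z} (hz : z ∈ U) :
    HasFDerivAt (fun z => ∫ q in K, f (z, q) ∂ν)
      (∫ q in K, (fderiv ℝ f (z, q)).comp (ContinuousLinearMap.inl ℝ Z Q) ∂ν) z := by
  have hf' := contDiffOn_partial_fderiv hU hf
  obtain ⟨ε, hε, hball⟩ := Metric.nhds_basis_closedBall.mem_iff.1 (hU.mem_nhds hz)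
  obtain ⟨C, hC⟩ := ((isCompact_closedBall z ε).prod hK).exists_bound_of_continuousOn
    (hf'.continuousOn.mono (prod_mono hball (subset_univ K)))
  have hcont : ∀ {G : Type u} [NormedAddCommGroup G] {g : Z × Q → G},
      ContinuousOn g (U ×ˢ univ) → ∀ z ∈ U, Continuous fun q => g (z, q) := by
    intro G _ g hg z hz
    exact continuousOn_univ.1 (hg.comp (by fun_prop) fun q _ => ⟨hz, mem_univ q⟩)
  refine hasFDerivAt_integral_of_dominated_of_fderiv_le (𝕜 := ℝ) (bound := fun _ => C)
    (F' := fun z q => (fderiv ℝ f (z, q)).comp (ContinuousLinearMap.inl ℝ Z Q))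
    (Metric.closedBall_mem_nhds z hε) ?_ ?_ ?_ ?_ ?_ ?_
  · filter_upwards [hU.mem_nhds hz] with z hz
    exact ((hcont hf.continuousOn z hz).continuousOn.aestronglyMeasurable_of_isCompact hK
      hK.measurableSet)
  · exact (hcont hf.continuousOn z hz).continuousOn.integrableOn_compact hK
  · exact ((hcont hf'.continuousOn z hz).continuousOn.aestronglyMeasurable_of_isCompact hK
      hK.measurableSet)
  · filter_upwards [ae_restrict_mem hK.measurableSet] with q hq z' hz'
    exact hC (z', q) ⟨hz', hq⟩
  · exact integrableOn_const hK.measure_lt_top.ne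
  · refine Filter.Eventually.of_forall fun q z' hz' => ?_
    have h1 : HasFDerivAt f (fderiv ℝ f (z', q)) (z', q) :=
      ((hf.contDiffAt ((hU.prod isOpen_univ).mem_nhds ⟨hball hz', mem_univ q⟩)).differentiableAt
        (by simp)).hasFDerivAt
    exact h1.comp z' (hasFDerivAt_prodMk_left z' q)

theorem contDiffOn_setIntegral_nat (hU : IsOpen U) (hK : IsCompact K) (n : ℕ) :
    ∀ {F : Type u} [NormedAddCommGroup F] [NormedSpace ℝ F] {f : Z × Q → F},
    ContDiffOn ℝ ∞ f (U ×ˢ univ) → ContDiffOn ℝ n (fun z => ∫ q in K, f (z, q) ∂ν) U := by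
  induction n with
  | zero =>
    intro F _ _ f hf
    refine contDiffOn_zero.2 fun z hz => ?_
    exact (hasFDerivAt_setIntegral hU hK hf hz).continuousAt.continuousWithinAt
  | succ n ih =>
    intro F _ _ f hf
    push_cast
    refine (contDiffOn_succ_iff_fderiv_of_isOpen hU).2 ⟨fun z hz => ?_, fun h => ?_, ?_⟩
    · exact (hasFDerivAt_setIntegral hU hK hf hz).differentiableAt.differentiableWithinAt
    · exact absurd h (by simp)
    · refine (ih (contDiffOn_partial_fderiv hU hf)).congr fun z hz => ?_
      exact (hasFDerivAt_setIntegral hU hK hf hz).fderiv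

theorem contDiffOn_setIntegral (hU : IsOpen U) (hK : IsCompact K) {f : Z × Q → F}
    (hf : ContDiffOn ℝ ∞ f (U ×ˢ univ)) : ContDiffOn ℝ ∞ (fun z => ∫ q in K, f (z, q) ∂ν) U :=
  contDiffOn_infty.2 fun n => contDiffOn_setIntegral_nat hU hK n hf

end Parametric

/-! ### Calculus of forms on manifolds without boundary -/

section ManifoldCalculus

variable {E : Type*} [NormedAddCommGroup E] [NormedSpace ℝ E] [FiniteDimensional ℝ E]
  {H : Type*} [TopologicalSpace H] {I : ModelWithCorners ℝ E H} [I.Boundaryless]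
  {M : Type*} [TopologicalSpace M] [ChartedSpace H M] [IsManifold I ∞ M]
  {E' : Type*} [NormedAddCommGroup E'] [NormedSpace ℝ E'] [FiniteDimensional ℝ E']
  {H' : Type*} [TopologicalSpace H'] {J : ModelWithCorners ℝ E' H'} [J.Boundaryless]
  {N : Type*} [TopologicalSpace N] [ChartedSpace H' N] [IsManifold J ∞ N] {k m n : ℕ}

theorem minSmoothness_two_le : minSmoothness ℝ 2 ≤ ∞ := by
  rw [minSmoothness_of_isRCLikeNormedField]
  exact WithTop.coe_le_coe.2 (le_top : (2 : ℕ∞) ≤ ⊤)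

theorem Form.apply_congr (η : Form I M k) {p q : M} (h : p = q) (v : Fin k → E) :
    (η p : E [⋀^Fin k]→L[ℝ] ℂ) v = (η q : E [⋀^Fin k]→L[ℝ] ℂ) v := by
  subst h; rfl

theorem Form.inChart_eq (η : Form I M k) (x₀ : M) (y : E) :
    Form.inChart η x₀ y = ((η ((extChartAt I x₀).symm y)).compContinuousLinearMap
      (mfderiv 𝓘(ℝ, E) I (extChartAt I x₀).symm y) : E [⋀^Fin k]→L[ℝ] ℂ) := by
  rw [Form.inChart, I.range_eq_univ, mfderivWithin_univ]

theorem mdifferentiableAt_extChartAt_symm {x₀ : M} {y : E} (hy : y ∈ (extChartAt I x₀).target) :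
    MDifferentiableAt 𝓘(ℝ, E) I (extChartAt I x₀).symm y :=
  ((contMDiffOn_extChartAt_symm (I := I) (n := ∞) x₀).contMDiffAt
    ((isOpen_extChartAt_target x₀).mem_nhds hy)).mdifferentiableAt (by simp)

theorem mdifferentiableAt_extChartAt' {x₀ x : M} (hx : x ∈ (chartAt H x₀).source) :
    MDifferentiableAt I 𝓘(ℝ, E) (extChartAt I x₀) x :=
  (contMDiffAt_extChartAt' (I := I) (n := ∞) hx).mdifferentiableAt (by simp)

theorem fderiv_chart_expression {f : M → N} {x₀ : M} {q : N} {y : E}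
    (hy : y ∈ (extChartAt I x₀).target)
    (hf : MDifferentiableAt I J f ((extChartAt I x₀).symm y))
    (hq : f ((extChartAt I x₀).symm y) ∈ (chartAt H' q).source) (w : E) :
    fderiv ℝ (extChartAt J q ∘ f ∘ (extChartAt I x₀).symm) y w =
      mfderiv J 𝓘(ℝ, E') (extChartAt J q) (f ((extChartAt I x₀).symm y))
        (mfderiv I J f ((extChartAt I x₀).symm y)
          (mfderiv 𝓘(ℝ, E) I (extChartAt I x₀).symm y w)) := by
  have h1 := mdifferentiableAt_extChartAt_symm hy
  rw [← mfderiv_eq_fderiv, mfderiv_comp (I' := J) y (mdifferentiableAt_extChartAt' hq) (hf.comp y h1),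
    mfderiv_comp y hf h1]
  rfl

theorem mfderiv_symm_mfderiv {q p : N} (hp : p ∈ (chartAt H' q).source) (w : E') :
    mfderiv 𝓘(ℝ, E') J (extChartAt J q).symm (extChartAt J q p)
      (mfderiv J 𝓘(ℝ, E') (extChartAt J q) p w) = w := by
  have hp' : p ∈ (extChartAt J q).source := by rwa [extChartAt_source]
  have : IsManifold J 1 N := IsManifold.of_le (n := ∞) (by simp)
  have h := mfderivWithin_extChartAt_symm_comp_mfderiv_extChartAt' (I := J) hp'
  rw [J.range_eq_univ, mfderivWithin_univ] at h
  exact DFunLike.congr_fun h w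

theorem Form.inChart_pullback (η : Form J N k) {f : M → N} {x₀ : M} {q : N} {y : E}
    (hy : y ∈ (extChartAt I x₀).target)
    (hf : MDifferentiableAt I J f ((extChartAt I x₀).symm y))
    (hq : f ((extChartAt I x₀).symm y) ∈ (chartAt H' q).source) :
    Form.inChart (Form.pullback (I := I) f η) x₀ y =
      (Form.inChart η q (extChartAt J q (f ((extChartAt I x₀).symm y)))).compContinuousLinearMap
        (fderiv ℝ (extChartAt J q ∘ f ∘ (extChartAt I x₀).symm) y) := by
  rw [Form.inChart_eq, Form.inChart_eq]
  have hq' : f ((extChartAt I x₀).symm y) ∈ (extChartAt J q).source := by rwa [extChartAt_source]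
  ext v
  refine (Form.apply_congr η ((extChartAt J q).left_inv hq').symm _).trans ?_
  refine congrArg (η _ : E' [⋀^Fin k]→L[ℝ] ℂ) (funext fun i => ?_)
  refine Eq.trans ?_ (congrArg _ (fderiv_chart_expression hy hf hq (v i)).symm)
  exact (mfderiv_symm_mfderiv hq _).symm

theorem Form.pullback_id (η : Form I M k) : Form.pullback (I := I) id η = η := by
  funext x
  ext v
  simp [Form.pullback, mfderiv_id]

theorem contMDiff_chart_expression {f : M → N} (hf : ContMDiff I J ∞ f) {x₀ : M} {q : N} {y : E}
    (hy : y ∈ (extChartAt I x₀).target)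
    (hq : f ((extChartAt I x₀).symm y) ∈ (chartAt H' q).source) :
    ContDiffAt ℝ ∞ (extChartAt J q ∘ f ∘ (extChartAt I x₀).symm) y := by
  rw [← contMDiffAt_iff_contDiffAt]
  exact (contMDiffAt_extChartAt' hq).comp y ((hf _).comp y
    ((contMDiffOn_extChartAt_symm x₀).contMDiffAt ((isOpen_extChartAt_target x₀).mem_nhds hy)))

theorem Form.inChart_pullback_eventuallyEq (η : Form J N k) {f : M → N} (hf : ContMDiff I J ∞ f)
    {x₀ : M} {q : N} {y : E} (hy : y ∈ (extChartAt I x₀).target)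
    (hq : f ((extChartAt I x₀).symm y) ∈ (chartAt H' q).source) :
    Form.inChart (Form.pullback (I := I) f η) x₀ =ᶠ[nhds y] fun y =>
      (Form.inChart η q ((extChartAt J q ∘ f ∘ (extChartAt I x₀).symm) y)).compContinuousLinearMap
        (fderiv ℝ (extChartAt J q ∘ f ∘ (extChartAt I x₀).symm) y) := by
  have h1 : ∀ᶠ y' in nhds y, f ((extChartAt I x₀).symm y') ∈ (chartAt H' q).source :=
    (hf.continuous.continuousAt.comp (continuousAt_extChartAt_symm'' hy)).eventually
      ((chartAt H' q).open_source.mem_nhds hq)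
  filter_upwards [h1, (isOpen_extChartAt_target x₀).mem_nhds hy] with y' h1 h2
  exact Form.inChart_pullback η h2 ((hf _).mdifferentiableAt (by simp)) h1

theorem Form.IsSmooth.contDiffAt {η : Form J N k} (hη : η.IsSmooth) {q : N} {y : E'}
    (hy : y ∈ (extChartAt J q).target) : ContDiffAt ℝ ∞ (Form.inChart η q) y :=
  (hη q).contDiffAt ((isOpen_extChartAt_target q).mem_nhds hy)

theorem Form.IsSmooth.pullback {η : Form J N k} (hη : η.IsSmooth) {f : M → N}
    (hf : ContMDiff I J ∞ f) : (Form.pullback (I := I) f η).IsSmooth := by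
  intro x₀ y hy
  set q := f ((extChartAt I x₀).symm y)
  have hq : f ((extChartAt I x₀).symm y) ∈ (chartAt H' q).source := mem_chart_source _ _
  refine ContDiffAt.contDiffWithinAt ?_
  refine ContDiffAt.congr_of_eventuallyEq ?_ (Form.inChart_pullback_eventuallyEq η hf hy hq)
  have hg := contMDiff_chart_expression hf hy hq
  have h1 : ContDiffAt ℝ ∞ (Form.inChart η q)
      ((extChartAt J q ∘ f ∘ (extChartAt I x₀).symm) y) :=
    hη.contDiffAt ((extChartAt J q).map_source (by rw [extChartAt_source]; exact hq))
  rw [← contDiffWithinAt_univ]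
  exact ContDiffWithinAt.alt_comp (h1.comp y hg).contDiffWithinAt
    (hg.fderiv_right (m := ∞) (by simp)).contDiffWithinAt

theorem Form.d_eq (η : Form I M k) (x : M) :
    Form.d η x = (extDeriv (Form.inChart η x) (extChartAt I x x) : E [⋀^Fin (k + 1)]→L[ℝ] ℂ) := by
  have : IsManifold I 1 M := IsManifold.of_le (n := ∞) (by simp)
  rw [Form.d, I.range_eq_univ, extDerivWithin_univ, mfderiv_extChartAt_self]
  rfl

theorem Form.extDeriv_inChart_pullback {η : Form J N k} (hη : η.IsSmooth) {f : M → N}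
    (hf : ContMDiff I J ∞ f) {x₀ : M} {q : N} {y : E} (hy : y ∈ (extChartAt I x₀).target)
    (hq : f ((extChartAt I x₀).symm y) ∈ (chartAt H' q).source) :
    extDeriv (Form.inChart (Form.pullback (I := I) f η) x₀) y =
      (extDeriv (Form.inChart η q)
        (extChartAt J q (f ((extChartAt I x₀).symm y)))).compContinuousLinearMap
        (fderiv ℝ (extChartAt J q ∘ f ∘ (extChartAt I x₀).symm) y) := by
  rw [(Form.inChart_pullback_eventuallyEq η hf hy hq).extDeriv_eq]
  refine extDeriv_pullback (r := ∞) ?_ (contMDiff_chart_expression hf hy hq) minSmoothness_two_le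
  exact (hη.contDiffAt ((extChartAt J q).map_source
    (by rw [extChartAt_source]; exact hq))).differentiableAt (by simp)

theorem Form.inChart_d {η : Form I M k} (hη : η.IsSmooth) {x₀ : M} {y : E}
    (hy : y ∈ (extChartAt I x₀).target) :
    Form.inChart (Form.d η) x₀ y = extDeriv (Form.inChart η x₀) y := by
  set p := (extChartAt I x₀).symm y with hp
  have hq : id ((extChartAt I x₀).symm y) ∈ (chartAt H p).source := mem_chart_source _ _
  have h := Form.extDeriv_inChart_pullback hη (f := id) contMDiff_id hy hq
  rw [Form.pullback_id] at h
  rw [h, Form.inChart_eq, ← hp, Form.d_eq]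
  ext v
  refine congrArg (extDeriv (Form.inChart η p) (extChartAt I p p)) (funext fun i => ?_)
  refine Eq.trans ?_ (fderiv_chart_expression hy mdifferentiableAt_id hq (v i)).symm
  have : IsManifold I 1 M := IsManifold.of_le (n := ∞) (by simp)
  rw [id, ← hp, mfderiv_extChartAt_self, mfderiv_id]
  rfl

theorem extDeriv_contDiffAt {V : Type*} [NormedAddCommGroup V] [NormedSpace ℝ V]
    {α : V → V [⋀^Fin k]→L[ℝ] ℂ} {y : V} (h : ContDiffAt ℝ ∞ α y) :
    ContDiffAt ℝ ∞ (extDeriv α) y := by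
  change ContDiffAt ℝ ∞ (fun y => ContinuousAlternatingMap.alternatizeUncurryFinCLM ℝ V ℂ
    (fderiv ℝ α y)) y
  exact (ContinuousLinearMap.contDiff _).contDiffAt.comp y (h.fderiv_right (m := ∞) (by simp))

theorem Form.IsSmooth.d {η : Form I M k} (hη : η.IsSmooth) : (Form.d η).IsSmooth := by
  intro x₀ y hy
  refine (ContDiffAt.congr_of_eventuallyEq (extDeriv_contDiffAt (hη.contDiffAt hy)) ?_).contDiffWithinAt
  filter_upwards [(isOpen_extChartAt_target x₀).mem_nhds hy] with y' hy'
  exact Form.inChart_d hη hy'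

theorem Form.d_d {η : Form I M k} (hη : η.IsSmooth) : Form.d (Form.d η) = 0 := by
  funext x
  have h : Form.inChart (Form.d η) x =ᶠ[nhds (extChartAt I x x)] extDeriv (Form.inChart η x) := by
    filter_upwards [(isOpen_extChartAt_target x).mem_nhds (mem_extChartAt_target x)] with y' hy'
    exact Form.inChart_d hη hy'
  rw [Form.d_eq, h.extDeriv_eq]
  exact extDeriv_extDeriv_apply (hη.contDiffAt (mem_extChartAt_target x)) minSmoothness_two_le

theorem Form.d_pullback {η : Form J N k} (hη : η.IsSmooth) {f : M → N} (hf : ContMDiff I J ∞ f) :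
    Form.d (Form.pullback (I := I) f η) = Form.pullback (I := I) f (Form.d η) := by
  funext x
  have hx : (extChartAt I x).symm (extChartAt I x x) = x := extChartAt_to_inv x
  have hq : f ((extChartAt I x).symm (extChartAt I x x)) ∈ (chartAt H' (f x)).source := by
    rw [hx]; exact mem_chart_source _ _
  have : IsManifold I 1 M := IsManifold.of_le (n := ∞) (by simp)
  have : IsManifold J 1 N := IsManifold.of_le (n := ∞) (by simp)
  rw [Form.d_eq, Form.extDeriv_inChart_pullback hη hf (mem_extChartAt_target x) hq, Form.pullback,
    Form.d_eq]
  ext v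
  rw [ContinuousAlternatingMap.compContinuousLinearMap_apply]
  have h1 : fderiv ℝ (extChartAt J (f x) ∘ f ∘ (extChartAt I x).symm) (extChartAt I x x) =
      (mfderiv I J f x : E →L[ℝ] E') := by
    ext w
    rw [fderiv_chart_expression (mem_extChartAt_target x) ((hf _).mdifferentiableAt (by simp)) hq]
    have h2 := mfderivWithin_range_extChartAt_symm (I := I) (x := x)
    rw [I.range_eq_univ, mfderivWithin_univ] at h2
    rw [h2, hx, mfderiv_extChartAt_self]
    rfl
  rw [h1, hx]
  rfl

theorem Form.inChart_wedge (α : Form I M m) (β : Form I M n) (x₀ : M) (y : E) :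
    Form.inChart (α.wedge β) x₀ y = wedgeAlt (Form.inChart α x₀ y) (Form.inChart β x₀ y) := by
  rw [Form.inChart_eq, Form.inChart_eq, Form.inChart_eq]
  exact wedgeAlt_comp _ _ _

theorem Form.pullback_wedge (α : Form J N m) (β : Form J N n) (f : M → N) :
    Form.pullback (I := I) f (α.wedge β) =
      (Form.pullback (I := I) f α).wedge (Form.pullback (I := I) f β) :=
  funext fun _ => wedgeAlt_comp _ _ _

theorem Form.IsSmooth.wedge {α : Form I M m} {β : Form I M n} (hα : α.IsSmooth)
    (hβ : β.IsSmooth) : (α.wedge β).IsSmooth := by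
  intro x₀ y hy
  simp_rw [funext fun y => Form.inChart_wedge α β x₀ y]
  exact ContDiffWithinAt.wedgeAlt (hα x₀ y hy) (hβ x₀ y hy)

theorem Form.isSmooth_sum {ι : Type*} (s : Finset ι) {α : ι → Form I M k}
    (h : ∀ i ∈ s, (α i).IsSmooth) : (∑ i ∈ s, α i).IsSmooth :=
  (SmoothForm I M k).sum_mem h

theorem Form.d_sum {ι : Type*} (s : Finset ι) {α : ι → Form I M k}
    (h : ∀ i ∈ s, (α i).IsSmooth) : Form.d (∑ i ∈ s, α i) = ∑ i ∈ s, Form.d (α i) := by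
  classical
  induction s using Finset.induction_on with
  | empty => simp [Form.d_zero]
  | insert a s ha ih =>
    rw [Finset.sum_insert ha, Finset.sum_insert ha,
      Form.d_add (h a (by simp)) (Form.isSmooth_sum s fun i hi => h i (by simp [hi])),
      ih fun i hi => h i (by simp [hi])]

variable (I) in
/-- The element of the exterior algebra attached to an alternating form on a tangent space. -/
def ext (x : M) : (TangentSpace I x [⋀^Fin k]→L[ℝ] ℂ) →ₗ[ℂ] CoordExt (Fin (Module.finrank ℝ E)) :=
  toExt (Module.finBasis ℝ E : Module.Basis _ ℝ (TangentSpace I x))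

theorem ext_injective (x : M) :
    Function.Injective (ext I x : (TangentSpace I x [⋀^Fin k]→L[ℝ] ℂ) → _) := toExt_injective _

theorem ext_wedge (α : Form I M m) (β : Form I M n) (x : M) :
    ext I x (α.wedge β x) = ext I x (α x) * ext I x (β x) := toExt_wedge _ _ _

theorem ext_d_wedge {α : Form I M m} {β : Form I M n} (hα : α.IsSmooth) (hβ : β.IsSmooth) (x : M) :
    ext I x (Form.d (α.wedge β) x) = ext I x (Form.d α x) * ext I x (β x) +
      (-1 : ℂ) ^ m • (ext I x (α x) * ext I x (Form.d β x)) := by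
  have : IsManifold I 1 M := IsManifold.of_le (n := ∞) (by simp)
  rw [Form.d_eq, Form.d_eq, Form.d_eq, funext fun y => Form.inChart_wedge α β x y]
  refine (toExt_extDeriv_wedge _
    ((hα.contDiffAt (mem_extChartAt_target x)).differentiableAt (by simp))
    ((hβ.contDiffAt (mem_extChartAt_target x)).differentiableAt (by simp))).trans ?_
  have h : ∀ {j : ℕ} (γ : Form I M j), Form.inChart γ x (extChartAt I x x) = γ x := by
    intro j γ
    have h2 := mfderivWithin_range_extChartAt_symm (I := I) (x := x)
    ext v
    rw [Form.inChart, h2]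
    exact Form.apply_congr γ (extChartAt_to_inv x) v
  rw [h, h]
  rfl

end ManifoldCalculus

/-! ### Naturality and closedness of the Chern character form -/

section ConnectionCalculus

variable {E : Type*} [NormedAddCommGroup E] [NormedSpace ℝ E] [FiniteDimensional ℝ E]
  {H : Type*} [TopologicalSpace H] {I : ModelWithCorners ℝ E H} [I.Boundaryless]
  {M : Type*} [TopologicalSpace M] [ChartedSpace H M] [IsManifold I ∞ M]
  {E' : Type*} [NormedAddCommGroup E'] [NormedSpace ℝ E'] [FiniteDimensional ℝ E']
  {H' : Type*} [TopologicalSpace H'] {J : ModelWithCorners ℝ E' H'} [J.Boundaryless]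
  {N : Type*} [TopologicalSpace N] [ChartedSpace H' N] [IsManifold J ∞ N] {k m n r : ℕ}

theorem Form.pullback_add (f : M → N) (α β : Form J N k) :
    Form.pullback (I := I) f (α + β) = Form.pullback (I := I) f α + Form.pullback (I := I) f β := rfl

theorem Form.pullback_smul (f : M → N) (c : ℂ) (α : Form J N k) :
    Form.pullback (I := I) f (c • α) = c • Form.pullback (I := I) f α := rfl

theorem Form.pullback_sum {ι : Type*} (f : M → N) (s : Finset ι) (α : ι → Form J N k) :
    Form.pullback (I := I) f (∑ i ∈ s, α i) = ∑ i ∈ s, Form.pullback (I := I) f (α i) :=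
  map_sum (AddMonoidHom.mk' (Form.pullback (I := I) (J := J) (k := k) f)
    (Form.pullback_add f)) _ _

theorem Form.pullback_pullback {E'' : Type*} [NormedAddCommGroup E''] [NormedSpace ℝ E'']
    {H'' : Type*} [TopologicalSpace H''] {J' : ModelWithCorners ℝ E'' H''}
    {L : Type*} [TopologicalSpace L] [ChartedSpace H'' L] {f : M → N} {g : N → L}
    (hf : ContMDiff I J ∞ f) (hg : ContMDiff J J' ∞ g) (α : Form J' L k) :
    Form.pullback (I := I) f (Form.pullback (I := J) g α) = Form.pullback (I := I) (g ∘ f) α := by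
  funext x
  ext v
  have h := mfderiv_comp x ((hg (f x)).mdifferentiableAt (by simp))
    ((hf x).mdifferentiableAt (by simp))
  rw [Form.pullback, Form.pullback, Form.pullback, h]
  rfl

theorem Connection.curvature_apply (c : Connection I M r) (i j : Fin r) :
    c.curvature i j = Form.d (c.form i j : Form I M 1) +
      ∑ l, (c.form i l : Form I M 1).wedge (c.form l j : Form I M 1) := rfl

theorem Connection.curvaturePow_succ (c : Connection I M r) (k : ℕ) :
    c.curvaturePow (k + 1) = matWedge (c.curvaturePow k) c.curvature := rfl

theorem matWedge_isSmooth {P : Matrix (Fin r) (Fin r) (Form I M m)}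
    {Q : Matrix (Fin r) (Fin r) (Form I M n)} (hP : ∀ i j, (P i j).IsSmooth)
    (hQ : ∀ i j, (Q i j).IsSmooth) (i j : Fin r) : (matWedge P Q i j).IsSmooth :=
  Form.isSmooth_sum (Finset.univ : Finset (Fin r)) (α := fun l => (P i l).wedge (Q l j))
    fun l _ => (hP i l).wedge (hQ l j)

theorem Connection.curvature_isSmooth (c : Connection I M r) (i j : Fin r) :
    (c.curvature i j).IsSmooth :=
  (SmoothForm I M 2).add_mem (Form.IsSmooth.d (c.form i j).2)
    (matWedge_isSmooth (fun i j => (c.form i j).2) (fun i j => (c.form i j).2) i j)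

theorem matOne_isSmooth (i j : Fin r) : (matOne i j : Form I M 0).IsSmooth := by
  intro x₀
  have h : Form.inChart (matOne i j : Form I M 0) x₀ = fun _ =>
      ContinuousAlternatingMap.constOfIsEmpty ℝ E (Fin 0) (if i = j then (1 : ℂ) else 0) := by
    funext y
    ext v
    rfl
  rw [h]
  exact contDiffOn_const

theorem Connection.curvaturePow_isSmooth (c : Connection I M r) (k : ℕ) (i j : Fin r) :
    (c.curvaturePow k i j).IsSmooth := by
  induction k generalizing i j with
  | zero => exact matOne_isSmooth i j
  | succ k ih => exact matWedge_isSmooth ih c.curvature_isSmooth i j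

theorem Connection.ch_isSmooth (c : Connection I M r) (k : ℕ) : (c.ch k).IsSmooth :=
  (SmoothForm I M (2 * k)).smul_mem _
    (Form.isSmooth_sum _ fun i _ => c.curvaturePow_isSmooth k i i)

/-- The pullback of a connection. -/
def Connection.pullback (c : Connection J N r) (f : M → N) (hf : ContMDiff I J ∞ f) :
    Connection I M r :=
  ⟨fun i j => ⟨Form.pullback f (c.form i j : Form J N 1), Form.IsSmooth.pullback (c.form i j).2 hf⟩⟩

theorem Connection.curvature_pullback (c : Connection J N r) (f : M → N) (hf : ContMDiff I J ∞ f)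
    (i j : Fin r) :
    (c.pullback f hf).curvature i j = Form.pullback f (c.curvature i j) := by
  rw [Connection.curvature_apply, Connection.curvature_apply, Form.pullback_add, Form.pullback_sum]
  simp_rw [Form.pullback_wedge]
  congr 1
  exact Form.d_pullback (c.form i j).2 hf

theorem Connection.curvaturePow_pullback (c : Connection J N r) (f : M → N)
    (hf : ContMDiff I J ∞ f) (k : ℕ) (i j : Fin r) :
    (c.pullback f hf).curvaturePow k i j = Form.pullback f (c.curvaturePow k i j) := by
  induction k generalizing i j with
  | zero => rfl
  | succ k ih =>
    rw [Connection.curvaturePow_succ, Connection.curvaturePow_succ]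
    simp only [matWedge, Matrix.of_apply, Form.pullback_sum, Form.pullback_wedge, ih,
      Connection.curvature_pullback]

theorem Connection.ch_pullback (c : Connection J N r) (f : M → N) (hf : ContMDiff I J ∞ f)
    (k : ℕ) : (c.pullback f hf).ch k = Form.pullback f (c.ch k) := by
  simp only [Connection.ch, Form.pullback_smul, Form.pullback_sum,
    Connection.curvaturePow_pullback]

variable (I) in
/-- A matrix of forms at a point, as a matrix over the exterior algebra. -/
def extMat (P : Matrix (Fin r) (Fin r) (Form I M k)) (x : M) :
    Matrix (Fin r) (Fin r) (CoordExt (Fin (Module.finrank ℝ E))) :=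
  Matrix.of fun i j => ext I x (P i j x)

theorem extMat_apply (P : Matrix (Fin r) (Fin r) (Form I M k)) (x : M) (i j : Fin r) :
    extMat I P x i j = ext I x (P i j x) := rfl

theorem ext_sum {ι : Type*} (s : Finset ι) (α : ι → Form I M k) (x : M) :
    ext I x ((∑ i ∈ s, α i) x) = ∑ i ∈ s, ext I x (α i x) := by
  rw [Finset.sum_apply, map_sum]

theorem extMat_matWedge (P : Matrix (Fin r) (Fin r) (Form I M m))
    (Q : Matrix (Fin r) (Fin r) (Form I M n)) (x : M) :
    extMat I (matWedge P Q) x = extMat I P x * extMat I Q x := by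
  ext i j
  rw [extMat_apply, Matrix.mul_apply]
  have h : matWedge P Q i j = ∑ l, (P i l).wedge (Q l j) := rfl
  rw [h, ext_sum]
  exact Finset.sum_congr rfl fun l _ => ext_wedge _ _ _

theorem ext_const (x : M) (c : ℂ) :
    ext I x (ContinuousAlternatingMap.constOfIsEmpty ℝ (TangentSpace I x) (Fin 0) c) =
      algebraMap ℂ (CoordExt (Fin (Module.finrank ℝ E))) c := toExt_const _ _

theorem extMat_matOne (x : M) : extMat I (matOne : Matrix (Fin r) (Fin r) (Form I M 0)) x = 1 := by
  ext i j
  rw [extMat_apply, Matrix.one_apply]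
  have h : (matOne i j : Form I M 0) x = ContinuousAlternatingMap.constOfIsEmpty ℝ
    (TangentSpace I x) (Fin 0) (if i = j then (1 : ℂ) else 0) := rfl
  rw [h, ext_const]
  by_cases h' : i = j
  · rw [if_pos h', if_pos h', RingHom.map_one]
  · rw [if_neg h', if_neg h', RingHom.map_zero]

theorem Connection.extMat_curvaturePow (c : Connection I M r) (k : ℕ) (x : M) :
    extMat I (c.curvaturePow k) x = extMat I c.curvature x ^ k := by
  induction k with
  | zero => exact extMat_matOne x
  | succ k ih => rw [Connection.curvaturePow_succ, extMat_matWedge, ih, pow_succ]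

/-- The connection form, as a matrix of forms. -/
def Connection.formMat (c : Connection I M r) : Matrix (Fin r) (Fin r) (Form I M 1) :=
  fun i j => c.form i j

/-- The entrywise exterior derivative of a matrix of forms. -/
def matD (P : Matrix (Fin r) (Fin r) (Form I M k)) : Matrix (Fin r) (Fin r) (Form I M (k + 1)) :=
  Matrix.of fun i j => Form.d (P i j)

theorem extMat_matD (P : Matrix (Fin r) (Fin r) (Form I M k)) (x : M) (i j : Fin r) :
    extMat I (matD P) x i j = ext I x (Form.d (P i j) x) := rfl

theorem extMat_matD_matWedge (hm : Even m) {P : Matrix (Fin r) (Fin r) (Form I M m)}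
    {Q : Matrix (Fin r) (Fin r) (Form I M n)} (hP : ∀ i j, (P i j).IsSmooth)
    (hQ : ∀ i j, (Q i j).IsSmooth) (x : M) :
    ∀ i j, ext I x (Form.d (matWedge P Q i j) x) =
      (extMat I (matD P) x * extMat I Q x + extMat I P x * extMat I (matD Q) x) i j := by
  intro i j
  rw [Matrix.add_apply, Matrix.mul_apply, Matrix.mul_apply, ← Finset.sum_add_distrib]
  have h : Form.d (matWedge P Q i j) = ∑ l, Form.d ((P i l).wedge (Q l j)) :=
    Form.d_sum (Finset.univ : Finset (Fin r)) (α := fun l => (P i l).wedge (Q l j))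
      fun l _ => (hP i l).wedge (hQ l j)
  rw [h, ext_sum]
  refine Finset.sum_congr rfl fun l _ => ?_
  rw [ext_d_wedge (hP i l) (hQ l j), hm.neg_one_pow, one_smul]
  rfl

/-- The exterior derivative of the connection form, as a matrix of forms. -/
def Connection.dForm (c : Connection I M r) : Matrix (Fin r) (Fin r) (Form I M 2) :=
  fun i j => Form.d (c.form i j : Form I M 1)

theorem Connection.extMat_curvature (c : Connection I M r) (x : M) :
    extMat I c.curvature x = extMat I c.dForm x + extMat I c.formMat x * extMat I c.formMat x := by
  rw [← extMat_matWedge]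
  ext i j
  rw [Matrix.add_apply, extMat_apply, extMat_apply, extMat_apply, ← map_add]
  rfl

theorem Connection.extMat_d_curvature (c : Connection I M r) (x : M) :
    extMat I (matD c.curvature) x =
      extMat I c.curvature x * extMat I c.formMat x -
        extMat I c.formMat x * extMat I c.curvature x := by
  rw [Connection.extMat_curvature, add_mul, mul_add, ← mul_assoc, add_sub_add_right_eq_sub]
  ext i j
  rw [extMat_matD, Connection.curvature_apply, Form.d_add (Form.IsSmooth.d (c.form i j).2)
    (Form.isSmooth_sum _ fun l _ => (c.form i l).2.wedge (c.form l j).2),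
    Form.d_d (c.form i j).2, zero_add,
    Form.d_sum _ fun l _ => (c.form i l).2.wedge (c.form l j).2, ext_sum, Matrix.sub_apply,
    Matrix.mul_apply, Matrix.mul_apply, ← Finset.sum_sub_distrib]
  refine Finset.sum_congr rfl fun l _ => ?_
  rw [ext_d_wedge (c.form i l).2 (c.form l j).2, pow_one, neg_one_smul, sub_eq_add_neg]
  rfl

theorem Connection.extMat_d_curvaturePow (c : Connection I M r) (k : ℕ) (x : M) :
    extMat I (matD (c.curvaturePow k)) x =
      extMat I c.curvature x ^ k * extMat I c.formMat x -
        extMat I c.formMat x * extMat I c.curvature x ^ k := by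
  induction k with
  | zero =>
    rw [pow_zero, one_mul, mul_one, sub_self]
    ext i j
    rw [extMat_matD]
    have h : Form.d (c.curvaturePow 0 i j) = 0 := by
      funext y
      rw [Form.d_eq]
      have h : Form.inChart (c.curvaturePow 0 i j) y = fun _ =>
        ContinuousAlternatingMap.constOfIsEmpty ℝ E (Fin 0) (if i = j then (1 : ℂ) else 0) := rfl
      rw [h]
      simp only [extDeriv, fderiv_fun_const]
      ext v
      simp [ContinuousAlternatingMap.alternatizeUncurryFin_apply]
      rfl
    rw [h]
    exact map_zero _
  | succ k ih =>
    rw [Connection.curvaturePow_succ]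
    have key := extMat_matD_matWedge (even_two_mul k) (c.curvaturePow_isSmooth k)
      c.curvature_isSmooth x
    simp only [ih, Connection.extMat_d_curvature, Connection.extMat_curvaturePow] at key
    refine Eq.trans (Matrix.ext key) ?_
    rw [pow_succ]
    noncomm_ring

theorem ext_even_commute (hk : Even k) (x : M) (η : Form I M k)
    (y : CoordExt (Fin (Module.finrank ℝ E))) : Commute (ext I x (η x)) y :=
  toExt_even_commute _ hk _ _

theorem trace_mul_comm_of_commute {R : Type*} [Ring R] {P Q : Matrix (Fin r) (Fin r) R}
    (h : ∀ i j y, Commute (P i j) y) : (P * Q).trace = (Q * P).trace := by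
  simp only [Matrix.trace, Matrix.diag_apply, Matrix.mul_apply]
  rw [Finset.sum_comm]
  exact Finset.sum_congr rfl fun i _ => Finset.sum_congr rfl fun j _ => h _ _ _

theorem Connection.curvaturePow_commute (c : Connection I M r) (k : ℕ) (x : M) (i j : Fin r)
    (y : CoordExt (Fin (Module.finrank ℝ E))) :
    Commute ((extMat I c.curvature x ^ k) i j) y := by
  rw [← Connection.extMat_curvaturePow]
  exact ext_even_commute (even_two_mul k) _ _ _

theorem Connection.d_ch (c : Connection I M r) (k : ℕ) : Form.d (c.ch k) = 0 := by
  rw [Connection.ch, Form.d_smul _ (Form.isSmooth_sum _ fun i _ => c.curvaturePow_isSmooth k i i),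
    Form.d_sum _ fun i _ => c.curvaturePow_isSmooth k i i]
  have h : ∑ i, Form.d (c.curvaturePow k i i) = 0 := by
    funext x
    refine ext_injective x ?_
    rw [ext_sum]
    have h1 := congrArg Matrix.trace (c.extMat_d_curvaturePow k x)
    rw [Matrix.trace_sub, trace_mul_comm_of_commute (c.curvaturePow_commute k x), sub_self] at h1
    exact h1.trans (map_zero _).symm
  rw [h]
  funext x
  ext v
  simp

end ConnectionCalculus

/-! ### Integration over the second factor of a product -/

section ProductCalculus

open MeasureTheory Set

universe u

variable {Z : Type u} {Q : Type*} [NormedAddCommGroup Z] [NormedSpace ℝ Z]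
  [FiniteDimensional ℝ Z]
  [NormedAddCommGroup Q] [NormedSpace ℝ Q] [MeasurableSpace Q] [BorelSpace Q]
  [FiniteDimensional ℝ Q] {ν : Measure Q} [IsLocallyFiniteMeasure ν] {K : Set Q} {U : Set Z} {k : ℕ}

theorem ContDiffOn.continuous_slice {F : Type*} [NormedAddCommGroup F] [NormedSpace ℝ F]
    {f : Z × Q → F} (hf : ContDiffOn ℝ ∞ f (U ×ˢ univ)) {z : Z} (hz : z ∈ U) :
    Continuous fun q => f (z, q) :=
  continuousOn_univ.1 (hf.continuousOn.comp (by fun_prop) fun q _ => ⟨hz, mem_univ q⟩)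

theorem extDeriv_setIntegral (hU : IsOpen U) (hK : IsCompact K) {f : Z × Q → Z [⋀^Fin k]→L[ℝ] ℂ}
    (hf : ContDiffOn ℝ ∞ f (U ×ˢ univ)) {z : Z} (hz : z ∈ U) :
    extDeriv (fun z => ∫ q in K, f (z, q) ∂ν) z =
      ∫ q in K, extDeriv (fun z => f (z, q)) z ∂ν := by
  have h1 := (hasFDerivAt_setIntegral (ν := ν) hU hK hf hz).fderiv
  have h2 : ∀ q, fderiv ℝ (fun z => f (z, q)) z =
      (fderiv ℝ f (z, q)).comp (ContinuousLinearMap.inl ℝ Z Q) := by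
    intro q
    have h3 : HasFDerivAt f (fderiv ℝ f (z, q)) (z, q) :=
      ((hf.contDiffAt ((hU.prod isOpen_univ).mem_nhds ⟨hz, mem_univ q⟩)).differentiableAt
        (by simp)).hasFDerivAt
    exact (h3.comp z (hasFDerivAt_prodMk_left z q)).fderiv
  change ContinuousAlternatingMap.alternatizeUncurryFinCLM ℝ Z ℂ _ =
    ∫ q in K, ContinuousAlternatingMap.alternatizeUncurryFinCLM ℝ Z ℂ _ ∂ν
  rw [h1]
  simp_rw [h2]
  have h3 := ContinuousLinearMap.integral_comp_comm (𝕜 := ℝ) (μ := ν.restrict K)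
    (E := Z →L[ℝ] Z [⋀^Fin k]→L[ℝ] ℂ) (Fₗ := Z [⋀^Fin (k + 1)]→L[ℝ] ℂ)
    (φ := fun q => (fderiv ℝ f (z, q)).comp (ContinuousLinearMap.inl ℝ Z Q))
    (ContinuousAlternatingMap.alternatizeUncurryFinCLM ℝ Z ℂ)
  refine (h3 ?_).symm
  exact (ContDiffOn.continuous_slice (contDiffOn_partial_fderiv hU hf)
    hz).continuousOn.integrableOn_compact hK

/-- The restriction of a form on a product to the first factor. -/
def restrictL (Z Q : Type*) [NormedAddCommGroup Z] [NormedSpace ℝ Z] [NormedAddCommGroup Q]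
    [NormedSpace ℝ Q] (k : ℕ) : ((Z × Q) [⋀^Fin k]→L[ℝ] ℂ) →L[ℝ] Z [⋀^Fin k]→L[ℝ] ℂ :=
  ContinuousAlternatingMap.compContinuousLinearMapCLM (ContinuousLinearMap.inl ℝ Z Q)

theorem extDeriv_restrictL {η : Z × Q → (Z × Q) [⋀^Fin k]→L[ℝ] ℂ} {z : Z} {q : Q}
    (hη : DifferentiableAt ℝ η (z, q)) :
    extDeriv (fun z => restrictL Z Q k (η (z, q))) z = restrictL Z Q (k + 1) (extDeriv η (z, q)) := by
  have h1 : ∀ z, fderiv ℝ (fun z : Z => (z, q)) z = ContinuousLinearMap.inl ℝ Z Q := fun z =>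
    (hasFDerivAt_prodMk_left z q).fderiv
  have h := extDeriv_pullback (f := fun z : Z => (z, q)) (x := z) (r := ∞) hη
    (by fun_prop) minSmoothness_two_le
  simp only [h1] at h
  exact h

theorem extDeriv_box {Ω : Z × (ℝ × ℝ) → (Z × (ℝ × ℝ)) [⋀^Fin (k + 2)]→L[ℝ] ℂ} (hU : IsOpen U)
    (hΩ : ContDiffOn ℝ ∞ Ω (U ×ˢ univ)) (hd : ∀ z ∈ U, ∀ q, extDeriv Ω (z, q) = 0) {a b : ℝ × ℝ}
    (hab : a ≤ b) {z : Z} (hz : z ∈ U) :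
    extDeriv (fun z => ∫ q in Icc a b,
      restrictL Z (ℝ × ℝ) k (contr (0, (1, 0)) (contr (0, (0, 1)) (Ω (z, q))))) z =
      (((-∫ t in a.1..b.1, restrictL Z (ℝ × ℝ) (k + 1) (contr (0, (1, 0)) (Ω (z, (t, b.2))))) -
        (-∫ t in a.1..b.1, restrictL Z (ℝ × ℝ) (k + 1) (contr (0, (1, 0)) (Ω (z, (t, a.2))))) +
        ∫ s in a.2..b.2, restrictL Z (ℝ × ℝ) (k + 1) (contr (0, (0, 1)) (Ω (z, (b.1, s))))) -
        ∫ s in a.2..b.2, restrictL Z (ℝ × ℝ) (k + 1) (contr (0, (0, 1)) (Ω (z, (a.1, s))))) := by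
  set R := restrictL Z (ℝ × ℝ) (k + 1)
  have hopen := hU.prod (isOpen_univ (X := ℝ × ℝ))
  have hdiff : ∀ q, DifferentiableAt ℝ Ω (z, q) := fun q =>
    (hΩ.contDiffAt (hopen.mem_nhds ⟨hz, mem_univ q⟩)).differentiableAt (by simp)
  have hcomp : ∀ {k' : ℕ} (L : ((Z × (ℝ × ℝ)) [⋀^Fin (k + 2)]→L[ℝ] ℂ) →L[ℝ]
      Z [⋀^Fin k']→L[ℝ] ℂ), ContDiffOn ℝ ∞ (fun p => L (Ω p)) (U ×ˢ univ) := fun L =>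
    L.contDiff.comp_contDiffOn hΩ
  set L0 := (restrictL Z (ℝ × ℝ) k).comp ((contrL k ((0 : Z), ((1 : ℝ), (0 : ℝ)))).comp
    (contrL (k + 1) ((0 : Z), ((0 : ℝ), (1 : ℝ)))))
  refine (extDeriv_setIntegral (f := fun p => L0 (Ω p)) hU isCompact_Icc (hcomp L0) hz).trans ?_
  have hG : ∀ (w : ℝ × ℝ) (q : ℝ × ℝ), HasFDerivAt (fun q => R (contr ((0 : Z), w) (Ω (z, q))))
      ((R.comp (fderiv ℝ (fun p => contr ((0 : Z), w) (Ω p)) (z, q))).comp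
        (ContinuousLinearMap.inr ℝ Z (ℝ × ℝ))) q := by
    intro w q
    have h1 : HasFDerivAt (fun p => contr ((0 : Z), w) (Ω p))
      (fderiv ℝ (fun p => contr ((0 : Z), w) (Ω p)) (z, q)) (z, q) :=
      ((contrL (k + 1) ((0 : Z), w)).differentiableAt.comp (z, q) (hdiff q)).hasFDerivAt
    exact (R.hasFDerivAt.comp (z, q) h1).comp q (hasFDerivAt_prodMk_right z q)
  have hcont : ∀ w : ℝ × ℝ, Continuous fun q => R (contr ((0 : Z), w) (Ω (z, q))) := fun w =>
    ContDiffOn.continuous_slice (hcomp (R.comp (contrL (k + 1) ((0 : Z), w)))) hz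
  have hint : ∀ q, extDeriv (fun z => L0 (Ω (z, q))) z =
      ((R.comp (fderiv ℝ (fun p => contr ((0 : Z), ((0 : ℝ), (1 : ℝ))) (Ω p)) (z, q))).comp
        (ContinuousLinearMap.inr ℝ Z (ℝ × ℝ))) (1, 0) +
      (-((R.comp (fderiv ℝ (fun p => contr ((0 : Z), ((1 : ℝ), (0 : ℝ))) (Ω p)) (z, q))).comp
        (ContinuousLinearMap.inr ℝ Z (ℝ × ℝ)))) (0, 1) := by
    intro q
    have h2 : DifferentiableAt ℝ (fun p => contr ((0 : Z), ((1 : ℝ), (0 : ℝ)))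
        (contr ((0 : Z), ((0 : ℝ), (1 : ℝ))) (Ω p))) (z, q) :=
      ((contrL k ((0 : Z), ((1 : ℝ), (0 : ℝ)))).comp
        (contrL (k + 1) ((0 : Z), ((0 : ℝ), (1 : ℝ))))).differentiableAt.comp (z, q) (hdiff q)
    have h1 := extDeriv_restrictL (k := k) (η := fun p =>
      contr ((0 : Z), ((1 : ℝ), (0 : ℝ))) (contr ((0 : Z), ((0 : ℝ), (1 : ℝ))) (Ω p))) (z := z)
      (q := q) h2
    refine h1.trans ?_
    rw [extDeriv_contr_contr (hdiff q) (hd z hz q), map_sub, sub_eq_add_neg]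
    rfl
  have hcont' : ∀ w w' : ℝ × ℝ, Continuous fun q =>
      ((R.comp (fderiv ℝ (fun p => contr ((0 : Z), w) (Ω p)) (z, q))).comp
        (ContinuousLinearMap.inr ℝ Z (ℝ × ℝ))) w' := by
    intro w w'
    have h1 : ContDiffOn ℝ ∞ (fun p => R (fderiv ℝ (fun p => contr ((0 : Z), w) (Ω p)) p
        (ContinuousLinearMap.inr ℝ Z (ℝ × ℝ) w'))) (U ×ˢ univ) := by
      refine R.contDiff.comp_contDiffOn (ContDiffOn.clm_apply ?_ contDiffOn_const)
      exact ((contrL (k + 1) ((0 : Z), w)).contDiff.comp_contDiffOn hΩ).fderiv_of_isOpen hopen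
        (by simp)
    exact ContDiffOn.continuous_slice h1 hz
  simp_rw [hint]
  refine (integral_divergence_prod_Icc_of_hasFDerivAt_of_le _
    (fun q => -R (contr ((0 : Z), ((1 : ℝ), (0 : ℝ))) (Ω (z, q)))) _ _ a b hab
    (hcont (0, 1)).continuousOn (hcont (1, 0)).neg.continuousOn (fun q _ => hG (0, 1) q)
    (fun q _ => (hG (1, 0) q).neg) ?_).trans ?_
  · refine Continuous.integrableOn_Icc ((hcont' _ _).add ?_)
    exact (hcont' (1, 0) (0, 1)).neg
  · simp only [intervalIntegral.integral_neg]

end ProductCalculus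

section FibreIntegration

open MeasureTheory Set

universe u

variable {E : Type u} [NormedAddCommGroup E] [NormedSpace ℝ E] [FiniteDimensional ℝ E]
  {H : Type*} [TopologicalSpace H] {I : ModelWithCorners ℝ E H} [I.Boundaryless]
  {M : Type*} [TopologicalSpace M] [ChartedSpace H M] [IsManifold I ∞ M]
  {Q : Type*} [NormedAddCommGroup Q] [NormedSpace ℝ Q] [MeasurableSpace Q] [BorelSpace Q]
  [FiniteDimensional ℝ Q] {ν : Measure Q} [IsLocallyFiniteMeasure ν] {K : Set Q} {k : ℕ}

/-- The contraction of a form on `M × Q` with a constant vector field along `Q`. -/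
def Form.contr (w : Q) (Θ : Form (I.prod 𝓘(ℝ, Q)) (M × Q) (k + 1)) :
    Form (I.prod 𝓘(ℝ, Q)) (M × Q) k :=
  fun p => ChernSimons.contr ((0, w) : E × Q) (Θ p)

/-- The restriction of a form on `M × Q` to `M × {q}`. -/
def Form.restrict (q : Q) (Θ : Form (I.prod 𝓘(ℝ, Q)) (M × Q) k) : Form I M k :=
  fun x => restrictL E Q k (Θ (x, q))

/-- The integral of the restrictions to `M × {q}`, for `q` in a set `K`. -/
def Form.fibreInt (ν : Measure Q) (K : Set Q) (Θ : Form (I.prod 𝓘(ℝ, Q)) (M × Q) k) :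
    Form I M k :=
  fun x => (∫ q in K, (restrictL E Q k (Θ (x, q))) ∂ν : E [⋀^Fin k]→L[ℝ] ℂ)

theorem clm_prod_ext {F : Type*} [AddCommGroup F] [Module ℝ F] [TopologicalSpace F]
    {L L' : E × Q →L[ℝ] F} (h1 : ∀ e, L (e, 0) = L' (e, 0)) (h2 : ∀ q, L (0, q) = L' (0, q)) :
    L = L' := by
  refine ContinuousLinearMap.ext fun v => ?_
  have hv : v = (v.1, 0) + (0, v.2) := by simp
  rw [hv, map_add, map_add, h1, h2]

theorem contr_comp_prodMap (η : (E × Q) [⋀^Fin (k + 1)]→L[ℝ] ℂ) (L : E →L[ℝ] E) (w : Q) :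
    ChernSimons.contr ((0, w) : E × Q)
      (η.compContinuousLinearMap (L.prodMap (ContinuousLinearMap.id ℝ Q))) =
      (ChernSimons.contr ((0, w) : E × Q) η).compContinuousLinearMap
        (L.prodMap (ContinuousLinearMap.id ℝ Q)) := by
  ext v
  refine congrArg η (funext fun i => ?_)
  refine Fin.cases ?_ (fun i => ?_) i
  · change (L 0, w) = (0, w)
    rw [map_zero]
  · rfl

theorem restrictL_comp_prodMap (η : (E × Q) [⋀^Fin k]→L[ℝ] ℂ) (L : E →L[ℝ] E) :
    restrictL E Q k (η.compContinuousLinearMap (L.prodMap (ContinuousLinearMap.id ℝ Q))) =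
      (restrictL E Q k η).compContinuousLinearMap L := by
  ext v
  rfl

theorem Form.restrict_eq_pullback (q : Q) (Θ : Form (I.prod 𝓘(ℝ, Q)) (M × Q) k) :
    Form.restrict q Θ = Form.pullback (I := I) (fun x => (x, q)) Θ := by
  funext x
  rw [Form.pullback, mfderiv_prod_left]
  rfl

theorem extChartAt_prod_symm_apply (p₀ : M × Q) (y : E) (q : Q) :
    (extChartAt (I.prod 𝓘(ℝ, Q)) p₀).symm (y, q) = ((extChartAt I p₀.1).symm y, q) := by
  rw [extChartAt_prod]
  rfl

theorem extChartAt_prod_target (p₀ : M × Q) :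
    (extChartAt (I.prod 𝓘(ℝ, Q)) p₀).target = (extChartAt I p₀.1).target ×ˢ univ := by
  rw [extChartAt_prod, PartialEquiv.prod_target, extChartAt_model_space_eq_id]
  rfl

theorem mfderiv_extChartAt_prod_symm {p₀ : M × Q} {y : E} (hy : y ∈ (extChartAt I p₀.1).target)
    (q : Q) :
    (mfderiv 𝓘(ℝ, E × Q) (I.prod 𝓘(ℝ, Q)) (extChartAt (I.prod 𝓘(ℝ, Q)) p₀).symm (y, q) :
      E × Q →L[ℝ] E × Q) =
      (mfderiv 𝓘(ℝ, E) I (extChartAt I p₀.1).symm y : E →L[ℝ] E).prodMap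
        (ContinuousLinearMap.id ℝ Q) := by
  have hmem : (y, q) ∈ (extChartAt (I.prod 𝓘(ℝ, Q)) p₀).target := by
    rw [extChartAt_prod_target]; exact ⟨hy, mem_univ q⟩
  have hd := mdifferentiableAt_extChartAt_symm hmem
  have h1 : ∀ e : E, mfderiv 𝓘(ℝ, E × Q) (I.prod 𝓘(ℝ, Q))
      (extChartAt (I.prod 𝓘(ℝ, Q)) p₀).symm (y, q) ((e, 0) : E × Q) =
      ((mfderiv 𝓘(ℝ, E) I (extChartAt I p₀.1).symm y e, 0) : E × Q) := by
    intro e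
    have hs : HasFDerivAt (fun y : E => (y, q)) (ContinuousLinearMap.inl ℝ E Q) y :=
      hasFDerivAt_prodMk_left y q
    have h2 := mfderiv_comp y (I' := 𝓘(ℝ, E × Q)) (f := fun y : E => (y, q)) hd
      hs.differentiableAt.mdifferentiableAt
    have h3 : (extChartAt (I.prod 𝓘(ℝ, Q)) p₀).symm ∘ (fun y : E => (y, q)) =
        (fun x : M => (x, q)) ∘ (extChartAt I p₀.1).symm := by
      funext y
      exact extChartAt_prod_symm_apply p₀ y q
    have h4 := mfderiv_comp y (I' := I) (I'' := I.prod 𝓘(ℝ, Q)) (g := fun x : M => (x, q))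
      (f := (extChartAt I p₀.1).symm) (mdifferentiableAt_id.prodMk mdifferentiableAt_const)
      (mdifferentiableAt_extChartAt_symm hy)
    rw [h3, h4, mfderiv_prod_left, mfderiv_eq_fderiv, hs.fderiv] at h2
    exact (DFunLike.congr_fun h2 e).symm
  have h1' : ∀ e : Q, mfderiv 𝓘(ℝ, E × Q) (I.prod 𝓘(ℝ, Q))
      (extChartAt (I.prod 𝓘(ℝ, Q)) p₀).symm (y, q) ((0, e) : E × Q) = ((0, e) : E × Q) := by
    intro e
    have hs : HasFDerivAt (fun q : Q => (y, q)) (ContinuousLinearMap.inr ℝ E Q) q :=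
      hasFDerivAt_prodMk_right y q
    have h2 := mfderiv_comp q (I' := 𝓘(ℝ, E × Q)) (f := fun q : Q => (y, q)) hd
      hs.differentiableAt.mdifferentiableAt
    have h3 : (extChartAt (I.prod 𝓘(ℝ, Q)) p₀).symm ∘ (fun q : Q => (y, q)) =
        fun q : Q => ((extChartAt I p₀.1).symm y, q) := by
      funext q
      exact extChartAt_prod_symm_apply p₀ y q
    rw [h3, mfderiv_prod_right, mfderiv_eq_fderiv, hs.fderiv] at h2
    exact (DFunLike.congr_fun h2 e).symm
  refine clm_prod_ext h1 fun e => (h1' e).trans ?_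
  change ((0, e) : E × Q) = ((mfderiv 𝓘(ℝ, E) I (extChartAt I p₀.1).symm y : E →L[ℝ] E) 0, e)
  rw [map_zero]
  rfl

theorem Form.inChart_prod (Θ : Form (I.prod 𝓘(ℝ, Q)) (M × Q) k) {p₀ : M × Q} {y : E}
    (hy : y ∈ (extChartAt I p₀.1).target) (q : Q) :
    Form.inChart Θ p₀ (y, q) =
      (Θ ((extChartAt I p₀.1).symm y, q) : (E × Q) [⋀^Fin k]→L[ℝ] ℂ).compContinuousLinearMap
      ((mfderiv 𝓘(ℝ, E) I (extChartAt I p₀.1).symm y : E →L[ℝ] E).prodMap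
        (ContinuousLinearMap.id ℝ Q)) := by
  rw [Form.inChart_eq]
  ext v
  have h := mfderiv_extChartAt_prod_symm hy q
  refine (Form.apply_congr Θ (extChartAt_prod_symm_apply p₀ y q) _).trans ?_
  refine congrArg (Θ _ : (E × Q) [⋀^Fin k]→L[ℝ] ℂ) (funext fun i => ?_)
  exact DFunLike.congr_fun h (v i)

theorem Form.inChart_contr (w : Q) (Θ : Form (I.prod 𝓘(ℝ, Q)) (M × Q) (k + 1)) {p₀ : M × Q}
    {z : E × Q} (hz : z.1 ∈ (extChartAt I p₀.1).target) :
    Form.inChart (Form.contr w Θ) p₀ z =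
      ChernSimons.contr ((0, w) : E × Q) (Form.inChart Θ p₀ z) := by
  obtain ⟨y, q⟩ := z
  rw [Form.inChart_prod _ hz, Form.inChart_prod _ hz]
  exact (contr_comp_prodMap _ _ _).symm

theorem Form.restrictL_inChart (Θ : Form (I.prod 𝓘(ℝ, Q)) (M × Q) k) {p₀ : M × Q} {y : E}
    (hy : y ∈ (extChartAt I p₀.1).target) (q : Q) :
    restrictL E Q k (Form.inChart Θ p₀ (y, q)) =
      (restrictL E Q k (Θ ((extChartAt I p₀.1).symm y, q))).compContinuousLinearMap
        (mfderiv 𝓘(ℝ, E) I (extChartAt I p₀.1).symm y : E →L[ℝ] E) := by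
  rw [Form.inChart_prod _ hy]
  exact restrictL_comp_prodMap _ _

theorem Form.inChart_self (η : Form I M k) (x : M) :
    Form.inChart η x (extChartAt I x x) = η x := by
  have : IsManifold I 1 M := IsManifold.of_le (n := ∞) (by simp)
  have h2 := mfderivWithin_range_extChartAt_symm (I := I) (x := x)
  ext v
  rw [Form.inChart, h2]
  exact Form.apply_congr η (extChartAt_to_inv x) v

theorem Form.IsSmooth.contDiffOn_prod {Θ : Form (I.prod 𝓘(ℝ, Q)) (M × Q) k} (hΘ : Θ.IsSmooth)
    (p₀ : M × Q) :
    ContDiffOn ℝ ∞ (Form.inChart Θ p₀) ((extChartAt I p₀.1).target ×ˢ univ) := by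
  rw [← extChartAt_prod_target]
  exact hΘ p₀

theorem Form.IsSmooth.contr {Θ : Form (I.prod 𝓘(ℝ, Q)) (M × Q) (k + 1)} (hΘ : Θ.IsSmooth) (w : Q) :
    (Form.contr w Θ).IsSmooth := by
  intro p₀
  rw [extChartAt_prod_target]
  refine ((contrL k ((0, w) : E × Q)).contDiff.comp_contDiffOn (hΘ.contDiffOn_prod p₀)).congr ?_
  exact fun z hz => Form.inChart_contr w Θ hz.1

theorem Form.restrictL_inChart_self (Θ : Form (I.prod 𝓘(ℝ, Q)) (M × Q) k) (x : M) (q₀ q : Q) :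
    restrictL E Q k (Form.inChart Θ (x, q₀) (extChartAt I x x, q)) =
      restrictL E Q k (Θ (x, q)) := by
  rw [Form.restrictL_inChart (p₀ := (x, q₀)) Θ (mem_extChartAt_target x) q]
  have h := Form.inChart_self (Form.restrict q Θ) x
  rw [Form.inChart_eq, extChartAt_to_inv] at h
  refine Eq.trans ?_ h
  change (restrictL E Q k (Θ ((extChartAt I x).symm (extChartAt I x x), q))).compContinuousLinearMap
    _ = _
  rw [extChartAt_to_inv]
  rfl

theorem Form.IsSmooth.continuous_restrictL {Θ : Form (I.prod 𝓘(ℝ, Q)) (M × Q) k}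
    (hΘ : Θ.IsSmooth) (x : M) : Continuous fun q => restrictL E Q k (Θ (x, q)) := by
  simp_rw [← fun q => Form.restrictL_inChart_self (I := I) Θ x 0 q]
  exact (restrictL E Q k).continuous.comp
    (ContDiffOn.continuous_slice (Form.IsSmooth.contDiffOn_prod (I := I) hΘ (x, (0 : Q))) (mem_extChartAt_target (I := I) x))

theorem Form.inChart_fibreInt {Θ : Form (I.prod 𝓘(ℝ, Q)) (M × Q) k} (hΘ : Θ.IsSmooth)
    (hK : IsCompact K) {x₀ : M} {y : E} (hy : y ∈ (extChartAt I x₀).target) :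
    Form.inChart (Form.fibreInt ν K Θ) x₀ y =
      ∫ q in K, restrictL E Q k (Form.inChart Θ (x₀, (0 : Q)) (y, q)) ∂ν := by
  rw [Form.inChart_eq]
  simp_rw [fun q => Form.restrictL_inChart (p₀ := (x₀, (0 : Q))) Θ hy q]
  refine (ContinuousLinearMap.integral_comp_comm (𝕜 := ℝ) (μ := ν.restrict K)
    (E := E [⋀^Fin k]→L[ℝ] ℂ) (Fₗ := E [⋀^Fin k]→L[ℝ] ℂ)
    (φ := fun q => restrictL E Q k (Θ ((extChartAt I x₀).symm y, q)))
    (ContinuousAlternatingMap.compContinuousLinearMapCLM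
      (mfderiv 𝓘(ℝ, E) I (extChartAt I x₀).symm y : E →L[ℝ] E)) ?_).symm
  exact (hΘ.continuous_restrictL _).continuousOn.integrableOn_compact hK

theorem Form.IsSmooth.fibreInt {Θ : Form (I.prod 𝓘(ℝ, Q)) (M × Q) k} (hΘ : Θ.IsSmooth)
    (hK : IsCompact K) : (Form.fibreInt ν K Θ).IsSmooth := by
  intro x₀
  refine (contDiffOn_setIntegral (ν := ν) (isOpen_extChartAt_target x₀) hK
    (f := fun p => restrictL E Q k (Form.inChart Θ (x₀, (0 : Q)) p)) ?_).congr
    fun y hy => Form.inChart_fibreInt hΘ hK hy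
  exact (restrictL E Q k).contDiff.comp_contDiffOn (hΘ.contDiffOn_prod (x₀, (0 : Q)))

/-- Stokes' theorem for the integral of a closed form over the fibres of `M × [a, b] → M`. -/
theorem Form.d_fibreInt_box {Ω : Form (I.prod 𝓘(ℝ, ℝ × ℝ)) (M × (ℝ × ℝ)) (k + 2)}
    (hΩ : Ω.IsSmooth) (hd : Form.d Ω = 0) {a b : ℝ × ℝ} (hab : a ≤ b) (x : M) :
    Form.d (Form.fibreInt volume (Icc a b) (Form.contr (1, 0) (Form.contr (0, 1) Ω))) x =
      (((-∫ t in a.1..b.1, restrictL E (ℝ × ℝ) (k + 1) (Form.contr (1, 0) Ω (x, (t, b.2)))) -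
        (-∫ t in a.1..b.1, restrictL E (ℝ × ℝ) (k + 1) (Form.contr (1, 0) Ω (x, (t, a.2)))) +
        ∫ s in a.2..b.2, restrictL E (ℝ × ℝ) (k + 1) (Form.contr (0, 1) Ω (x, (b.1, s)))) -
        ∫ s in a.2..b.2, restrictL E (ℝ × ℝ) (k + 1) (Form.contr (0, 1) Ω (x, (a.1, s)))) := by
  set p₀ : M × (ℝ × ℝ) := (x, 0)
  have hx := mem_extChartAt_target (I := I) x
  have h1 : Form.inChart (Form.fibreInt volume (Icc a b)
      (Form.contr (1, 0) (Form.contr (0, 1) Ω))) x =ᶠ[nhds (extChartAt I x x)] fun y =>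
      ∫ q in Icc a b, restrictL E (ℝ × ℝ) k (ChernSimons.contr ((0, (1, 0)) : E × (ℝ × ℝ))
        (ChernSimons.contr ((0, (0, 1)) : E × (ℝ × ℝ)) (Form.inChart Ω p₀ (y, q)))) := by
    filter_upwards [(isOpen_extChartAt_target x).mem_nhds hx] with y hy
    rw [Form.inChart_fibreInt ((hΩ.contr _).contr _) isCompact_Icc hy]
    refine integral_congr_ae (Filter.Eventually.of_forall fun q => ?_)
    change restrictL E (ℝ × ℝ) k (Form.inChart _ (x, 0) (y, q)) = _
    rw [Form.inChart_contr (p₀ := (x, 0)) _ _ hy, Form.inChart_contr (p₀ := (x, 0)) _ _ hy]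
  have hd' : ∀ y ∈ (extChartAt I x).target, ∀ q, extDeriv (Form.inChart Ω p₀) (y, q) = 0 := by
    intro y hy q
    rw [← Form.inChart_d hΩ (by rw [extChartAt_prod_target]; exact ⟨hy, mem_univ q⟩), hd]
    rfl
  rw [Form.d_eq, h1.extDeriv_eq,
    extDeriv_box (isOpen_extChartAt_target x) (hΩ.contDiffOn_prod p₀) hd' hab hx]
  have h2 : ∀ w q, restrictL E (ℝ × ℝ) (k + 1) (ChernSimons.contr ((0, w) : E × (ℝ × ℝ))
      (Form.inChart Ω p₀ (extChartAt I x x, q))) =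
      restrictL E (ℝ × ℝ) (k + 1) (Form.contr w Ω (x, q)) := by
    intro w q
    rw [← Form.restrictL_inChart_self _ x 0 q, Form.inChart_contr (p₀ := (x, 0)) _ _ hx]
  simp_rw [h2]
  rfl

end FibreIntegration

/-! ### The transgression form and the Chern–Simons class -/

section Scale

variable {E : Type*} [NormedAddCommGroup E] [NormedSpace ℝ E] [FiniteDimensional ℝ E]
  {H : Type*} [TopologicalSpace H] {I : ModelWithCorners ℝ E H} [I.Boundaryless]
  {M : Type*} [TopologicalSpace M] [ChartedSpace H M] [IsManifold I ∞ M]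
  {E' : Type*} [NormedAddCommGroup E'] [NormedSpace ℝ E'] [FiniteDimensional ℝ E']
  {H' : Type*} [TopologicalSpace H'] {J : ModelWithCorners ℝ E' H'} [J.Boundaryless]
  {N : Type*} [TopologicalSpace N] [ChartedSpace H' N] [IsManifold J ∞ N] {k r : ℕ}

/-- The product of a form with a real function. -/
def Form.scale (f : M → ℝ) (η : Form I M k) : Form I M k := fun x => (f x : ℂ) • η x

theorem Form.IsSmooth.scale {f : M → ℝ} (hf : ContMDiff I 𝓘(ℝ, ℝ) ∞ f) {η : Form I M k}
    (hη : η.IsSmooth) : (Form.scale f η).IsSmooth := by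
  intro x₀ y hy
  have h1 : ContMDiffAt 𝓘(ℝ, E) 𝓘(ℝ, ℝ) ∞ (f ∘ (extChartAt I x₀).symm) y :=
    (hf _).comp y ((contMDiffOn_extChartAt_symm x₀).contMDiffAt
      ((isOpen_extChartAt_target x₀).mem_nhds hy))
  rw [contMDiffAt_iff_contDiffAt] at h1
  exact ((Complex.ofRealCLM.contDiff.contDiffAt.comp y h1).contDiffWithinAt).smul (hη x₀ y hy)

theorem Form.pullback_scale (f : N → ℝ) (η : Form J N k) (g : M → N) :
    Form.pullback (I := I) g (Form.scale f η) = Form.scale (f ∘ g) (Form.pullback g η) := rfl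

theorem Form.scale_eq_self {f : M → ℝ} (hf : ∀ x, f x = 1) (η : Form I M k) :
    Form.scale f η = η := by
  funext x
  rw [Form.scale, hf, Complex.ofReal_one, one_smul]

theorem Form.scale_eq_zero {f : M → ℝ} (hf : ∀ x, f x = 0) (η : Form I M k) :
    Form.scale f η = 0 := by
  funext x
  rw [Form.scale, hf, Complex.ofReal_zero]
  exact zero_smul ℂ (η x : E [⋀^Fin k]→L[ℝ] ℂ)

theorem Form.scale_zero (f : M → ℝ) : Form.scale f (0 : Form I M k) = 0 :=
  funext fun x => smul_zero (A := E [⋀^Fin k]→L[ℝ] ℂ) (f x : ℂ)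

/-- The connection obtained by multiplying the connection form with a real function. -/
def Connection.scale (c : Connection I M r) (f : M → ℝ) (hf : ContMDiff I 𝓘(ℝ, ℝ) ∞ f) :
    Connection I M r :=
  ⟨fun i j => ⟨Form.scale f (c.form i j : Form I M 1), Form.IsSmooth.scale hf (c.form i j).2⟩⟩

theorem Connection.ext_form {c c' : Connection I M r}
    (h : ∀ i j, (c.form i j : Form I M 1) = c'.form i j) : c = c' := by
  cases c
  cases c'
  congr 1
  ext1 i j
  exact Subtype.ext (h i j)

theorem Connection.trivial_ch (k : ℕ) : (Connection.trivial I M r).ch (k + 1) = 0 := by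
  have h1 : (Connection.trivial I M r).curvature = 0 := by
    ext1 i j
    have h2 : ∀ i j, ((Connection.trivial I M r).form i j : Form I M 1) = 0 := fun _ _ => rfl
    have h3 : (0 : Form I M 1).wedge (0 : Form I M 1) = 0 := by
      funext x
      refine ext_injective x ?_
      rw [ext_wedge]
      simp
    rw [Connection.curvature_apply]
    simp only [h2, Form.d_zero, h3]
    simp
  rw [Connection.ch]
  have h2 : ∀ i j, (Connection.trivial I M r).curvaturePow (k + 1) i j = 0 := by
    intro i j
    funext x
    refine ext_injective x ?_
    rw [← extMat_apply, Connection.extMat_curvaturePow, h1]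
    have h3 : extMat I (0 : Matrix (Fin r) (Fin r) (Form I M 2)) x = 0 := by
      ext1 i j
      exact LinearMap.map_zero (ext I x)
    rw [h3, zero_pow (Nat.succ_ne_zero k)]
    exact (LinearMap.map_zero (ext I x)).symm
  simp only [h2, Finset.sum_const_zero, smul_zero]

end Scale

section Transgression

open MeasureTheory Set

universe u

variable {E : Type u} [NormedAddCommGroup E] [NormedSpace ℝ E] [FiniteDimensional ℝ E]
  {H : Type*} [TopologicalSpace H] {I : ModelWithCorners ℝ E H} [I.Boundaryless]
  {M : Type*} [TopologicalSpace M] [ChartedSpace H M] [IsManifold I ∞ M]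
  {E' : Type*} [NormedAddCommGroup E'] [NormedSpace ℝ E'] [FiniteDimensional ℝ E']
  {H' : Type*} [TopologicalSpace H'] {J : ModelWithCorners ℝ E' H'} [J.Boundaryless]
  {N : Type*} [TopologicalSpace N] [ChartedSpace H' N] [IsManifold J ∞ N]
  {Q : Type*} [NormedAddCommGroup Q] [NormedSpace ℝ Q] [FiniteDimensional ℝ Q] {k r : ℕ}

/-- The connection `d + s A` on `M × ℝ`, where `s` is the coordinate of `ℝ`. -/
def Connection.cone (c : Connection I M r) : Connection (I.prod 𝓘(ℝ, ℝ)) (M × ℝ) r :=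
  (c.pullback Prod.fst contMDiff_fst).scale Prod.snd contMDiff_snd

/-- The degree `2k+1` part of the transgression form of a connection. -/
def Connection.transgression (c : Connection I M r) (k : ℕ) : Form I M (2 * k + 1) :=
  Form.fibreInt volume (Icc (0 : ℝ) 1) (Form.contr (k := 2 * k + 1) (1 : ℝ) (c.cone.ch (k + 1)))

theorem Connection.transgression_isSmooth (c : Connection I M r) (k : ℕ) :
    (c.transgression k).IsSmooth :=
  Form.IsSmooth.fibreInt (Form.IsSmooth.contr (k := 2 * k + 1) (c.cone.ch_isSmooth (k + 1)) 1)
    isCompact_Icc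

theorem restrictL_contr_path (Ω : Form (I.prod 𝓘(ℝ, Q)) (M × Q) (k + 1)) {a : ℝ → Q} {w : Q}
    {t : ℝ} (ha : HasDerivAt a w t) (x : M) :
    restrictL E Q k (Form.contr w Ω (x, a t)) =
      restrictL E ℝ k (Form.contr (1 : ℝ) (Form.pullback (I := I.prod 𝓘(ℝ, ℝ))
        (Prod.map id a) Ω) (x, t)) := by
  have h := mfderiv_prodMap (p := (x, t)) (I := I) (I' := 𝓘(ℝ, ℝ)) (J := I) (J' := 𝓘(ℝ, Q))
    (f := (id : M → M)) (g := a) mdifferentiableAt_id ha.differentiableAt.mdifferentiableAt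
  rw [mfderiv_id, mfderiv_eq_fderiv, ha.hasFDerivAt.fderiv] at h
  ext v
  refine congrArg (Ω (x, a t) : (E × Q) [⋀^Fin (k + 1)]→L[ℝ] ℂ) (funext fun i => ?_)
  refine Eq.trans ?_ (DFunLike.congr_fun h _).symm
  refine Fin.cases ?_ (fun i => ?_) i
  · change ((0, w) : E × Q) = (0, (1 : ℝ) • w)
    rw [one_smul]
  · change ((v i, 0) : E × Q) = (v i, (0 : ℝ) • w)
    rw [zero_smul]

theorem contMDiff_incl_uncurry :
    ContMDiff (I.prod 𝓘(ℝ, ℝ)) (I.prod (𝓡 1)) ∞ (fun p : M × ℝ => incl p.2 p.1) :=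
  contMDiff_fst.prodMk (contMDiff_circleExp.comp contMDiff_snd)

theorem contMDiff_incl (θ : ℝ) : ContMDiff I (I.prod (𝓡 1)) ∞ (incl (M := M) θ) :=
  contMDiff_id.prodMk contMDiff_const

theorem apply_snoc {V : Type*} [AddCommGroup V] [Module ℝ V] [TopologicalSpace V]
    (η : V [⋀^Fin (k + 1)]→L[ℝ] ℂ) (v : Fin k → V) (w : V) :
    η (Fin.snoc (α := fun _ => V) v w) = (-1 : ℂ) ^ k * η (Matrix.vecCons w v) := by
  have h : (Fin.snoc (α := fun _ => V) v w) = Matrix.vecCons w v ∘ finRotate (k + 1) :=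
    funext fun i => congrFun (Fin.snoc_eq_cons_rotate v w) i
  have h1 := η.toAlternatingMap.map_perm (Matrix.vecCons w v) (finRotate (k + 1))
  rw [sign_finRotate, Nat.add_sub_cancel] at h1
  rw [h]
  refine h1.trans ?_
  simp [Units.smul_def]

theorem fibreIntegrand_eq (η : Form (I.prod (𝓡 1)) (M × Circle) (2 * k + 2)) (x : M) (θ : ℝ)
    (v : Fin (2 * k + 1) → TangentSpace I x) :
    η (incl θ x) (Fin.snoc (α := fun _ => TangentSpace (I.prod (𝓡 1)) (incl θ x))
      (fun j => mfderiv I (I.prod (𝓡 1)) (incl θ) x (v j)) (dTheta I x θ)) =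
    -(restrictL E ℝ (2 * k + 1) (Form.contr (1 : ℝ) (Form.pullback (I := I.prod 𝓘(ℝ, ℝ))
        (fun p : M × ℝ => incl p.2 p.1) η) (x, θ))) v := by
  rw [apply_snoc, Odd.neg_one_pow ⟨k, rfl⟩, neg_one_mul]
  congr 1
  refine congrArg (η (incl θ x)) (funext fun i => ?_)
  have hd : MDifferentiableAt (I.prod 𝓘(ℝ, ℝ)) (I.prod (𝓡 1)) (fun p : M × ℝ => incl p.2 p.1)
    (x, θ) := (contMDiff_incl_uncurry _).mdifferentiableAt (by simp)
  refine Fin.cases ?_ (fun i => ?_) i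
  · have h := mfderiv_comp θ (I' := I.prod 𝓘(ℝ, ℝ)) (f := fun t : ℝ => (x, t)) hd
      (mdifferentiableAt_const.prodMk mdifferentiableAt_id)
    rw [mfderiv_prod_right] at h
    exact DFunLike.congr_fun h (1 : ℝ)
  · have h := mfderiv_comp x (I' := I.prod 𝓘(ℝ, ℝ)) (f := fun x : M => (x, θ)) hd
      (mdifferentiableAt_id.prodMk mdifferentiableAt_const)
    rw [mfderiv_prod_left] at h
    exact DFunLike.congr_fun h (v i)

/-- The transgression form as an odd form. -/
def Connection.transgressionOdd (c : Connection I M r) : OddForm I M :=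
  fun k => ⟨c.transgression k, c.transgression_isSmooth k⟩

theorem contMDiff_fst_path {a : ℝ → Q} (ha : ContDiff ℝ ∞ a) :
    ContMDiff (I.prod 𝓘(ℝ, ℝ)) (I.prod 𝓘(ℝ, Q)) ∞ (Prod.map (id : M → M) a) :=
  contMDiff_id.prodMap ha.contMDiff

theorem restrictL_contr_ch_path (c : Connection (I.prod 𝓘(ℝ, Q)) (M × Q) r)
    (c' : Connection (I.prod 𝓘(ℝ, ℝ)) (M × ℝ) r) {a : ℝ → Q} {w : Q} (ha : ContDiff ℝ ∞ a)
    (ha' : ∀ t, HasDerivAt a w t)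
    (h : ∀ i j, (c'.form i j : Form (I.prod 𝓘(ℝ, ℝ)) (M × ℝ) 1) =
      Form.pullback (Prod.map id a) (c.form i j : Form (I.prod 𝓘(ℝ, Q)) (M × Q) 1)) (k : ℕ)
    (x : M) (t : ℝ) :
    restrictL E Q (2 * k + 1) (Form.contr (k := 2 * k + 1) w (c.ch (k + 1)) (x, a t)) =
      restrictL E ℝ (2 * k + 1) (Form.contr (k := 2 * k + 1) (1 : ℝ) (c'.ch (k + 1)) (x, t)) := by
  have h1 : c' = c.pullback (Prod.map id a) (contMDiff_fst_path ha) := Connection.ext_form h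
  rw [h1, Connection.ch_pullback]
  exact restrictL_contr_path (k := 2 * k + 1) (c.ch (k + 1)) (ha' t) x

/-- The pullback of a connection on `M × S¹` to `M × ℝ`. -/
def unwind (c' : Connection (I.prod (𝓡 1)) (M × Circle) r) :
    Connection (I.prod 𝓘(ℝ, ℝ)) (M × ℝ) r :=
  c'.pullback (fun p => incl p.2 p.1) contMDiff_incl_uncurry

/-- The connection `d + s A` on `M × ℝ²` attached to a connection `d + A` on `M × ℝ`, where
`s` is the second coordinate of `ℝ²`. -/
def doubleCone (c : Connection (I.prod 𝓘(ℝ, ℝ)) (M × ℝ) r) :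
    Connection (I.prod 𝓘(ℝ, ℝ × ℝ)) (M × (ℝ × ℝ)) r :=
  (c.pullback (Prod.map id Prod.fst) (contMDiff_id.prodMap contDiff_fst.contMDiff)).scale
    (fun p => p.2.2) (contDiff_snd.contMDiff.comp contMDiff_snd)

theorem pullback_doubleCone (c : Connection (I.prod 𝓘(ℝ, ℝ)) (M × ℝ) r) {a : ℝ → ℝ × ℝ}
    (ha : ContDiff ℝ ∞ a) (i j : Fin r) :
    Form.pullback (I := I.prod 𝓘(ℝ, ℝ)) (Prod.map id a)
      ((doubleCone c).form i j : Form (I.prod 𝓘(ℝ, ℝ × ℝ)) (M × (ℝ × ℝ)) 1) =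
    Form.scale (fun p => (a p.2).2) (Form.pullback (Prod.map id fun t => (a t).1)
      (c.form i j : Form (I.prod 𝓘(ℝ, ℝ)) (M × ℝ) 1)) := by
  change Form.pullback _ (Form.scale _ (Form.pullback _ (c.form i j).1)) = _
  rw [Form.pullback_scale, Form.pullback_pullback (contMDiff_fst_path ha)
    (contMDiff_id.prodMap contDiff_fst.contMDiff)]
  rfl

theorem Form.pullback_incl_fst (c' : Form (I.prod (𝓡 1)) (M × Circle) k) (θ : ℝ) :
    Form.pullback (I := I.prod 𝓘(ℝ, ℝ)) (Prod.map (id : M → M) fun _ : ℝ => θ)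
      (Form.pullback (I := I.prod 𝓘(ℝ, ℝ)) (fun p : M × ℝ => incl p.2 p.1) c') =
    Form.pullback (I := I.prod 𝓘(ℝ, ℝ)) (Prod.fst : M × ℝ → M)
      (Form.pullback (I := I) (incl θ) c') := by
  rw [Form.pullback_pullback (contMDiff_fst_path contDiff_const) contMDiff_incl_uncurry,
    Form.pullback_pullback contMDiff_fst (contMDiff_incl θ)]
  rfl

theorem incl_two_pi : (incl (2 * Real.pi) : M → M × Circle) = incl 0 := by
  funext x
  rw [incl, incl, Circle.exp_two_pi, Circle.exp_zero]

/-- The fibre integral over the rectangle `[π, 2π] × [0, 1]` whose differential is the difference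
of the Chern–Simons form and the transgression form. -/
def rectangleForm (c' : Connection (I.prod (𝓡 1)) (M × Circle) r) (k : ℕ) : Form I M (2 * k) :=
  Form.fibreInt volume (Icc ((Real.pi, 0) : ℝ × ℝ) (2 * Real.pi, 1))
    (Form.contr (1, 0) (Form.contr (k := 2 * k + 1) (0, 1) ((doubleCone (unwind c')).ch (k + 1))))

theorem rectangleForm_isSmooth (c' : Connection (I.prod (𝓡 1)) (M × Circle) r) (k : ℕ) :
    (rectangleForm c' k).IsSmooth :=
  Form.IsSmooth.fibreInt ((Form.IsSmooth.contr (k := 2 * k + 1)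
    ((doubleCone (unwind c')).ch_isSmooth (k + 1)) _).contr _) isCompact_Icc

theorem Connection.transgression_apply (c : Connection I M r) (k : ℕ) (x : M) :
    c.transgression k x = ∫ s in (0 : ℝ)..1, restrictL E ℝ (2 * k + 1)
      (Form.contr (k := 2 * k + 1) (1 : ℝ) (c.cone.ch (k + 1)) (x, s)) := by
  rw [intervalIntegral.integral_of_le zero_le_one, ← integral_Icc_eq_integral_Ioc]
  rfl

theorem d_rectangleForm {c' : Connection (I.prod (𝓡 1)) (M × Circle) r} {c : Connection I M r}
    (h : Interpolates c' c (Connection.trivial I M r)) (k : ℕ) (x : M) :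
    (Form.d (rectangleForm c' k) + c.transgression k) x =
      (-∫ t in Real.pi..2 * Real.pi, restrictL E ℝ (2 * k + 1)
        (Form.contr (k := 2 * k + 1) (1 : ℝ) ((unwind c').ch (k + 1)) (x, t))) := by
  have hbox := Form.d_fibreInt_box (k := 2 * k) (Ω := (doubleCone (unwind c')).ch (k + 1))
    ((doubleCone (unwind c')).ch_isSmooth (k + 1)) ((doubleCone (unwind c')).d_ch (k + 1))
    (a := (Real.pi, 0)) (b := (2 * Real.pi, 1))
    ⟨by change Real.pi ≤ 2 * Real.pi; linarith [Real.pi_pos], zero_le_one⟩ x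
  have e1 := fun t => restrictL_contr_ch_path (doubleCone (unwind c')) (unwind c')
    (a := fun t => (t, 1)) (w := (1, 0)) (by fun_prop)
    (fun t => (hasDerivAt_id t).prodMk (hasDerivAt_const t 1))
    (fun i j => by
      rw [pullback_doubleCone _ (by fun_prop)]
      rw [Form.scale_eq_self fun p => rfl]
      exact (Form.pullback_id _).symm) k x t
  have e2 := fun t => restrictL_contr_ch_path (doubleCone (unwind c'))
    (Connection.trivial (I.prod 𝓘(ℝ, ℝ)) (M × ℝ) r)
    (a := fun t => (t, 0)) (w := (1, 0)) (by fun_prop)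
    (fun t => (hasDerivAt_id t).prodMk (hasDerivAt_const t 0))
    (fun i j => by
      rw [pullback_doubleCone _ (by fun_prop)]
      rw [Form.scale_eq_zero fun p => rfl]
      rfl) k x t
  have e3 := fun t => restrictL_contr_ch_path (doubleCone (unwind c'))
    (Connection.trivial (I.prod 𝓘(ℝ, ℝ)) (M × ℝ) r)
    (a := fun s => (2 * Real.pi, s)) (w := (0, 1)) (by fun_prop)
    (fun t => (hasDerivAt_const t _).prodMk (hasDerivAt_id t))
    (fun i j => by
      rw [pullback_doubleCone _ (by fun_prop)]
      change _ = Form.scale _ (Form.pullback (I := I.prod 𝓘(ℝ, ℝ)) _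
        (Form.pullback (I := I.prod 𝓘(ℝ, ℝ)) _ _))
      rw [Form.pullback_incl_fst, incl_two_pi, (h i j).1]
      exact (Form.scale_zero _).symm) k x t
  have e4 := fun t => restrictL_contr_ch_path (doubleCone (unwind c')) c.cone
    (a := fun s => (Real.pi, s)) (w := (0, 1)) (by fun_prop)
    (fun t => (hasDerivAt_const t _).prodMk (hasDerivAt_id t))
    (fun i j => by
      rw [pullback_doubleCone _ (by fun_prop)]
      change _ = Form.scale _ (Form.pullback (I := I.prod 𝓘(ℝ, ℝ)) _
        (Form.pullback (I := I.prod 𝓘(ℝ, ℝ)) _ _))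
      rw [Form.pullback_incl_fst, (h i j).2]
      rfl) k x t
  simp only [e1, e2, e3, e4, Connection.trivial_ch] at hbox
  refine (congrArg₂ (fun a b : E [⋀^Fin (2 * k + 1)]→L[ℝ] ℂ => a + b) hbox
    (c.transgression_apply k x)).trans ?_
  have hz : ∀ t : ℝ, restrictL E ℝ (2 * k + 1) (Form.contr (k := 2 * k + 1) (1 : ℝ)
      (0 : Form (I.prod 𝓘(ℝ, ℝ)) (M × ℝ) (2 * k + 2)) (x, t)) = 0 := fun t => rfl
  simp only [hz, intervalIntegral.integral_zero, neg_zero, sub_zero, add_zero, sub_add_cancel]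

theorem fibreIntegral_step {c' : Connection (I.prod (𝓡 1)) (M × Circle) r} {c : Connection I M r}
    (h : Interpolates c' c (Connection.trivial I M r)) (k : ℕ) (x : M)
    (v : Fin (2 * k + 1) → TangentSpace I x) :
    fibreIntegral (k := 2 * k + 1) step (c'.ch (k + 1)) x v =
      (Form.d (rectangleForm c' k) + c.transgression k) x v := by
  have hπ := Real.pi_pos
  set R : ℝ → E [⋀^Fin (2 * k + 1)]→L[ℝ] ℂ := fun t => restrictL E ℝ (2 * k + 1)
    (Form.contr (k := 2 * k + 1) (1 : ℝ) ((unwind c').ch (k + 1)) (x, t)) with hR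
  have hRc : Continuous R := (Form.IsSmooth.contr (k := 2 * k + 1)
    ((unwind c').ch_isSmooth (k + 1)) (1 : ℝ)).continuous_restrictL x
  have h1 : (Form.d (rectangleForm c' k) + c.transgression k) x v =
      -∫ t in Real.pi..2 * Real.pi, R t v := by
    rw [d_rectangleForm h]
    refine congrArg Neg.neg ?_
    exact ((ContinuousAlternatingMap.apply ℝ E ℂ v).intervalIntegral_comp_comm
      (hRc.intervalIntegrable _ _)).symm
  have h2 : ∀ θ, (c'.ch (k + 1)) (incl θ x)
      (Fin.snoc (α := fun _ => TangentSpace (I.prod (𝓡 1)) (incl θ x))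
      (fun j => mfderiv I (I.prod (𝓡 1)) (incl θ) x (v j)) (dTheta I x θ)) = -(R θ v) := by
    intro θ
    rw [hR, unwind, Connection.ch_pullback]
    exact fibreIntegrand_eq (c'.ch (k + 1)) x θ v
  rw [h1]
  refine (intervalIntegral.integral_congr fun θ _ => congrArg _ (h2 θ)).trans ?_
  have hfc : Continuous fun t => R t v :=
    (ContinuousAlternatingMap.apply ℝ E ℂ v).continuous.comp hRc
  rw [← intervalIntegral.integral_neg, intervalIntegral.integral_of_le (by linarith),
    intervalIntegral.integral_of_le (by linarith)]
  have h3 : (fun θ => (step θ : ℂ) * -(R θ v)) =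
      (Ici Real.pi).indicator fun θ => -(R θ v) := by
    funext θ
    by_cases hθ : θ < Real.pi
    · rw [indicator_of_notMem (by simpa using hθ), step, if_pos hθ]
      simp
    · rw [indicator_of_mem (by simpa using hθ), step, if_neg hθ]
      simp
  have h4 : Ioc 0 (2 * Real.pi) ∩ Ici Real.pi = Icc Real.pi (2 * Real.pi) := by
    ext θ
    simp only [mem_inter_iff, mem_Ioc, mem_Ici, mem_Icc]
    constructor
    · rintro ⟨⟨_, h2⟩, h3⟩
      exact ⟨h3, h2⟩
    · rintro ⟨h1, h2⟩
      exact ⟨⟨by linarith, h2⟩, h1⟩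
  rw [h3, setIntegral_indicator measurableSet_Ici, h4, integral_Icc_eq_integral_Ioc]

theorem exists_interpolates (c : Connection I M r) :
    ∃ c', Interpolates c' c (Connection.trivial I M r) := by
  have : Fact (Module.finrank ℝ ℂ = 1 + 1) := ⟨Complex.finrank_real_complex⟩
  have hf : ContMDiff (I.prod (𝓡 1)) 𝓘(ℝ, ℝ) ∞
      (fun p : M × Circle => (1 - (p.2 : ℂ).re) / 2) := by
    have h1 : ContMDiff (𝓡 1) 𝓘(ℝ, ℂ) ∞ (fun z : Circle => (z : ℂ)) := contMDiff_coe_sphere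
    have h2 : ContDiff ℝ ∞ fun z : ℂ => (1 - z.re) / 2 :=
      (contDiff_const.sub Complex.reCLM.contDiff).div_const 2
    exact h2.contMDiff.comp (h1.comp contMDiff_snd)
  refine ⟨(c.pullback Prod.fst contMDiff_fst).scale _ hf, fun i j => ?_⟩
  have key : ∀ θ : ℝ, Form.pullback (I := I) (incl θ)
      (((c.pullback Prod.fst contMDiff_fst).scale _ hf).form i j :
        Form (I.prod (𝓡 1)) (M × Circle) 1) =
      Form.scale (fun _ => (1 - (Circle.exp θ : ℂ).re) / 2) (c.form i j : Form I M 1) := by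
    intro θ
    change Form.pullback _ (Form.scale _ (Form.pullback _ (c.form i j).1)) = _
    rw [Form.pullback_scale, Form.pullback_pullback (contMDiff_incl θ) contMDiff_fst]
    congr 1
    exact Form.pullback_id _
  rw [key, key]
  constructor
  · exact Form.scale_eq_zero (by simp) _
  · exact Form.scale_eq_self (by simp) _

theorem isChernSimonsClass_transgression (c : Connection I M r) :
    IsChernSimonsClass c (Connection.trivial I M r)
      ((exactOdd I M).mkQ c.transgressionOdd) := by
  refine ⟨exists_interpolates c, fun c' h => ?_⟩
  refine ⟨fun k => ⟨Form.d (rectangleForm c' k) + c.transgression k,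
    (SmoothForm I M _).add_mem (Form.IsSmooth.d (rectangleForm_isSmooth c' k))
      (c.transgression_isSmooth k)⟩, fun k x v => (fibreIntegral_step h k x v).symm, ?_⟩
  refine (Submodule.Quotient.eq _).2 ⟨fun k => ⟨rectangleForm c' k, rectangleForm_isSmooth c' k⟩,
    fun k => ?_⟩
  exact add_sub_cancel_right (Form.d (rectangleForm c' k)) (c.transgression k)

end Transgression

/-! ### The transgression form in the exterior algebra -/

section ExtPullback

open ExteriorAlgebra

variable {V V' : Type*} [AddCommGroup V] [Module ℝ V] [TopologicalSpace V] [AddCommGroup V']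
  [Module ℝ V'] [TopologicalSpace V'] {ι ι' : Type*} [DecidableEq ι] [DecidableEq ι'] [Fintype ι]
  [Fintype ι'] {k : ℕ}

/-- The homomorphism of exterior algebras induced by a linear map `V → V'`. -/
def extPullback (b' : Module.Basis ι' ℝ V') (b : Module.Basis ι ℝ V) (L : V →L[ℝ] V') :
    CoordExt ι' →ₐ[ℂ] CoordExt ι :=
  ExteriorAlgebra.map (LinearMap.pi fun i => pairing b' (L (b i)))

theorem extPullback_toExt (b' : Module.Basis ι' ℝ V') (b : Module.Basis ι ℝ V) (L : V →L[ℝ] V')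
    (η : V' [⋀^Fin k]→L[ℝ] ℂ) :
    extPullback b' b L (toExt b' η) = toExt b (η.compContinuousLinearMap L) := by
  have h : ∀ g : Fin k → ι', extPullback b' b L (genMulti g) =
      ∑ h : Fin k → ι, (∏ j, ((b'.repr (L (b (h j))) (g j) : ℝ) : ℂ)) • genMulti h := by
    intro g
    rw [extPullback, genMulti, ExteriorAlgebra.map_apply_ιMulti]
    have h1 : (LinearMap.pi fun i => pairing b' (L (b i))) ∘ (fun j => Pi.single (g j) (1 : ℂ)) =
        fun j => ∑ i, ((b'.repr (L (b i)) (g j) : ℝ) : ℂ) • (Pi.single i 1 : ι → ℂ) := by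
      funext j i
      simp [pairing_single, Pi.single_apply]
    rw [h1]
    refine ((ιMulti ℂ k (M := ι → ℂ)).toMultilinearMap.map_sum _).trans ?_
    exact Finset.sum_congr rfl fun h _ => (ιMulti ℂ k (M := ι → ℂ)).toMultilinearMap.map_smul_univ _ _
  rw [toExt_apply, toExt_apply, map_smul, map_sum]
  simp_rw [map_smul, h, Finset.smul_sum, smul_smul]
  rw [Finset.sum_comm]
  refine Finset.sum_congr rfl fun h _ => ?_
  rw [← Finset.sum_smul]
  congr 1
  rw [ContinuousAlternatingMap.compContinuousLinearMap_apply, alt_basis_expand b' η, Finset.mul_sum]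
  refine Finset.sum_congr rfl fun g _ => ?_
  simp only [Function.comp_apply]
  ring

end ExtPullback

section Derivation

variable {R : Type*} [Ring R] {r : ℕ}

theorem trace_derivation_pow (D : R →+ R) {F : Matrix (Fin r) (Fin r) R}
    (hc : ∀ n i j y, Commute ((F ^ n) i j) y)
    (hD : ∀ n i j y, D ((F ^ n) i j * y) = D ((F ^ n) i j) * y + (F ^ n) i j * D y) (n m : ℕ) :
    ((F ^ (n + 1)).map D * F ^ m).trace = (n + 1) • (F.map D * F ^ (n + m)).trace := by
  induction n generalizing m with
  | zero => simp
  | succ n ih =>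
    have h1 : (F ^ (n + 2)).map D = (F ^ (n + 1)).map D * F + F ^ (n + 1) * F.map D := by
      ext i j
      rw [pow_succ F (n + 1), Matrix.map_apply, Matrix.mul_apply, map_sum, Matrix.add_apply,
        Matrix.mul_apply, Matrix.mul_apply, ← Finset.sum_add_distrib]
      exact Finset.sum_congr rfl fun l _ => hD (n + 1) i l _
    rw [h1, add_mul, Matrix.trace_add, mul_assoc, ← pow_succ', ih (m + 1), mul_assoc,
      trace_mul_comm_of_commute (hc (n + 1)), mul_assoc, ← pow_add,
      show m + (n + 1) = n + 1 + m by omega, show n + (m + 1) = n + 1 + m by omega,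
      succ_nsmul _ (n + 1)]

end Derivation

section TransgressionFormula

open MeasureTheory Set CliffordAlgebra

universe u

variable {E : Type u} [NormedAddCommGroup E] [NormedSpace ℝ E] [FiniteDimensional ℝ E]
  {H : Type*} [TopologicalSpace H] {I : ModelWithCorners ℝ E H} [I.Boundaryless]
  {M : Type*} [TopologicalSpace M] [ChartedSpace H M] [IsManifold I ∞ M] {k r : ℕ}

/-- The integrand of the transgression form. -/
def Connection.integrand (c : Connection I M r) (k : ℕ) (x : M) (s : ℝ) :
    E [⋀^Fin (2 * k + 1)]→L[ℝ] ℂ :=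
  restrictL E ℝ (2 * k + 1) (Form.contr (k := 2 * k + 1) (1 : ℝ) (c.cone.ch (k + 1)) (x, s))

theorem Connection.integrand_continuous (c : Connection I M r) (k : ℕ) (x : M) :
    Continuous (c.integrand k x) :=
  (Form.IsSmooth.contr (k := 2 * k + 1) (c.cone.ch_isSmooth (k + 1)) (1 : ℝ)).continuous_restrictL x

theorem Connection.transgression_eq (c : Connection I M r) (k : ℕ) (x : M) :
    c.transgression k x = ∫ s in (0 : ℝ)..1, c.integrand k x s := c.transgression_apply k x

theorem contr_pullback_fst (α : Form I M 1) (p : M × ℝ) :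
    Form.contr (k := 0) (1 : ℝ) (Form.pullback (I := I.prod 𝓘(ℝ, ℝ)) Prod.fst α) p = 0 := by
  have h : (Form.pullback (I := I.prod 𝓘(ℝ, ℝ)) Prod.fst α p) =
      (α p.1 : E [⋀^Fin 1]→L[ℝ] ℂ).compContinuousLinearMap (ContinuousLinearMap.fst ℝ E ℝ) := by
    rw [Form.pullback, mfderiv_fst]
    rfl
  rw [Form.contr, h]
  ext v
  exact (α p.1 : E [⋀^Fin 1]→L[ℝ] ℂ).map_coord_zero 0 rfl

theorem contr_cone_form (c : Connection I M r) (i j : Fin r) :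
    Form.contr (k := 0) (1 : ℝ) (c.cone.form i j : Form (I.prod 𝓘(ℝ, ℝ)) (M × ℝ) 1) = 0 := by
  funext p
  have h : Form.contr (k := 0) (1 : ℝ) (c.cone.form i j : Form (I.prod 𝓘(ℝ, ℝ)) (M × ℝ) 1) p =
    (p.2 : ℂ) • (Form.contr (k := 0) (1 : ℝ) (Form.pullback (I := I.prod 𝓘(ℝ, ℝ)) Prod.fst
      (c.form i j : Form I M 1)) p : (E × ℝ) [⋀^Fin 0]→L[ℝ] ℂ) := rfl
  rw [h, contr_pullback_fst]
  exact smul_zero (A := (E × ℝ) [⋀^Fin 0]→L[ℝ] ℂ) (p.2 : ℂ)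

theorem inChart_cone_form (c : Connection I M r) (i j : Fin r) {p₀ : M × ℝ} {y : E}
    (hy : y ∈ (extChartAt I p₀.1).target) :
    ∃ β : (E × ℝ) [⋀^Fin 1]→L[ℝ] ℂ, ∀ t : ℝ,
      Form.inChart (c.cone.form i j : Form (I.prod 𝓘(ℝ, ℝ)) (M × ℝ) 1) p₀ (y, t) = (t : ℂ) • β ∧
      Form.inChart (Form.pullback (I := I.prod 𝓘(ℝ, ℝ)) Prod.fst (c.form i j : Form I M 1)) p₀
        (y, t) = β := by
  refine ⟨((c.form i j : Form I M 1) ((extChartAt I p₀.1).symm y) :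
    E [⋀^Fin 1]→L[ℝ] ℂ).compContinuousLinearMap ((ContinuousLinearMap.fst ℝ E ℝ).comp
      ((mfderiv 𝓘(ℝ, E) I (extChartAt I p₀.1).symm y : E →L[ℝ] E).prodMap
        (ContinuousLinearMap.id ℝ ℝ))), fun t => ?_⟩
  have h : Form.inChart (Form.pullback (I := I.prod 𝓘(ℝ, ℝ)) Prod.fst (c.form i j : Form I M 1)) p₀
      (y, t) = ((c.form i j : Form I M 1) ((extChartAt I p₀.1).symm y) :
    E [⋀^Fin 1]→L[ℝ] ℂ).compContinuousLinearMap ((ContinuousLinearMap.fst ℝ E ℝ).comp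
      ((mfderiv 𝓘(ℝ, E) I (extChartAt I p₀.1).symm y : E →L[ℝ] E).prodMap
        (ContinuousLinearMap.id ℝ ℝ))) := by
    rw [Form.inChart_prod _ hy, Form.pullback, mfderiv_fst]
    rfl
  refine ⟨?_, h⟩
  refine Eq.trans ?_ (congrArg (fun ξ => (t : ℂ) • ξ) h)
  rw [Form.inChart_prod _ hy, Form.inChart_prod _ hy]
  rfl

theorem contr_d_cone_form (c : Connection I M r) (i j : Fin r) (p : M × ℝ) :
    Form.contr (k := 1) (1 : ℝ)
      (Form.d (c.cone.form i j : Form (I.prod 𝓘(ℝ, ℝ)) (M × ℝ) 1)) p =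
    Form.pullback (I := I.prod 𝓘(ℝ, ℝ)) Prod.fst (c.form i j : Form I M 1) p := by
  obtain ⟨x, s⟩ := p
  set η : Form (I.prod 𝓘(ℝ, ℝ)) (M × ℝ) 1 := (c.cone.form i j).1 with hη
  have hsm : η.IsSmooth := (c.cone.form i j).2
  have hx := mem_extChartAt_target (I := I) x
  have hpt : extChartAt (I.prod 𝓘(ℝ, ℝ)) (x, s) (x, s) = (extChartAt I x x, s) := by
    rw [extChartAt_prod]; rfl
  have hz : (extChartAt I x x, s) ∈ (extChartAt (I.prod 𝓘(ℝ, ℝ)) (x, s)).target := by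
    rw [extChartAt_prod_target]; exact ⟨hx, mem_univ s⟩
  have hdiff := (hsm.contDiffAt hz).differentiableAt (by simp)
  have h1 : (fun z => ChernSimons.contr ((0, 1) : E × ℝ) (Form.inChart η (x, s) z)) =ᶠ[nhds
      (extChartAt I x x, s)] fun _ => 0 := by
    filter_upwards [(isOpen_extChartAt_target (I := I.prod 𝓘(ℝ, ℝ)) (x, s)).mem_nhds hz] with z hz
    rw [extChartAt_prod_target] at hz
    rw [← Form.inChart_contr (p₀ := (x, s)) _ _ hz.1, hη, contr_cone_form]
    rfl
  have h2 : extDeriv (fun _ : E × ℝ => (0 : (E × ℝ) [⋀^Fin 0]→L[ℝ] ℂ)) (extChartAt I x x, s) = 0 := by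
    rw [extDeriv, fderiv_fun_const]
    ext v
    simp [ContinuousAlternatingMap.alternatizeUncurryFin_apply]
  obtain ⟨β, hβ⟩ := inChart_cone_form c i j (p₀ := (x, s)) hx
  have h3 : fderiv ℝ (Form.inChart η (x, s)) (extChartAt I x x, s) (0, 1) = β := by
    have h4 : HasDerivAt (fun t : ℝ => (extChartAt I x x, t)) ((0, 1) : E × ℝ) s :=
      (hasDerivAt_const s _).prodMk (hasDerivAt_id s)
    have h5 := hdiff.hasFDerivAt.comp_hasDerivAt s h4
    have h6 : Form.inChart η (x, s) ∘ (fun t : ℝ => (extChartAt I x x, t)) = fun t => t • β :=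
      funext fun t => (hβ t).1.trans (Complex.coe_smul t β)
    rw [h6] at h5
    have h7 : HasDerivAt (fun t : ℝ => t • β) ((1 : ℝ) • β) s := (hasDerivAt_id s).smul_const β
    rw [h5.unique h7, one_smul]
  have h8 := contr_extDeriv hdiff ((0, 1) : E × ℝ)
  rw [h1.extDeriv_eq, h2, sub_zero, h3, ← (hβ s).2, ← hpt, Form.inChart_self] at h8
  refine Eq.trans ?_ h8
  rw [Form.contr, Form.d_eq]
  rfl

theorem ext_contr (w : ℝ) (Θ : Form (I.prod 𝓘(ℝ, ℝ)) (M × ℝ) (k + 1)) (p : M × ℝ) :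
    ext (I.prod 𝓘(ℝ, ℝ)) p (Form.contr w Θ p) =
      contractLeft (Q := 0) (pairing (Module.finBasis ℝ (E × ℝ)) ((0, w) : E × ℝ))
        (ext (I.prod 𝓘(ℝ, ℝ)) p (Θ p)) := toExt_contr _ _ _

theorem contr_cone_curvature (c : Connection I M r) (i j : Fin r) (p : M × ℝ) :
    Form.contr (k := 1) (1 : ℝ) (c.cone.curvature i j) p =
    Form.pullback (I := I.prod 𝓘(ℝ, ℝ)) Prod.fst (c.form i j : Form I M 1) p := by
  refine ext_injective p ?_
  have h0 : ∀ i j, contractLeft (Q := 0) (pairing (Module.finBasis ℝ (E × ℝ)) ((0, 1) : E × ℝ))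
      (ext (I.prod 𝓘(ℝ, ℝ)) p
        ((c.cone.form i j : Form (I.prod 𝓘(ℝ, ℝ)) (M × ℝ) 1) p)) = 0 := by
    intro i j
    rw [← ext_contr, contr_cone_form]
    exact LinearMap.map_zero (ext (I.prod 𝓘(ℝ, ℝ)) p)
  rw [← contr_d_cone_form, ext_contr, ext_contr, Connection.curvature_apply, Pi.add_apply, map_add,
    ext_sum, map_add, map_sum, add_eq_left]
  refine Finset.sum_eq_zero fun l _ => ?_
  rw [ext_wedge]
  refine (contractLeft_toExt_mul _ _ _ _).trans ?_
  have h1 := h0 i l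
  have h2 := h0 l j
  rw [ext] at h1 h2
  rw [h1, ext, h2, zero_mul, mul_zero, smul_zero, add_zero]

theorem restrictL_cone_curvature (c : Connection I M r) (i j : Fin r) (x : M) (s : ℝ) :
    ext I x (restrictL E ℝ 2 (c.cone.curvature i j (x, s))) =
      ((s : ℂ) • extMat I c.dForm x +
        (s ^ 2 : ℂ) • (extMat I c.formMat x * extMat I c.formMat x)) i j := by
  have hsl : ContMDiff I (I.prod 𝓘(ℝ, ℝ)) ∞ (fun x : M => (x, s)) :=
    contMDiff_id.prodMk contMDiff_const
  have h1 : c.cone.pullback _ hsl = c.scale (fun _ => s) contMDiff_const := by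
    refine Connection.ext_form fun i j => ?_
    change Form.pullback _ (Form.scale _ (Form.pullback _ (c.form i j).1)) = _
    rw [Form.pullback_scale, Form.pullback_pullback hsl contMDiff_fst]
    refine congrArg _ ?_
    exact Form.pullback_id _
  have h2 : restrictL E ℝ 2 (c.cone.curvature i j (x, s)) =
      (c.cone.pullback _ hsl).curvature i j x := by
    rw [Connection.curvature_pullback, ← Form.restrict_eq_pullback]
    rfl
  rw [h2, h1]
  have h3 := congrFun (congrFun
    ((c.scale (fun _ => s) contMDiff_const).extMat_curvature x) i) j
  refine h3.trans ?_
  have h4 : extMat I (c.scale (fun _ => s) contMDiff_const).formMat x =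
      (s : ℂ) • extMat I c.formMat x := by
    ext i j
    have h6 : (c.scale (fun _ => s) contMDiff_const).formMat i j =
      (s : ℂ) • (c.form i j : Form I M 1) := rfl
    rw [extMat_apply, h6, Pi.smul_apply, map_smul]
    rfl
  have h5 : extMat I (c.scale (fun _ => s) contMDiff_const).dForm x =
      (s : ℂ) • extMat I c.dForm x := by
    ext i j
    have h6 : (c.scale (fun _ => s) contMDiff_const).dForm i j =
      (s : ℂ) • Form.d (c.form i j : Form I M 1) := Form.d_smul (s : ℂ) (c.form i j).2
    rw [extMat_apply, h6, Pi.smul_apply, map_smul]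
    rfl
  rw [h4, h5, smul_mul_smul_comm, pow_two]

theorem extPullback_ext (x : M) (s : ℝ) (η : TangentSpace (I.prod 𝓘(ℝ, ℝ)) (x, s) [⋀^Fin k]→L[ℝ] ℂ) :
    extPullback (Module.finBasis ℝ (E × ℝ)) (Module.finBasis ℝ E) (ContinuousLinearMap.inl ℝ E ℝ)
      (ext (I.prod 𝓘(ℝ, ℝ)) (x, s) η) = ext I x (restrictL E ℝ k η) :=
  extPullback_toExt _ _ _ _

theorem Connection.ext_integrand (c : Connection I M r) (k : ℕ) (x : M) (s : ℝ) :
    ext I x (c.integrand k x s) =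
      (((k + 1).factorial : ℂ)⁻¹ * (Complex.I / (2 * Real.pi)) ^ (k + 1) * (k + 1)) •
      (extMat I c.formMat x * ((s : ℂ) • extMat I c.dForm x +
        (s ^ 2 : ℂ) • (extMat I c.formMat x * extMat I c.formMat x)) ^ k).trace := by
  set J := I.prod 𝓘(ℝ, ℝ)
  set F := extMat J c.cone.curvature (x, s) with hF
  set D := contractLeft (Q := 0) (pairing (Module.finBasis ℝ (E × ℝ)) ((0, 1) : E × ℝ)) with hD
  set ρ := extPullback (Module.finBasis ℝ (E × ℝ)) (Module.finBasis ℝ E)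
    (ContinuousLinearMap.inl ℝ E ℝ) with hρ
  have h1 : ext J (x, s) (c.cone.ch (k + 1) (x, s)) =
      (((k + 1).factorial : ℂ)⁻¹ * (Complex.I / (2 * Real.pi)) ^ (k + 1)) • (F ^ (k + 1)).trace := by
    rw [Connection.ch, Pi.smul_apply, map_smul, ext_sum, ← Connection.extMat_curvaturePow]
    rfl
  have h2 := trace_derivation_pow (D : _ →ₗ[ℂ] _).toAddMonoidHom (F := F)
    (fun n => c.cone.curvaturePow_commute n (x, s))
    (fun n i j y => by
      rw [← Connection.extMat_curvaturePow, extMat_apply]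
      refine (contractLeft_toExt_mul _ _ _ _).trans ?_
      rw [(even_two_mul n).neg_one_pow, one_smul]
      rfl) k 0
  rw [pow_zero, mul_one, add_zero] at h2
  have h3 : ext I x (c.integrand k x s) = ρ (D (ext J (x, s) (c.cone.ch (k + 1) (x, s)))) := by
    rw [hD, ← ext_contr (k := 2 * k + 1), extPullback_ext]
    rfl
  have h4 : D (F ^ (k + 1)).trace = (k + 1) • (F.map D * F ^ k).trace := by
    refine Eq.trans ?_ h2
    exact map_sum D _ _
  have h5 : ρ (F.map D * F ^ k).trace = ((F.map D).map ρ * (F.map ρ) ^ k).trace := by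
    have := AddMonoidHom.map_trace ρ.toRingHom.toAddMonoidHom (F.map D * F ^ k)
    refine this.trans ?_
    congr 1
    exact (map_mul ρ.toRingHom.mapMatrix (F.map D) (F ^ k)).trans
      (congrArg _ (map_pow ρ.toRingHom.mapMatrix F k))
  have h6 : (F.map D).map ρ = extMat I c.formMat x := by
    ext i j
    rw [Matrix.map_apply, Matrix.map_apply, hF, extMat_apply, hD, ← ext_contr,
      contr_cone_curvature, extPullback_ext, Form.pullback, mfderiv_fst]
    rfl
  have h7 : F.map ρ = (s : ℂ) • extMat I c.dForm x +
        (s ^ 2 : ℂ) • (extMat I c.formMat x * extMat I c.formMat x) := by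
    ext i j
    rw [← restrictL_cone_curvature, ← extPullback_ext]
    rfl
  rw [h3, h1, map_smul, map_smul, h4, map_nsmul, h5, h6, h7, ← Nat.cast_smul_eq_nsmul ℂ,
    smul_smul]
  push_cast
  rfl

end TransgressionFormula

/-! ### Block sums and cyclic connections -/

section CyclicMatrices

variable {R : Type*} [Ring R] {N : ℕ}

/-- The matrix is supported on the entries `(i, j)` with `j ≡ i + w` for some `w ∈ S`. -/
def HasWeights (S : Set ℕ) (X : Matrix (Fin N) (Fin N) R) : Prop :=
  ∀ i j, X i j ≠ 0 → ∃ w ∈ S, ((i : ℕ) + w) % N = j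

theorem HasWeights.mono {S T : Set ℕ} {X : Matrix (Fin N) (Fin N) R} (hX : HasWeights S X)
    (h : S ⊆ T) : HasWeights T X := fun i j hij =>
  let ⟨w, hw, e⟩ := hX i j hij
  ⟨w, h hw, e⟩

theorem HasWeights.add {S : Set ℕ} {X Y : Matrix (Fin N) (Fin N) R} (hX : HasWeights S X)
    (hY : HasWeights S Y) : HasWeights S (X + Y) := by
  intro i j hij
  by_cases h : X i j = 0
  · exact hY i j fun h' => hij (by rw [Matrix.add_apply, h, h', add_zero])
  · exact hX i j h

theorem HasWeights.smul {A : Type*} [CommRing A] [Algebra A R] {S : Set ℕ}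
    {X : Matrix (Fin N) (Fin N) R} (hX : HasWeights S X) (c : A) : HasWeights S (c • X) :=
  fun i j hij => hX i j fun h => hij (by rw [Matrix.smul_apply, h, smul_zero])

theorem HasWeights.mul {S T U : Set ℕ} {X Y : Matrix (Fin N) (Fin N) R} (hX : HasWeights S X)
    (hY : HasWeights T Y) (h : ∀ s ∈ S, ∀ t ∈ T, s + t ∈ U) : HasWeights U (X * Y) := by
  intro i j hij
  rw [Matrix.mul_apply] at hij
  obtain ⟨l, _, hl⟩ := Finset.exists_ne_zero_of_sum_ne_zero hij
  obtain ⟨s, hs, e⟩ := hX i l (left_ne_zero_of_mul hl)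
  obtain ⟨t, ht, e'⟩ := hY l j (right_ne_zero_of_mul hl)
  refine ⟨s + t, h s hs t ht, ?_⟩
  rw [← e', ← e, Nat.mod_add_mod, add_assoc]

theorem HasWeights.trace_eq_zero {S : Set ℕ} {X : Matrix (Fin N) (Fin N) R} (hX : HasWeights S X)
    (h : ∀ s ∈ S, 0 < s ∧ s < N) : X.trace = 0 := by
  refine Finset.sum_eq_zero fun i _ => ?_
  by_contra hi
  obtain ⟨w, hw, e⟩ := hX i i hi
  obtain ⟨h1, h2⟩ := h w hw
  have hiN := i.isLt
  rcases lt_or_ge ((i : ℕ) + w) N with h3 | h3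
  · rw [Nat.mod_eq_of_lt h3] at e
    omega
  · rw [Nat.mod_eq_sub_mod h3, Nat.mod_eq_of_lt (by omega)] at e
    omega

theorem HasWeights.pow {a : Matrix (Fin N) (Fin N) R} (ha : HasWeights {1} a) (n : ℕ) :
    HasWeights {n} (a ^ n) := by
  induction n with
  | zero =>
    intro i j hij
    refine ⟨0, rfl, ?_⟩
    rw [pow_zero] at hij
    by_cases h : i = j
    · rw [h, add_zero, Nat.mod_eq_of_lt j.isLt]
    · exact absurd (Matrix.one_apply_ne h) hij
  | succ n ih =>
    rw [pow_succ]
    refine ih.mul ha ?_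
    rintro s rfl t rfl
    rfl

theorem pow_sub_hasWeights {A : Type*} [CommRing A] [Algebra A R] {a f : Matrix (Fin N) (Fin N) R}
    (ha : HasWeights {1} a) (hf : HasWeights {1} f) (s : A) (m : ℕ) :
    HasWeights {w | m ≤ w ∧ w < 2 * m} ((s • f + s ^ 2 • (a * a)) ^ m - s ^ (2 * m) • a ^ (2 * m)) := by
  induction m with
  | zero => intro i j hij; simp at hij
  | succ m ih =>
    have e : (s • f + s ^ 2 • (a * a)) ^ (m + 1) - s ^ (2 * (m + 1)) • a ^ (2 * (m + 1)) =
        ((s • f + s ^ 2 • (a * a)) ^ m - s ^ (2 * m) • a ^ (2 * m)) * (s • f + s ^ 2 • (a * a)) +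
          (s ^ (2 * m) • a ^ (2 * m)) * (s • f) := by
      have h1 : s ^ (2 * (m + 1)) • a ^ (2 * (m + 1)) =
          (s ^ (2 * m) • a ^ (2 * m)) * (s ^ 2 • (a * a)) := by
        rw [smul_mul_smul_comm, ← pow_two, ← pow_add, ← pow_add]
        rfl
      rw [h1, pow_succ, sub_mul, mul_add (s ^ (2 * m) • a ^ (2 * m))]
      abel
    have hs : HasWeights {w | w = 1 ∨ w = 2} (s • f + s ^ 2 • (a * a)) := by
      refine ((hf.smul s).mono ?_).add (((ha.mul ha (U := {2}) ?_).smul _).mono ?_)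
      · rintro w rfl; exact Or.inl rfl
      · rintro w rfl w' rfl; rfl
      · rintro w rfl; exact Or.inr rfl
    rw [e]
    refine (ih.mul hs ?_).add ((((ha.pow _).smul _).mul (hf.smul s) ?_))
    · rintro w ⟨h1, h2⟩ w' (rfl | rfl) <;> constructor <;> omega
    · rintro w rfl w' rfl
      constructor <;> omega

theorem trace_cyclic {A : Type*} [CommRing A] [Algebra A R] {k m : ℕ} (hm : m ≤ k)
    {a f : Matrix (Fin (2 * k + 1)) (Fin (2 * k + 1)) R} (ha : HasWeights {1} a)
    (hf : HasWeights {1} f) (s : A) :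
    (a * (s • f + s ^ 2 • (a * a)) ^ m).trace = s ^ (2 * m) • (a ^ (2 * m + 1)).trace := by
  have h1 : (a * ((s • f + s ^ 2 • (a * a)) ^ m - s ^ (2 * m) • a ^ (2 * m))).trace = 0 := by
    refine (ha.mul (pow_sub_hasWeights ha hf s m) (U := {w | m < w ∧ w < 2 * m + 1}) ?_).trace_eq_zero ?_
    · rintro w rfl w' ⟨h1, h2⟩
      constructor <;> omega
    · rintro w ⟨h1, h2⟩
      constructor <;> omega
  rw [mul_sub, Matrix.trace_sub, sub_eq_zero, mul_smul_comm, ← pow_succ', Matrix.trace_smul] at h1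
  exact h1

theorem mul_ofFn_prod {B : ℕ → R} (hB : ∀ i j, B i * B j = -(B j * B i)) (i j n : ℕ) :
    B i * (List.ofFn fun t : Fin n => B (j + t)).prod =
      (-1) ^ n * ((List.ofFn fun t : Fin n => B (j + t)).prod * B i) := by
  induction n with
  | zero => simp
  | succ n ih =>
    have e : (List.ofFn fun t : Fin (n + 1) => B (j + t)).prod =
        (List.ofFn fun t : Fin n => B (j + t)).prod * B (j + n) := by
      rw [List.ofFn_succ', List.prod_concat]
      rfl
    rw [e, ← mul_assoc, ih, mul_assoc, mul_assoc, hB i, mul_neg, mul_neg, pow_succ]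
    noncomm_ring

/-- The matrix with entries `β i` at the places `(i, i + 1)`. -/
def cyclicMatrix {A : Type*} [Zero A] {N : ℕ} (β : Fin N → A) : Matrix (Fin N) (Fin N) A :=
  Matrix.of fun i j => if ((i : ℕ) + 1) % N = j then β i else 0

theorem cyclicMatrix_hasWeights (β : Fin N → R) : HasWeights {1} (cyclicMatrix β) := by
  intro i j hij
  refine ⟨1, rfl, ?_⟩
  by_contra h
  exact hij (if_neg h)

theorem cyclicMatrix_pow (β : Fin (N + 1) → R) (n : ℕ) (i j : Fin (N + 1)) :
    (cyclicMatrix β ^ n) i j = if ((i : ℕ) + n) % (N + 1) = j then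
      (List.ofFn fun t : Fin n => β (Fin.ofNat (N + 1) (i + t))).prod else 0 := by
  induction n generalizing j with
  | zero =>
    rw [pow_zero, Matrix.one_apply, add_zero, Nat.mod_eq_of_lt i.isLt]
    simp [Fin.ext_iff]
  | succ n ih =>
    rw [pow_succ, Matrix.mul_apply, Finset.sum_eq_single (Fin.ofNat (N + 1) (i + n))]
    · rw [ih, if_pos (by simp), cyclicMatrix, Matrix.of_apply]
      have e : (((Fin.ofNat (N + 1) (i + n) : Fin (N + 1)) : ℕ) + 1) % (N + 1) =
        ((i : ℕ) + (n + 1)) % (N + 1) := by simp [add_assoc]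
      rw [e, mul_ite, mul_zero]
      congr 1
      rw [List.ofFn_succ', List.prod_concat]
      rfl
    · intro l _ hl
      rw [ih, if_neg, zero_mul]
      intro h
      exact hl (Fin.ext (by rw [← h]; simp))
    · simp

theorem cyclicMatrix_pow_trace {k : ℕ} (β : Fin (2 * k + 1) → R)
    (hβ : ∀ i j, β i * β j = -(β j * β i)) :
    (cyclicMatrix β ^ (2 * k + 1)).trace = (2 * k + 1) • (List.ofFn β).prod := by
  set B : ℕ → R := fun n => β (Fin.ofNat (2 * k + 1) n) with hBdef
  have hB : ∀ i j, B i * B j = -(B j * B i) := fun i j => hβ _ _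
  have h1 : ∀ i : ℕ, (List.ofFn fun t : Fin (2 * k + 1) => B (i + t)).prod = (List.ofFn β).prod := by
    intro i
    induction i with
    | zero =>
      congr 2
      funext t
      have : Fin.ofNat (2 * k + 1) (0 + t) = t := Fin.ext (by simp)
      rw [hBdef]
      exact congrArg β this
    | succ i ih =>
      have e1 : (List.ofFn fun t : Fin (2 * k + 1) => B (i + t)).prod =
          B i * (List.ofFn fun t : Fin (2 * k) => B (i + 1 + t)).prod := by
        rw [List.ofFn_succ, List.prod_cons]
        congr 3
        funext t
        rw [Fin.val_succ, add_right_comm, add_assoc]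
      have e2 : (List.ofFn fun t : Fin (2 * k + 1) => B (i + 1 + t)).prod =
          (List.ofFn fun t : Fin (2 * k) => B (i + 1 + t)).prod * B i := by
        rw [List.ofFn_succ', List.prod_concat]
        congr 1
        refine congrArg β (Fin.ext ?_)
        have : i + 1 + (Fin.last (2 * k) : ℕ) = i + (2 * k + 1) := by simp; omega
        simp only [Fin.ofNat, this, Nat.add_mod_right]
      rw [e2, ← ih, e1, mul_ofFn_prod hB, (even_two_mul k).neg_one_pow, one_mul]
  have h2 : ∀ i : Fin (2 * k + 1), (cyclicMatrix β ^ (2 * k + 1)) i i = (List.ofFn β).prod := by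
    intro i
    rw [cyclicMatrix_pow, if_pos (by rw [Nat.add_mod_right, Nat.mod_eq_of_lt i.isLt])]
    exact h1 i
  rw [Matrix.trace]
  simp only [Matrix.diag_apply, h2, Finset.sum_const, Finset.card_univ, Fintype.card_fin]

end CyclicMatrices

section CyclicConnections

open MeasureTheory Set

universe u

variable {E : Type u} [NormedAddCommGroup E] [NormedSpace ℝ E] [FiniteDimensional ℝ E]
  {H : Type*} [TopologicalSpace H] {I : ModelWithCorners ℝ E H} [I.Boundaryless]
  {M : Type*} [TopologicalSpace M] [ChartedSpace H M] [IsManifold I ∞ M] {k m r r' : ℕ}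

/-- The connection whose form is the cyclic matrix with entries `b 0, …, b (2k)`. -/
def Connection.cyclic (b : Fin (2 * k + 1) → SmoothForm I M 1) : Connection I M (2 * k + 1) :=
  ⟨cyclicMatrix b⟩

theorem Connection.extMat_formMat_cyclic (b : Fin (2 * k + 1) → SmoothForm I M 1) (x : M) :
    extMat I (Connection.cyclic b).formMat x =
      cyclicMatrix fun i => ext I x ((b i : Form I M 1) x) := by
  ext i j
  have h : (Connection.cyclic b).formMat i j =
    ((if ((i : ℕ) + 1) % (2 * k + 1) = j then b i else 0 : SmoothForm I M 1) : Form I M 1) := rfl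
  rw [extMat_apply, h, cyclicMatrix, Matrix.of_apply]
  split_ifs with h1
  · rfl
  · exact LinearMap.map_zero (ext I x)

theorem Connection.extMat_dForm_cyclic (b : Fin (2 * k + 1) → SmoothForm I M 1) (x : M) :
    extMat I (Connection.cyclic b).dForm x =
      cyclicMatrix fun i => ext I x (Form.d (b i : Form I M 1) x) := by
  ext i j
  have h : (Connection.cyclic b).dForm i j = Form.d
    ((if ((i : ℕ) + 1) % (2 * k + 1) = j then b i else 0 : SmoothForm I M 1) : Form I M 1) := rfl
  rw [extMat_apply, h, cyclicMatrix, Matrix.of_apply]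
  split_ifs with h1
  · rfl
  · have h2 : Form.d ((0 : SmoothForm I M 1) : Form I M 1) = 0 := Form.d_zero
    rw [h2]
    exact LinearMap.map_zero (ext I x)

theorem Connection.toExt_integrand (c : Connection I M r) (k : ℕ) (x : M) (s : ℝ) :
    toExt (Module.finBasis ℝ E) (c.integrand k x s) =
      (((k + 1).factorial : ℂ)⁻¹ * (Complex.I / (2 * Real.pi)) ^ (k + 1) * (k + 1)) •
      (extMat I c.formMat x * ((s : ℂ) • extMat I c.dForm x +
        (s ^ 2 : ℂ) • (extMat I c.formMat x * extMat I c.formMat x)) ^ k).trace :=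
  c.ext_integrand k x s

theorem Connection.ext_transgression_cyclic (b : Fin (2 * k + 1) → SmoothForm I M 1) (hm : m ≤ k)
    (x : M) :
    ext I x ((Connection.cyclic b).transgression m x) =
      ((2 * m + 1 : ℂ)⁻¹ * (((m + 1).factorial : ℂ)⁻¹ * (Complex.I / (2 * Real.pi)) ^ (m + 1) *
        (m + 1))) • (extMat I (Connection.cyclic b).formMat x ^ (2 * m + 1)).trace := by
  set c := Connection.cyclic b
  have ha : HasWeights {1} (extMat I c.formMat x) := by
    rw [Connection.extMat_formMat_cyclic]; exact cyclicMatrix_hasWeights _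
  have hf : HasWeights {1} (extMat I c.dForm x) := by
    rw [Connection.extMat_dForm_cyclic]; exact cyclicMatrix_hasWeights _
  have h1 : ∀ s : ℝ, c.integrand m x s = (s ^ (2 * m)) • c.integrand m x 1 := by
    intro s
    refine (toExt_injective (Module.finBasis ℝ E) ?_).trans
      (Complex.coe_smul (s ^ (2 * m)) (c.integrand m x 1))
    rw [map_smul, Connection.toExt_integrand, Connection.toExt_integrand, trace_cyclic hm ha hf,
      trace_cyclic hm ha hf, smul_comm, Complex.ofReal_one, one_pow, one_smul, Complex.ofReal_pow]
  have h2 : c.transgression m x = ((2 * m + 1 : ℂ)⁻¹) • c.integrand m x 1 := by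
    have h3 : ∫ s in (0 : ℝ)..1, s ^ (2 * m) • c.integrand m x 1 =
        ((2 * m + 1 : ℝ)⁻¹) • c.integrand m x 1 := by
      rw [intervalIntegral.integral_smul_const, integral_pow]
      simp
    refine (c.transgression_eq m x).trans ?_
    refine ((intervalIntegral.integral_congr fun s _ => h1 s).trans h3).trans ?_
    refine (Complex.coe_smul _ (c.integrand m x 1)).symm.trans ?_
    push_cast
    rfl
  rw [h2]
  refine (map_smul (toExt (Module.finBasis ℝ E)) _ (c.integrand m x 1)).trans ?_
  rw [Connection.toExt_integrand, trace_cyclic hm ha hf, Complex.ofReal_one, one_pow, one_smul,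
    smul_smul]

theorem ext_one_anticomm (x : M) (α β : Form I M 1) :
    ext I x (α x) * ext I x (β x) = -(ext I x (β x) * ext I x (α x)) := by
  have h := toExt_one_mul (Module.finBasis ℝ E) (α x) (β x)
  rw [pow_one, neg_one_smul] at h
  exact h

/-- The coefficient of the product of the entries in the transgression form of a cyclic
connection. -/
def cyclicCoeff (k : ℕ) : ℂ :=
  ((k + 1).factorial : ℂ)⁻¹ * (Complex.I / (2 * Real.pi)) ^ (k + 1) * (k + 1)

theorem cyclicCoeff_ne_zero (k : ℕ) : cyclicCoeff k ≠ 0 := by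
  have h1 : ((k + 1).factorial : ℂ) ≠ 0 := by exact_mod_cast (k + 1).factorial_ne_zero
  have h2 : ((k : ℂ) + 1) ≠ 0 := by exact_mod_cast k.succ_ne_zero
  have h3 : Complex.I / (2 * Real.pi) ≠ 0 := by
    simp [Real.pi_ne_zero]
  exact mul_ne_zero (mul_ne_zero (inv_ne_zero h1) (pow_ne_zero _ h3)) h2

theorem Connection.ext_transgression_cyclic_top (b : Fin (2 * k + 1) → SmoothForm I M 1) (x : M) :
    ext I x ((Connection.cyclic b).transgression k x) =
      cyclicCoeff k • (List.ofFn fun i => ext I x ((b i : Form I M 1) x)).prod := by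
  rw [Connection.ext_transgression_cyclic b le_rfl, Connection.extMat_formMat_cyclic,
    cyclicMatrix_pow_trace _ fun i j => ext_one_anticomm x _ _, ← Nat.cast_smul_eq_nsmul ℂ, smul_smul]
  congr 1
  have h2 : (2 * (k : ℂ) + 1) ≠ 0 := by exact_mod_cast (2 * k).succ_ne_zero
  rw [cyclicCoeff]
  push_cast
  field_simp

theorem Connection.transgression_cyclic_eq_zero (b : Fin (2 * k + 1) → SmoothForm I M 1)
    (hm : m < k) : (Connection.cyclic b).transgression m = 0 := by
  funext x
  refine ext_injective x ?_
  rw [Connection.ext_transgression_cyclic b hm.le, Connection.extMat_formMat_cyclic,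
    ((cyclicMatrix_hasWeights _).pow _).trace_eq_zero, smul_zero]
  · exact (LinearMap.map_zero (ext I x)).symm
  · rintro s rfl
    constructor <;> omega

/-- The direct sum of two connections. -/
def Connection.blockSum (c : Connection I M r) (c' : Connection I M r') :
    Connection I M (r + r') :=
  ⟨Matrix.reindex finSumFinEquiv finSumFinEquiv (Matrix.fromBlocks c.form 0 0 c'.form)⟩

theorem Connection.extMat_formMat_blockSum (c : Connection I M r) (c' : Connection I M r') (x : M) :
    extMat I (c.blockSum c').formMat x = Matrix.reindex finSumFinEquiv finSumFinEquiv
      (Matrix.fromBlocks (extMat I c.formMat x) 0 0 (extMat I c'.formMat x)) := by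
  ext i j
  have h : (c.blockSum c').formMat i j = (Matrix.fromBlocks c.form 0 0 c'.form
    (finSumFinEquiv.symm i) (finSumFinEquiv.symm j) : SmoothForm I M 1) := rfl
  rw [extMat_apply, h, Matrix.reindex_apply, Matrix.submatrix_apply]
  rcases finSumFinEquiv.symm i with i | i <;> rcases finSumFinEquiv.symm j with j | j
  · rfl
  · exact LinearMap.map_zero (ext I x)
  · exact LinearMap.map_zero (ext I x)
  · rfl

theorem Connection.extMat_dForm_blockSum (c : Connection I M r) (c' : Connection I M r') (x : M) :
    extMat I (c.blockSum c').dForm x = Matrix.reindex finSumFinEquiv finSumFinEquiv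
      (Matrix.fromBlocks (extMat I c.dForm x) 0 0 (extMat I c'.dForm x)) := by
  ext i j
  have h : (c.blockSum c').dForm i j = Form.d (Matrix.fromBlocks c.form 0 0 c'.form
    (finSumFinEquiv.symm i) (finSumFinEquiv.symm j) : SmoothForm I M 1).1 := rfl
  have h2 : Form.d ((0 : SmoothForm I M 1) : Form I M 1) = 0 := Form.d_zero
  have h3 : ext I x (Form.d ((0 : SmoothForm I M 1) : Form I M 1) x) = 0 := by
    rw [h2]
    exact LinearMap.map_zero (ext I x)
  rw [extMat_apply, h, Matrix.reindex_apply, Matrix.submatrix_apply]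
  rcases finSumFinEquiv.symm i with i | i <;> rcases finSumFinEquiv.symm j with j | j
  · rfl
  · exact h3
  · exact h3
  · rfl

theorem Connection.transgression_blockSum (c : Connection I M r) (c' : Connection I M r') (k : ℕ) :
    (c.blockSum c').transgression k = c.transgression k + c'.transgression k := by
  funext x
  have h1 : ∀ s, (c.blockSum c').integrand k x s = c.integrand k x s + c'.integrand k x s := by
    intro s
    refine toExt_injective (Module.finBasis ℝ E) ?_
    rw [map_add, Connection.toExt_integrand, Connection.toExt_integrand,
      Connection.toExt_integrand, ← smul_add, Connection.extMat_formMat_blockSum, Connection.extMat_dForm_blockSum]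
    congr 1
    set a := extMat I c.formMat x
    set a' := extMat I c'.formMat x
    set f := extMat I c.dForm x
    set f' := extMat I c'.dForm x
    set φ := Matrix.reindexAlgEquiv ℂ (CoordExt (Fin (Module.finrank ℝ E)))
      (finSumFinEquiv (m := r) (n := r'))
    have hφ : ∀ X, Matrix.reindex finSumFinEquiv finSumFinEquiv X = φ X := fun _ => rfl
    have ht : ∀ X, (φ X).trace = X.trace := fun X =>
      finSumFinEquiv.symm.sum_comp fun i => X i i
    rw [hφ, hφ, ← map_mul, ← map_smul, ← map_smul, ← map_add, ← map_pow, ← map_mul, ht,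
      Matrix.fromBlocks_multiply, Matrix.fromBlocks_smul, Matrix.fromBlocks_smul,
      Matrix.fromBlocks_add]
    simp only [Matrix.mul_zero, Matrix.zero_mul, add_zero, zero_add, smul_zero]
    rw [Matrix.fromBlocks_diagonal_pow, Matrix.fromBlocks_multiply, Matrix.trace,
      Fintype.sum_sum_type]
    simp only [Matrix.mul_zero, Matrix.zero_mul, add_zero, zero_add]
    rfl
  refine (Connection.transgression_eq _ _ _).trans ?_
  rw [funext h1, intervalIntegral.integral_add ((c.integrand_continuous k x).intervalIntegrable _ _)
    ((c'.integrand_continuous k x).intervalIntegrable _ _), ← Connection.transgression_eq,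
    ← Connection.transgression_eq]
  rfl

theorem Connection.transgression_rank_zero (c : Connection I M 0) (k : ℕ) :
    c.transgression k = 0 := by
  funext x
  have h1 : ∀ s, c.integrand k x s = 0 := by
    intro s
    refine toExt_injective (Module.finBasis ℝ E) ?_
    rw [map_zero, Connection.toExt_integrand, Matrix.trace]
    simp
  rw [Connection.transgression_eq, funext h1]
  simp
  rfl

theorem exists_transgression_sum {ι : Type*} (s : Finset ι) (r : ι → ℕ)
    (c : ∀ i, Connection I M (r i)) :
    ∃ (N : ℕ) (C : Connection I M N), ∀ k, C.transgression k = ∑ i ∈ s, (c i).transgression k := by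
  classical
  induction s using Finset.induction_on with
  | empty => exact ⟨0, Connection.trivial I M 0, fun k => by
      rw [Finset.sum_empty, Connection.transgression_rank_zero]⟩
  | insert a s ha ih =>
    obtain ⟨N, C, hC⟩ := ih
    exact ⟨_, (c a).blockSum C, fun k => by
      rw [Finset.sum_insert ha, Connection.transgression_blockSum, hC]⟩

end CyclicConnections

/-! ### Frames dual to spanning families of differentials -/

section Frames

variable {E : Type*} [NormedAddCommGroup E] [NormedSpace ℝ E] [FiniteDimensional ℝ E] {N : ℕ}

/-- The Gram operator `e ↦ ∑ a, β a e • β a` of a family of linear forms. -/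
def gram (β : Fin N → E →L[ℝ] ℝ) : E →L[ℝ] E →L[ℝ] ℝ := ∑ a, (β a).smulRight (β a)

theorem gram_apply (β : Fin N → E →L[ℝ] ℝ) (e : E) : gram β e = ∑ a, β a e • β a := by
  simp [gram]

theorem exists_gram_equiv {β : Fin N → E →L[ℝ] ℝ} (hβ : ∀ v, (∀ a, β a v = 0) → v = 0) :
    ∃ e : E ≃L[ℝ] (E →L[ℝ] ℝ), (e : E →L[ℝ] E →L[ℝ] ℝ) = gram β := by
  have hinj : Function.Injective (gram β : E →ₗ[ℝ] E →L[ℝ] ℝ) := by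
    rw [injective_iff_map_eq_zero]
    intro v hv
    have h1 : gram β v v = 0 := by
      have : gram β v = 0 := hv
      rw [this]; rfl
    rw [gram_apply, sum_apply] at h1
    have h2 := (Finset.sum_eq_zero_iff_of_nonneg fun a _ => by
      simpa using mul_self_nonneg (β a v)).1 h1
    refine hβ v fun a => ?_
    simpa using h2 a (Finset.mem_univ a)
  have hdim : Module.finrank ℝ E = Module.finrank ℝ (E →L[ℝ] ℝ) := by
    rw [← (LinearMap.toContinuousLinearMap (𝕜 := ℝ) (E := E) (F' := ℝ)).finrank_eq]
    exact (Subspace.dual_finrank_eq (K := ℝ) (V := E)).symm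
  refine ⟨(LinearMap.linearEquivOfInjective _ hinj hdim).toContinuousLinearEquiv, ?_⟩
  ext v : 1
  rfl

/-- The family of vectors with `∑ a, β a e • frame β a = e`. -/
def frame (β : Fin N → E →L[ℝ] ℝ) (a : Fin N) : E := (gram β).inverse (β a)

theorem gram_frame {β : Fin N → E →L[ℝ] ℝ} (hβ : ∀ v, (∀ a, β a v = 0) → v = 0) (a : Fin N) :
    gram β (frame β a) = β a := by
  obtain ⟨e, he⟩ := exists_gram_equiv hβ
  rw [frame, ← he, ContinuousLinearMap.inverse_equiv]
  exact e.apply_symm_apply _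

theorem gram_injective {β : Fin N → E →L[ℝ] ℝ} (hβ : ∀ v, (∀ a, β a v = 0) → v = 0) :
    Function.Injective (gram β) := by
  obtain ⟨e, he⟩ := exists_gram_equiv hβ
  rw [← he]
  exact e.injective

theorem sum_frame {β : Fin N → E →L[ℝ] ℝ} (hβ : ∀ v, (∀ a, β a v = 0) → v = 0) (v : E) :
    ∑ a, β a v • frame β a = v := by
  refine gram_injective hβ ?_
  rw [map_sum, gram_apply β v]
  refine Finset.sum_congr rfl fun a _ => ?_
  rw [map_smul, gram_frame hβ]

theorem frame_comp {β : Fin N → E →L[ℝ] ℝ} (hβ : ∀ v, (∀ a, β a v = 0) → v = 0) {D D' : E →L[ℝ] E}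
    (hD : ∀ v, D (D' v) = v) (hD' : ∀ v, D' (D v) = v) (a : Fin N) :
    D (frame (fun a => (β a).comp D) a) = frame β a := by
  have hβ' : ∀ v, (∀ a, (β a).comp D v = 0) → v = 0 := fun v hv => by
    rw [← hD' v, hβ (D v) hv, map_zero]
  refine gram_injective hβ ?_
  rw [gram_frame hβ]
  have h1 := gram_frame hβ' a
  ext v
  have h2 := DFunLike.congr_fun h1 (D' v)
  rw [gram_apply] at h2 ⊢
  simpa [sum_apply, hD] using h2

theorem contDiffAt_frame {Z : Type*} [NormedAddCommGroup Z] [NormedSpace ℝ Z]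
    {β : Fin N → Z → E →L[ℝ] ℝ} {z : Z} (hβ : ∀ a, ContDiffAt ℝ ∞ (β a) z)
    (h : ∀ v, (∀ a, β a z v = 0) → v = 0) (a : Fin N) :
    ContDiffAt ℝ ∞ (fun z => frame (fun a => β a z) a) z := by
  have : CompleteSpace E := FiniteDimensional.complete ℝ E
  obtain ⟨e, he⟩ := exists_gram_equiv h
  have h1 : ContDiffAt ℝ ∞ (fun z => gram fun a => β a z) z := by
    refine ContDiffAt.sum fun a _ => ?_
    exact (hβ a).smulRight (hβ a)
  have h2 : ContDiffAt ℝ ∞ (ContinuousLinearMap.inverse :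
      (E →L[ℝ] E →L[ℝ] ℝ) → (E →L[ℝ] ℝ) →L[ℝ] E) (gram fun a => β a z) := by
    rw [← he]
    exact contDiffAt_map_inverse e
  exact (h2.comp z h1).clm_apply (hβ a)

theorem gen_prod_genMulti {ι : Type*} [DecidableEq ι] {k : ℕ} (g : Fin k → ι) :
    genMulti g = (List.ofFn fun i => gen (g i)).prod :=
  ExteriorAlgebra.ιMulti_apply _

/-- The expansion of an alternating form with respect to a family of linear forms. -/
theorem toExt_frame {ι : Type*} [Fintype ι] [DecidableEq ι] (b : Module.Basis ι ℝ E) {k : ℕ}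
    {β : Fin N → E →L[ℝ] ℝ} (hβ : ∀ v, (∀ a, β a v = 0) → v = 0) (η : E [⋀^Fin k]→L[ℝ] ℂ) :
    toExt b η = (k.factorial : ℂ)⁻¹ • ∑ g : Fin k → Fin N, η (fun i => frame β (g i)) •
      (List.ofFn fun i => toExt b (((ContinuousAlternatingMap.ofSubsingleton ℝ E ℂ (0 : Fin 1))
        (Complex.ofRealCLM.comp (β (g i)))))).prod := by
  set L : E →L[ℝ] Fin N → ℝ := ContinuousLinearMap.pi β
  set S : (Fin N → ℝ) →L[ℝ] E := ∑ a, (ContinuousLinearMap.proj a).smulRight (frame β a)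
  have hS : ∀ w, S w = ∑ a, w a • frame β a := fun w => by
    simp [S]
  have h1 : η = (η.compContinuousLinearMap S).compContinuousLinearMap L := by
    ext v
    refine congrArg η (funext fun i => ?_)
    exact ((hS _).trans (sum_frame hβ (v i))).symm
  have h2 : ∀ a, extPullback (Pi.basisFun ℝ (Fin N)) b L (gen a) =
      toExt b (((ContinuousAlternatingMap.ofSubsingleton ℝ E ℂ (0 : Fin 1))
        (Complex.ofRealCLM.comp (β a)))) := by
    intro a
    have h3 : gen a = toExt (Pi.basisFun ℝ (Fin N))
        ((ContinuousAlternatingMap.ofSubsingleton ℝ (Fin N → ℝ) ℂ (0 : Fin 1))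
          (Complex.ofRealCLM.comp (ContinuousLinearMap.proj a))) := by
      rw [toExt_one_form, Finset.sum_eq_single a]
      · simp
      · intro i _ hi
        simp [hi.symm]
      · simp
    rw [h3, extPullback_toExt]
    rfl
  conv_lhs => rw [h1]
  rw [← extPullback_toExt (Pi.basisFun ℝ (Fin N)), toExt_apply, map_smul, map_sum]
  congr 1
  refine Finset.sum_congr rfl fun g _ => ?_
  rw [map_smul, gen_prod_genMulti, map_list_prod, List.map_ofFn]
  congr 1
  · refine congrArg η (funext fun i => ?_)
    refine (hS _).trans ?_
    simp [Pi.single_apply]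
  · congr 2
    funext i
    exact h2 (g i)

end Frames

/-! ### Spanning the forms by products of differentials -/

section Spanning

variable {E : Type*} [NormedAddCommGroup E] [NormedSpace ℝ E] [FiniteDimensional ℝ E]
  {H : Type*} [TopologicalSpace H] {I : ModelWithCorners ℝ E H} [I.Boundaryless]
  {M : Type*} [TopologicalSpace M] [ChartedSpace H M] [IsManifold I ∞ M]
  {F F' : Type*} [NormedAddCommGroup F] [NormedSpace ℝ F] [NormedAddCommGroup F'] [NormedSpace ℝ F']
  {k N : ℕ}

variable (I) in
/-- The differential of a function with values in a vector space, as a linear map on the model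
space. -/
def differential (f : M → F) (x : M) : E →L[ℝ] F := mfderiv I 𝓘(ℝ, F) f x

theorem hasMFDerivAt_differential {f : M → F} (hf : ContMDiff I 𝓘(ℝ, F) ∞ f) (x : M) :
    HasMFDerivAt I 𝓘(ℝ, F) f x (mfderiv I 𝓘(ℝ, F) f x) :=
  ((hf x).mdifferentiableAt (by simp)).hasMFDerivAt

theorem differential_clm_comp (L : F →L[ℝ] F') {f : M → F} (hf : ContMDiff I 𝓘(ℝ, F) ∞ f) (x : M) :
    differential I (fun x => L (f x)) x = L.comp (differential I f x) :=
  (L.hasMFDerivAt.comp x (hasMFDerivAt_differential hf x)).mfderiv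

theorem differential_add {f g : M → F} (hf : ContMDiff I 𝓘(ℝ, F) ∞ f)
    (hg : ContMDiff I 𝓘(ℝ, F) ∞ g) (x : M) :
    differential I (f + g) x = differential I f x + differential I g x :=
  ((hasMFDerivAt_differential hf x).add (hasMFDerivAt_differential hg x)).mfderiv

theorem differential_congr {f g : M → F} {x : M} (h : f =ᶠ[nhds x] g) :
    differential I f x = differential I g x := h.mfderiv_eq

theorem differential_comp {f : M → F} (hf : ContMDiff I 𝓘(ℝ, F) ∞ f) {x₀ : M} {y : E}
    (hy : y ∈ (extChartAt I x₀).target) :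
    (differential I f ((extChartAt I x₀).symm y)).comp
      (mfderiv 𝓘(ℝ, E) I (extChartAt I x₀).symm y : E →L[ℝ] E) =
      fderiv ℝ (f ∘ (extChartAt I x₀).symm) y := by
  have h1 := mfderiv_comp y ((hf ((extChartAt I x₀).symm y)).mdifferentiableAt (by simp))
    (mdifferentiableAt_extChartAt_symm hy)
  rw [mfderiv_eq_fderiv] at h1
  exact h1.symm

theorem contDiffAt_comp_symm {f : M → F} (hf : ContMDiff I 𝓘(ℝ, F) ∞ f) {x₀ : M} {y : E}
    (hy : y ∈ (extChartAt I x₀).target) : ContDiffAt ℝ ∞ (f ∘ (extChartAt I x₀).symm) y := by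
  have h1 : ContMDiffAt 𝓘(ℝ, E) 𝓘(ℝ, F) ∞ (f ∘ (extChartAt I x₀).symm) y :=
    (hf _).comp y ((contMDiffOn_extChartAt_symm x₀).contMDiffAt
      ((isOpen_extChartAt_target x₀).mem_nhds hy))
  rwa [contMDiffAt_iff_contDiffAt] at h1

/-- The `1`-form `df`. -/
def Form.ofDifferential (f : M → ℝ) : Form I M 1 := fun x =>
  (ContinuousAlternatingMap.ofSubsingleton ℝ E ℂ (0 : Fin 1)
    (Complex.ofRealCLM.comp (differential I f x)) : E [⋀^Fin 1]→L[ℝ] ℂ)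

theorem Form.ofDifferential_isSmooth {f : M → ℝ} (hf : ContMDiff I 𝓘(ℝ, ℝ) ∞ f) :
    (Form.ofDifferential f : Form I M 1).IsSmooth := by
  intro x₀
  refine ContDiffOn.congr (f := fun y => ContinuousAlternatingMap.ofSubsingleton ℝ E ℂ (0 : Fin 1)
    (Complex.ofRealCLM.comp (fderiv ℝ (f ∘ (extChartAt I x₀).symm) y))) ?_ ?_
  · intro y hy
    refine contDiffWithinAt_alt_iff.2 fun v => ContDiffAt.contDiffWithinAt ?_
    have h1 := (contDiffAt_comp_symm hf hy).fderiv_right (m := ∞) (by simp)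
    exact Complex.ofRealCLM.contDiff.contDiffAt.comp y (h1.clm_apply contDiffAt_const)
  · intro y hy
    rw [← differential_comp hf hy, Form.inChart_eq]
    rfl

/-- The product of a form with a complex function. -/
def Form.mulFun (u : M → ℂ) (η : Form I M k) : Form I M k := fun x => u x • η x

theorem Form.IsSmooth.mulFun {u : M → ℂ} (hu : ∀ x₀, ContDiffOn ℝ ∞ (u ∘ (extChartAt I x₀).symm)
    (extChartAt I x₀).target) {η : Form I M k} (hη : η.IsSmooth) : (Form.mulFun u η).IsSmooth :=
  fun x₀ y hy => (hu x₀ y hy).smul (hη x₀ y hy)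

theorem apply_comm_of_right_inverse {D D' : E →L[ℝ] E} (h : ∀ v, D (D' v) = v) (v : E) :
    D' (D v) = v := by
  have h3 : (D : E →ₗ[ℝ] E) ∘ₗ (D' : E →ₗ[ℝ] E) = LinearMap.id := LinearMap.ext h
  rw [LinearMap.comp_eq_id_comm] at h3
  exact LinearMap.congr_fun h3 v

theorem mfderiv_symm_inverse {x₀ : M} {y : E} (hy : y ∈ (extChartAt I x₀).target) :
    ∃ D' : E →L[ℝ] E,
      (∀ v, (mfderiv 𝓘(ℝ, E) I (extChartAt I x₀).symm y : E →L[ℝ] E) (D' v) = v) ∧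
      ∀ v, D' ((mfderiv 𝓘(ℝ, E) I (extChartAt I x₀).symm y : E →L[ℝ] E) v) = v := by
  set p := (extChartAt I x₀).symm y with hp
  have hps : p ∈ (chartAt H x₀).source := by
    rw [← extChartAt_source I]; exact (extChartAt I x₀).map_target hy
  have h1 : ∀ w : E, (mfderiv 𝓘(ℝ, E) I (extChartAt I x₀).symm y : E →L[ℝ] E)
      ((mfderiv I 𝓘(ℝ, E) (extChartAt I x₀) p : E →L[ℝ] E) w) = w := by
    intro w
    have h2 := mfderiv_symm_mfderiv (J := I) hps w
    rw [hp, (extChartAt I x₀).right_inv hy] at h2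
    exact h2
  refine ⟨(mfderiv I 𝓘(ℝ, E) (extChartAt I x₀) p : E →L[ℝ] E), h1, ?_⟩
  exact apply_comm_of_right_inverse (E := E) h1

theorem contDiffOn_frame_coefficient {G : Fin N → M → ℝ} (hG : ∀ a, ContMDiff I 𝓘(ℝ, ℝ) ∞ (G a))
    (h : ∀ x v, (∀ a, differential I (G a) x v = 0) → v = 0) {η : Form I M k} (hη : η.IsSmooth)
    (g : Fin k → Fin N) (x₀ : M) :
    ContDiffOn ℝ ∞ ((fun x => (η x : E [⋀^Fin k]→L[ℝ] ℂ)
      fun i => frame (E := E) (fun a => differential I (G a) x) (g i)) ∘ (extChartAt I x₀).symm)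
      (extChartAt I x₀).target := by
  refine ContDiffOn.congr (f := fun y => Form.inChart η x₀ y fun i =>
    frame (fun a => fderiv ℝ (G a ∘ (extChartAt I x₀).symm) y) (g i)) ?_ ?_
  · intro y hy
    refine ContDiffWithinAt.alt_apply (hη x₀ y hy) fun i => ContDiffAt.contDiffWithinAt ?_
    refine contDiffAt_frame (β := fun a y => fderiv ℝ (G a ∘ (extChartAt I x₀).symm) y)
      (fun a => (contDiffAt_comp_symm (hG a) hy).fderiv_right (m := ∞) (by simp)) ?_ (g i)
    intro v hv
    obtain ⟨D', -, hD'⟩ := mfderiv_symm_inverse (I := I) hy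
    refine (hD' v).symm.trans ((congrArg D' (h ((extChartAt I x₀).symm y) _ fun a => ?_)).trans (map_zero D'))
    exact (DFunLike.congr_fun (differential_comp (hG a) hy) v).trans (hv a)
  · intro y hy
    obtain ⟨D', hD, hD'⟩ := mfderiv_symm_inverse (I := I) hy
    rw [Form.inChart_eq]
    refine congrArg (η ((extChartAt I x₀).symm y) : E [⋀^Fin k]→L[ℝ] ℂ) (funext fun i => ?_)
    have h1 := frame_comp (h ((extChartAt I x₀).symm y)) hD hD' (g i)
    rw [← h1]
    refine congrArg _ (congrArg (fun β => frame β (g i)) (funext fun a => ?_))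
    exact differential_comp (hG a) hy

/-- If the differentials of finitely many functions span every cotangent space, then every smooth
form is a finite sum of products of smooth `1`-forms. -/
theorem exists_sum_products {G : Fin N → M → ℝ} (hG : ∀ a, ContMDiff I 𝓘(ℝ, ℝ) ∞ (G a))
    (h : ∀ x v, (∀ a, differential I (G a) x v = 0) → v = 0) {η : Form I M (k + 1)}
    (hη : η.IsSmooth) :
    ∃ b : (Fin (k + 1) → Fin N) → Fin (k + 1) → SmoothForm I M 1, ∀ x,
      ext I x (η x) = ∑ g, (List.ofFn fun i => ext I x ((b g i : Form I M 1) x)).prod := by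
  set u : (Fin (k + 1) → Fin N) → M → ℂ := fun g x => ((k + 1).factorial : ℂ)⁻¹ •
    (η x : E [⋀^Fin (k + 1)]→L[ℝ] ℂ) fun i => frame (E := E) (fun a => differential I (G a) x) (g i) with hu
  have hus : ∀ g x₀, ContDiffOn ℝ ∞ (u g ∘ (extChartAt I x₀).symm) (extChartAt I x₀).target :=
    fun g x₀ => (contDiffOn_frame_coefficient hG h hη g x₀).const_smul _
  refine ⟨fun g => Fin.cons
    ⟨Form.mulFun (u g) (Form.ofDifferential (G (g 0))),
      Form.IsSmooth.mulFun (hus g) (Form.ofDifferential_isSmooth (hG _))⟩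
    fun i => ⟨Form.ofDifferential (G (g i.succ)), Form.ofDifferential_isSmooth (hG _)⟩,
    fun x => ?_⟩
  refine (toExt_frame (Module.finBasis ℝ E) (h x) (η x : E [⋀^Fin (k + 1)]→L[ℝ] ℂ)).trans ?_
  rw [Finset.smul_sum]
  refine Finset.sum_congr rfl fun g _ => ?_
  rw [List.ofFn_succ, List.ofFn_succ, List.prod_cons, List.prod_cons, ← smul_mul_assoc,
    ← smul_mul_assoc, smul_smul]
  refine congrArg₂ (· * ·) ?_ rfl
  exact (map_smul (ext I x) (u g x) (Form.ofDifferential (G (g 0)) x)).symm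

end Spanning

/-! ### Finitely many functions whose differentials span the cotangent spaces -/

section Immersion

open Set Module

variable {E : Type*} [NormedAddCommGroup E] [NormedSpace ℝ E] [FiniteDimensional ℝ E]
  {H : Type*} [TopologicalSpace H] {I : ModelWithCorners ℝ E H} [I.Boundaryless]
  {M : Type*} [TopologicalSpace M] [ChartedSpace H M] [IsManifold I ∞ M]
  {F : Type*} [NormedAddCommGroup F] [NormedSpace ℝ F]

/-- The values of the differential of a smooth map do not exhaust a vector space of dimension
greater than twice the dimension of the manifold. -/
theorem exists_notMem_range_differential [SecondCountableTopology M] [FiniteDimensional ℝ F]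
    (hF : 2 * finrank ℝ E < finrank ℝ F) {g : M → F} (hg : ContMDiff I 𝓘(ℝ, F) ∞ g) :
    ∃ c : F, ∀ x v, differential I g x v ≠ c := by
  have h1 : ∀ x₀ : M, ∃ ε > 0,
      Metric.ball (extChartAt I x₀ x₀) ε ⊆ (extChartAt I x₀).target := fun x₀ =>
    Metric.isOpen_iff.1 (isOpen_extChartAt_target x₀) _ (mem_extChartAt_target x₀)
  choose ε hε hball using h1
  obtain ⟨s, hs, hsU⟩ := TopologicalSpace.countable_cover_nhds
    (f := fun x₀ => (extChartAt I x₀).source ∩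
      extChartAt I x₀ ⁻¹' Metric.ball (extChartAt I x₀ x₀) (ε x₀)) fun x₀ =>
    Filter.inter_mem (extChartAt_source_mem_nhds x₀)
      ((continuousAt_extChartAt x₀).preimage_mem_nhds (Metric.ball_mem_nhds _ (hε x₀)))
  set T : Set F := ⋃ x₀ ∈ s, (fun p : E × E => fderiv ℝ (g ∘ (extChartAt I x₀).symm) p.1 p.2) ''
    (Metric.ball (extChartAt I x₀ x₀) (ε x₀) ×ˢ univ) with hT
  have h2 : dimH T < finrank ℝ F := by
    rw [hT, dimH_bUnion hs]
    refine lt_of_le_of_lt (iSup₂_le fun x₀ _ => ?_ : _ ≤ ((2 * finrank ℝ E : ℕ) : ENNReal))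
      (by exact_mod_cast hF)
    have h3 : ContDiffOn ℝ 1 (fun p : E × E => fderiv ℝ (g ∘ (extChartAt I x₀).symm) p.1 p.2)
        (Metric.ball (extChartAt I x₀ x₀) (ε x₀) ×ˢ univ) := by
      intro p hp
      refine ContDiffAt.contDiffWithinAt ?_
      have h4 := (contDiffAt_comp_symm hg (hball x₀ hp.1)).fderiv_right (m := 1) (by norm_cast)
      exact (h4.comp p contDiffAt_fst).clm_apply contDiffAt_snd
    refine (h3.dimH_image_le ((convex_ball _ _).prod convex_univ) le_rfl).trans ?_
    refine (dimH_mono (subset_univ _)).trans ?_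
    rw [Real.dimH_univ_eq_finrank, finrank_prod, two_mul]
  obtain ⟨c, hc⟩ : ∃ c, c ∉ T := by
    by_contra! h3
    rw [eq_univ_of_forall h3, Real.dimH_univ_eq_finrank] at h2
    exact lt_irrefl _ h2
  refine ⟨c, fun x v hx => hc ?_⟩
  have h3 : x ∈ ⋃ x₀ ∈ s, _ := hsU ▸ mem_univ x
  simp only [mem_iUnion] at h3
  obtain ⟨x₀, hx₀, hxs, hxb⟩ := h3
  have hy := (extChartAt I x₀).map_source hxs
  obtain ⟨D', hD, -⟩ := mfderiv_symm_inverse (I := I) hy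
  refine mem_biUnion hx₀ ⟨(extChartAt I x₀ x, D' v), ⟨hxb, mem_univ _⟩, ?_⟩
  have h4 := DFunLike.congr_fun (differential_comp hg hy) (D' v)
  refine h4.symm.trans (Eq.trans ?_ hx)
  refine (congrArg (differential I g _) (hD v)).trans ?_
  rw [(extChartAt I x₀).left_inv hxs]

/-- A locally finite sequence of functions whose differentials span the cotangent spaces can be
combined into one map to a vector space of sufficiently large dimension. -/
theorem exists_immersion_of_locallyFinite [SecondCountableTopology M] [FiniteDimensional ℝ F]
    (hF : 2 * finrank ℝ E < finrank ℝ F) {h : ℕ → M → ℝ} (hh : ∀ j, ContMDiff I 𝓘(ℝ, ℝ) ∞ (h j))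
    (hfin : LocallyFinite fun j => Function.support (h j))
    (hspan : ∀ x v, (∀ j, differential I (h j) x v = 0) → v = 0) :
    ∃ g : M → F, ContMDiff I 𝓘(ℝ, F) ∞ g ∧ ∀ x v, differential I g x v = 0 → v = 0 := by
  have hex : ∀ g : {g : M → F // ContMDiff I 𝓘(ℝ, F) ∞ g}, ∃ c : F, ∀ x v,
      differential I g.1 x v ≠ c := fun g => exists_notMem_range_differential hF g.2
  choose c hc using hex
  have hsm : ∀ j (e : F), ContMDiff I 𝓘(ℝ, F) ∞ fun x => h j x • e := fun j e =>
    (hh j).smul contMDiff_const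
  set g : ℕ → {g : M → F // ContMDiff I 𝓘(ℝ, F) ∞ g} := fun j => Nat.rec ⟨0, contMDiff_const⟩
    (fun j g => ⟨g.1 + fun x => h j x • c g, g.2.add (hsm j _)⟩) j with hgdef
  have hg0 : (g 0).1 = 0 := rfl
  have hgs : ∀ j, (g (j + 1)).1 = (g j).1 + fun x => h j x • c (g j) := fun _ => rfl
  have hker : ∀ j x v, differential I (g j).1 x v = 0 → ∀ i < j, differential I (h i) x v = 0 := by
    intro j
    induction j with
    | zero => intro x v _ i hi; exact absurd hi (by simp)
    | succ j ih =>
      intro x v hv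
      have h1 : differential I (g j).1 x v + differential I (h j) x v • c (g j) = 0 := by
        rw [← hv, hgs, differential_add (g j).2 (hsm j _)]
        have h2 := differential_clm_comp ((1 : ℝ →L[ℝ] ℝ).smulRight (c (g j))) (hh j) x
        exact congrArg (differential I (g j).1 x v + ·) (DFunLike.congr_fun h2 v).symm
      have h2 : differential I (h j) x v = 0 := by
        by_contra h3
        refine hc (g j) x (-(differential I (h j) x v)⁻¹ • v) ?_
        rw [map_smul, eq_neg_of_add_eq_zero_left h1, smul_neg, neg_smul, neg_neg, smul_smul,
          inv_mul_cancel₀ h3, one_smul]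
      intro i hi
      rcases Nat.lt_succ_iff_lt_or_eq.1 hi with hi | rfl
      · rw [h2, zero_smul, add_zero] at h1
        exact ih x v h1 i hi
      · exact h2
  have hsum : ∀ j x, (g j).1 x = ∑ i ∈ Finset.range j, h i x • c (g i) := by
    intro j x
    induction j with
    | zero => simp [hg0]
    | succ j ih => rw [Finset.sum_range_succ, hgs, Pi.add_apply, ih]
  set G : M → F := fun x => ∑ᶠ i, h i x • c (g i) with hG
  have hloc : ∀ x, ∃ J, ∀ j ≥ J, G =ᶠ[nhds x] (g j).1 := by
    intro x
    obtain ⟨W, hW, hWf⟩ := hfin x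
    obtain ⟨J, hJ⟩ := hWf.bddAbove
    refine ⟨J + 1, fun j hj => ?_⟩
    filter_upwards [hW] with y hy
    rw [hsum, hG]
    refine finsum_eq_sum_of_support_subset _ fun i hi => ?_
    have hi' : h i y ≠ 0 := fun h0 => hi (by simp [h0])
    have := hJ (show i ∈ _ from ⟨y, hi', hy⟩)
    simp only [Finset.coe_range, mem_Iio]
    omega
  refine ⟨G, fun x => ?_, fun x v hv => hspan x v fun i => ?_⟩
  · obtain ⟨J, hJ⟩ := hloc x
    exact ((g J).2 x).congr_of_eventuallyEq (hJ J le_rfl)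
  · obtain ⟨J, hJ⟩ := hloc x
    rw [differential_congr (hJ (J + i + 1) (by omega))] at hv
    exact hker (J + i + 1) x v hv i (by omega)

theorem exists_locallyFinite_spanning [T2Space M] [SecondCountableTopology M] :
    ∃ h : ℕ → M → ℝ, (∀ j, ContMDiff I 𝓘(ℝ, ℝ) ∞ (h j)) ∧
      (LocallyFinite fun j => Function.support (h j)) ∧
      ∀ x v, (∀ j, differential I (h j) x v = 0) → v = 0 := by
  have : LocallyCompactSpace M := Manifold.locallyCompact_of_finiteDimensional I
  obtain ⟨ι, f, -⟩ := SmoothBumpCovering.exists_isSubordinate I (isClosed_univ (X := M))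
    (U := fun _ => univ) fun _ _ => Filter.univ_mem
  have : Countable ι := countable_univ_iff.1
    (f.locallyFinite.countable_univ fun i => (f i).nonempty_support)
  obtain ⟨e, he⟩ := exists_injective_nat (ι × Fin (finrank ℝ E))
  set L : Fin (finrank ℝ E) → E →L[ℝ] ℝ := fun a =>
    LinearMap.toContinuousLinearMap ((finBasis ℝ E).coord a)
  set u : ι → M → E := fun i x => f i x • extChartAt I (f.c i) x
  have hu : ∀ i, ContMDiff I 𝓘(ℝ, E) ∞ (u i) := fun i =>
    (f i).contMDiff_smul contMDiffOn_extChartAt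
  set w : ι × Fin (finrank ℝ E) → M → ℝ := fun p x => L p.2 (u p.1 x)
  have hw : ∀ p, ContMDiff I 𝓘(ℝ, ℝ) ∞ (w p) := fun p =>
    (L p.2).contMDiff.comp (hu p.1)
  refine ⟨Function.extend e w 0, fun j => ?_, fun x => ?_, fun x v hv => ?_⟩
  · by_cases hj : ∃ p, e p = j
    · obtain ⟨p, rfl⟩ := hj
      rw [he.extend_apply]
      exact hw p
    · rw [Function.extend_apply' _ _ _ hj]
      exact contMDiff_const
  · obtain ⟨W, hW, hWf⟩ := f.locallyFinite x
    refine ⟨W, hW, ((hWf.prod (finite_univ (α := Fin (finrank ℝ E)))).image e).subset ?_⟩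
    rintro j ⟨y, (hy : Function.extend e w 0 j y ≠ 0), hyW⟩
    by_cases hj : ∃ p, e p = j
    · obtain ⟨p, rfl⟩ := hj
      rw [he.extend_apply] at hy
      refine ⟨p, ⟨⟨y, fun h0 => hy ?_, hyW⟩, mem_univ _⟩, rfl⟩
      simp [w, u, h0]
    · rw [Function.extend_apply' _ _ _ hj] at hy
      exact absurd rfl hy
  · set i := f.ind x (mem_univ x)
    have h1 : u i =ᶠ[nhds x] extChartAt I (f.c i) := by
      filter_upwards [f.eventuallyEq_one x (mem_univ x)] with y hy
      exact (congrArg (· • extChartAt I (f.c i) y) hy).trans (one_smul _ _)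
    have h2 : differential I (u i) x v = 0 := by
      refine (finBasis ℝ E).ext_elem fun a => ?_
      have h3 := hv (e (i, a))
      rw [he.extend_apply] at h3
      have h4 := DFunLike.congr_fun (differential_clm_comp (L a) (hu i) x) v
      rw [map_zero]
      exact h4.symm.trans h3
    have h3 := mfderiv_symm_mfderiv (J := I) (f.mem_chartAt_ind_source x (mem_univ x)) v
    rw [differential_congr h1] at h2
    refine h3.symm.trans ((congrArg _ h2).trans ?_)
    exact map_zero _

variable (I M) in
/-- Finitely many smooth functions suffice for their differentials to span every cotangent
space. -/
theorem exists_spanning_differentials [T2Space M] [SecondCountableTopology M] :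
    ∃ (N : ℕ) (G : Fin N → M → ℝ), (∀ a, ContMDiff I 𝓘(ℝ, ℝ) ∞ (G a)) ∧
      ∀ x v, (∀ a, differential I (G a) x v = 0) → v = 0 := by
  obtain ⟨h, hh, hfin, hspan⟩ := exists_locallyFinite_spanning (I := I) (M := M)
  obtain ⟨g, hg, hker⟩ := exists_immersion_of_locallyFinite
    (F := Fin (2 * finrank ℝ E + 1) → ℝ) (by simp) hh hfin hspan
  have h1 : ∀ a, ContMDiff I 𝓘(ℝ, ℝ) ∞ fun x => g x a := fun a =>
    (ContinuousLinearMap.proj (R := ℝ) (φ := fun _ => ℝ) a).contMDiff.comp hg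
  refine ⟨_, fun a x => g x a, h1, fun x v hv => hker x v (funext fun a => ?_)⟩
  have h2 := differential_clm_comp (ContinuousLinearMap.proj (R := ℝ) (φ := fun _ => ℝ) a) hg x
  exact (DFunLike.congr_fun h2 v).symm.trans (hv a)

end Immersion

/-! ### Every odd form is a transgression form -/

section Realization

universe u

variable {E : Type u} [NormedAddCommGroup E] [NormedSpace ℝ E] [FiniteDimensional ℝ E]
  {H : Type*} [TopologicalSpace H] {I : ModelWithCorners ℝ E H} [I.Boundaryless]
  {M : Type*} [TopologicalSpace M] [ChartedSpace H M] [IsManifold I ∞ M] {k : ℕ}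

theorem alt_eq_zero_of_finrank_lt (h : Module.finrank ℝ E < k) (η : E [⋀^Fin k]→L[ℝ] ℂ) :
    η = 0 := by
  ext v
  refine η.toAlternatingMap.map_linearDependent v fun hv => ?_
  have := hv.fintype_card_le_finrank
  rw [Fintype.card_fin] at this
  omega

variable [T2Space M] [SecondCountableTopology M]

/-- Every smooth form of degree `2k + 1` is a transgression form whose components of lower degree
vanish. -/
theorem exists_transgression_eq {η : Form I M (2 * k + 1)} (hη : η.IsSmooth) :
    ∃ (r : ℕ) (c : Connection I M r), c.transgression k = η ∧
      ∀ m < k, c.transgression m = 0 := by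
  obtain ⟨N, G, hG, hspan⟩ := exists_spanning_differentials I M
  obtain ⟨b, hb⟩ := exists_sum_products hG hspan
    ((SmoothForm I M _).smul_mem (cyclicCoeff k)⁻¹ hη)
  obtain ⟨r, c, hc⟩ := exists_transgression_sum Finset.univ _ fun g => Connection.cyclic (b g)
  refine ⟨r, c, ?_, fun m hm => ?_⟩
  · funext x
    refine ext_injective x ?_
    rw [hc, ext_sum, Finset.sum_congr rfl fun g _ => Connection.ext_transgression_cyclic_top (b g) x,
      ← Finset.smul_sum, ← hb x, ← map_smul]
    exact congrArg (ext I x) (smul_inv_smul₀ (cyclicCoeff_ne_zero k) (η x))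
  · rw [hc]
    exact Finset.sum_eq_zero fun g _ => Connection.transgression_cyclic_eq_zero (b g) hm

theorem exists_transgressionOdd_eq_of_eq_zero (j m : ℕ) (hj : Module.finrank ℝ E < 2 * (m + j) + 1)
    (α : OddForm I M) (hα : ∀ k < m, (α k : Form I M (2 * k + 1)) = 0) :
    ∃ (r : ℕ) (c : Connection I M r), ∀ k, c.transgression k = α k := by
  induction j generalizing m α with
  | zero =>
    refine ⟨0, Connection.trivial I M 0, fun k => ?_⟩
    rw [Connection.transgression_rank_zero]
    rcases lt_or_ge k m with hk | hk
    · exact (hα k hk).symm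
    · funext x
      exact (alt_eq_zero_of_finrank_lt (E := E) (by omega) _).symm
  | succ j ih =>
    obtain ⟨r, c, hc, hc0⟩ := exists_transgression_eq (α m).2
    obtain ⟨r', c', hc'⟩ := ih (m + 1) (by omega)
      (fun k => α k - ⟨c.transgression k, c.transgression_isSmooth k⟩) fun k hk => by
        refine (AddSubgroupClass.coe_sub _ _).trans (sub_eq_zero.2 ?_)
        rcases Nat.lt_succ_iff_lt_or_eq.1 hk with hk | rfl
        · exact (hα k hk).trans (hc0 k hk).symm
        · exact hc.symm
    refine ⟨_, c.blockSum c', fun k => ?_⟩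
    rw [Connection.transgression_blockSum, hc', Submodule.coe_sub, add_sub_cancel]

/-- Every smooth odd form is the transgression form of a connection on a trivial bundle. -/
theorem exists_transgressionOdd_eq (α : OddForm I M) :
    ∃ (r : ℕ) (c : Connection I M r), c.transgressionOdd = α := by
  obtain ⟨r, c, hc⟩ := exists_transgressionOdd_eq_of_eq_zero (Module.finrank ℝ E) 0 (by omega) α
    fun k hk => absurd hk (by simp)
  exact ⟨r, c, funext fun k => Subtype.ext (hc k)⟩

end Realization

end ChernSimons

end

theorem mainTheorem6 (n : ℕ) (X : Type*) [TopologicalSpace X] [T2Space X]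
    [SecondCountableTopology X] [ChartedSpace (EuclideanSpace ℝ (Fin n)) X]
    [IsManifold (𝓡 n) ∞ X] (α : ChernSimons.OddFormModExact (𝓡 n) X) :
    ∃ (r : ℕ) (c : ChernSimons.Connection (𝓡 n) X r),
      ChernSimons.IsChernSimonsClass c (ChernSimons.Connection.trivial (𝓡 n) X r) α := by
  obtain ⟨a, rfl⟩ := Submodule.mkQ_surjective _ α
  obtain ⟨r, c, rfl⟩ := ChernSimons.exists_transgressionOdd_eq a
  exact ⟨r, c, ChernSimons.isChernSimonsClass_transgression c⟩
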